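/- **Setting.** Let $k$ be a field of characteristic $p>2$. A Lie superalgebra $\mathfrak g=\mathfrak g_{\bar 0}\oplus\mathfrak g_{\bar 1}$ over $k$ satisfies graded skew-symmetry, the graded Jacobi identity and $[x,[x,x]]=0$ for odd $x$ (automatic if $p>3$). It is *restricted* if $\mathfrak g_{\bar 0}$ is a restricted Lie algebra with $p$-operation $x\mapsto x^{[p]}$ and $\mathrm{ad}(x^{[p]})=(\mathrm{ad}\,x)^p$ on all of $\mathfrak g$ for $x\in\mathfrak g_{\bar 0}$. Its restricted enveloping superalgebra is $U'(\mathfrak g)=U(\mathfrak g)/\langle x^p-x^{[p]} : x\in\mathfrak g_{\bar 0}\rangle$, with coproduct $\Delta(u)=\sum u_{(1)}\otimes u_{(2)}$ for which the elements of $\mathfrak g$ are primitive. Let $\mathfrak h\subset\mathfrak g$ be a restricted subsuperalgebra (a graded subspace closed under bracket and $p$-operation) with $\mathfrak g/\mathfrak h$ finite dimensional, put $m=\dim(\mathfrak g/\mathfrak h)_{\bar 1}$, and let $\mathrm{strad}_{\mathfrak g/\mathfrak h}(H)$ be the supertrace of the adjoint action of $H\in\mathfrak h$ on $\mathfrak g/\mathfrak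 h$; it defines a restricted representation $\Pi^m k_{\mathrm{strad}_{\mathfrak g/\mathfrak h}}$ of $\mathfrak h$ on a line of parity $m \bmod 2$. Let $(\pi,V)$ be a restricted representation of $\mathfrak h$ on a superspace $V$. Representations are tensored by $H(x\otimes y)=Hx\otimes y+(-1)^{|H||x|}x\otimes Hy$. The restricted induced module is $\mathrm{Ind}_{U'(\mathfrak h)}^{U'(\mathfrak g)}(W)=U'(\mathfrak g)\otimes_{U'(\mathfrak h)}W$, with left multiplication. The restricted coinduced module $\mathrm{Coind}_{U'(\mathfrak h)}^{U'(\mathfrak g)}(\pi)=\mathrm{Hom}_{U'(\mathfrak h)}(U'(\mathfrak g),V)$ consists of the linear maps $\mu$, written $u\mapsto\langle u,\mu\rangle=(-1)^{|u||\mu|}\mu(u)$, with $\langle au,\mu\rangle=a\langle u,\mu\rangle$ for $a\in U'(\mathfrak h)$; the action $\delta_u$ of $u\in U'(\mathfrak g)$ on it is $\langle w,\delta_u\mu\rangle=\langle wu,\mu\rangle$. Let $\mathcal A=\mathrm{Coind}_{U'(\mathfrak h)}^{U'(\mathfrak g)}(k)$; the formula $\langle u,\lambda\mu\rangle=\sum(-1)^{|\lambda||u_{(2)}|}\langle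 u_{(1)},\lambda\rangle\langle u_{(2)},\mu\rangle$ defines the product of $\mathcal A$ and the action of $\mathcal A$ on $\mathrm{Coind}_{U'(\mathfrak h)}^{U'(\mathfrak g)}(\pi)$. **Theorem.** There is a parity preserving isomorphism of $U'(\mathfrak g)$-modules $$\mathrm{Ind}_{U'(\mathfrak h)}^{U'(\mathfrak g)}\big(\Pi^m k_{\mathrm{strad}_{\mathfrak g/\mathfrak h}}\otimes\pi\big)\;\cong\;\mathrm{Coind}_{U'(\mathfrak h)}^{U'(\mathfrak g)}(\pi).$$ More precisely, let $e_1,\dots,e_n$ (even) and $\epsilon_1,\dots,\epsilon_m$ (odd) form a basis of a supplement of $\mathfrak h$ in $\mathfrak g$. There are unique elements $\eta_i,\zeta_s\in\mathcal A$ and $\hat v\in\mathrm{Coind}_{U'(\mathfrak h)}^{U'(\mathfrak g)}(\pi)$ ($1\le i\le n$, $1\le s\le m$, $v\in V$) which take the values $1$, $1$, $v$ on the monomials $e_i$, $\epsilon_s$, $1$ respectively, and vanish on all the other monomials $e_1^{a_1}\cdots e_n^{a_n}\epsilon_1^{\alpha_1}\cdots\epsilon_m^{\alpha_m}$ with $0\le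 a_i\le p-1$, $\alpha_s\in\{0,1\}$. Put $\Lambda=\eta_1^{p-1}\cdots\eta_n^{p-1}\zeta_1\cdots\zeta_m\in\mathcal A$. Then: 1. $\Lambda$ is nonzero, of parity $m \bmod 2$, and $\delta_H(\Lambda)=\mathrm{strad}_{\mathfrak g/\mathfrak h}(H)\,\Lambda$ for all $H\in\mathfrak h$; thus $k\Lambda\cong\Pi^m k_{\mathrm{strad}_{\mathfrak g/\mathfrak h}}$ as $\mathfrak h$-modules. 2. Identifying $\Pi^m k_{\mathrm{strad}_{\mathfrak g/\mathfrak h}}$ with $k\Lambda$, the map $$\Phi:\ \mathrm{Ind}_{U'(\mathfrak h)}^{U'(\mathfrak g)}\big(\Pi^m k_{\mathrm{strad}_{\mathfrak g/\mathfrak h}}\otimes\pi\big)\to\mathrm{Coind}_{U'(\mathfrak h)}^{U'(\mathfrak g)}(\pi),\qquad u\otimes(\Lambda\otimes v)\mapsto\delta_u(\Lambda\hat v),$$ is a well defined, parity preserving isomorphism of $U'(\mathfrak g)$-modules. -/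

import Mathlib

open scoped TensorProduct

set_option linter.unusedSectionVars false

noncomputable section

namespace RestrictedSuper

/-! ### Superspaces -/

/-- The sign `(-1) ^ i` in `k`, for a parity `i`. -/
def psign (k : Type*) [Field k] (i : ZMod 2) : k := if i = 0 then 1 else -1

theorem zmod2_cases (i : ZMod 2) : i = 0 ∨ i = 1 := by
  revert i; decide

@[simp] theorem psign_zero (k : Type*) [Field k] : psign k 0 = 1 := by simp [psign]

@[simp] theorem psign_one (k : Type*) [Field k] : psign k 1 = -1 := by simp [psign]

theorem psign_add (k : Type*) [Field k] (i j : ZMod 2) :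
    psign k (i + j) = psign k i * psign k j := by
  have h11 : (1 + 1 : ZMod 2) = 0 := by decide
  rcases zmod2_cases i with rfl | rfl <;> rcases zmod2_cases j with rfl | rfl <;> simp [h11]

theorem psign_mul_self (k : Type*) [Field k] (i : ZMod 2) : psign k i * psign k i = 1 := by
  rcases zmod2_cases i with rfl | rfl <;> simp

/-- A superspace structure on the vector space `V`: a decomposition `V = V₀ ⊕ V₁`. -/
structure SuperGrading (k : Type*) [Field k] (V : Type*) [AddCommGroup V] [Module k V] where
  /-- The homogeneous elements of a given parity. -/
  deg : ZMod 2 → Submodule k V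
  isCompl : IsCompl (deg 0) (deg 1)

namespace SuperGrading

section

variable {k : Type*} [Field k] {V : Type*} [AddCommGroup V] [Module k V] (G : SuperGrading k V)

/-- The projection of `V` to its homogeneous part of parity `i`. -/
def proj (i : ZMod 2) : Module.End k V :=
  if i = 0 then (G.deg 0).projection (G.deg 1) G.isCompl
  else (G.deg 1).projection (G.deg 0) G.isCompl.symm

/-- The parity operator `v ↦ (-1) ^ |v| v`. -/
def parity : Module.End k V := G.proj 0 - G.proj 1

/-- The operator `v ↦ (-1) ^ (i|v|) v`. -/
def signOp (i : ZMod 2) : Module.End k V := if i = 0 then 1 else G.parity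

@[simp] theorem signOp_zero : G.signOp 0 = 1 := by simp [signOp]

@[simp] theorem signOp_one : G.signOp 1 = G.parity := by simp [signOp]

theorem proj_mem (i : ZMod 2) (v : V) : G.proj i v ∈ G.deg i := by
  rcases zmod2_cases i with rfl | rfl
  · simp only [proj, if_true]; exact Submodule.projection_apply_mem _ _
  · simp only [proj, one_ne_zero, if_false]; exact Submodule.projection_apply_mem _ _

theorem proj_add (v : V) : G.proj 0 v + G.proj 1 v = v := by
  simp only [proj, one_ne_zero, if_false, if_true]
  exact Submodule.projection_add_projection_eq_self _ _

theorem proj_self {i : ZMod 2} {v : V} (hv : v ∈ G.deg i) : G.proj i v = v := by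
  rcases zmod2_cases i with rfl | rfl
  · simp only [proj, if_true]; exact Submodule.projection_apply_of_mem_left _ hv
  · simp only [proj, one_ne_zero, if_false]; exact Submodule.projection_apply_of_mem_left _ hv

theorem proj_ne {i j : ZMod 2} (hij : i ≠ j) {v : V} (hv : v ∈ G.deg i) : G.proj j v = 0 := by
  have h1 := G.proj_add v
  have h2 := G.proj_self hv
  rcases zmod2_cases i with rfl | rfl <;> rcases zmod2_cases j with rfl | rfl
  · exact absurd rfl hij
  · rwa [h2, add_eq_left] at h1
  · rwa [h2, add_eq_right] at h1
  · exact absurd rfl hij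

theorem parity_of_mem {i : ZMod 2} {v : V} (hv : v ∈ G.deg i) : G.parity v = psign k i • v := by
  rcases zmod2_cases i with rfl | rfl
  · simp [parity, G.proj_self hv, G.proj_ne (show (0 : ZMod 2) ≠ 1 by decide) hv]
  · simp [parity, G.proj_self hv, G.proj_ne (show (1 : ZMod 2) ≠ 0 by decide) hv]

theorem parity_parity (v : V) : G.parity (G.parity v) = v := by
  have h0 := G.parity_of_mem (G.proj_mem 0 v)
  have h1 := G.parity_of_mem (G.proj_mem 1 v)
  have : G.parity v = G.proj 0 v - G.proj 1 v := rfl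
  rw [this, map_sub, h0, h1]
  simp [G.proj_add]

theorem signOp_of_mem (i : ZMod 2) {j : ZMod 2} {v : V} (hv : v ∈ G.deg j) :
    G.signOp i v = psign k (i * j) • v := by
  rcases zmod2_cases i with rfl | rfl
  · simp
  · simp [G.parity_of_mem hv]

theorem signOp_mul (i j : ZMod 2) : G.signOp i * G.signOp j = G.signOp (i + j) := by
  have h11 : (1 + 1 : ZMod 2) = 0 := by decide
  have h : G.parity * G.parity = 1 := LinearMap.ext G.parity_parity
  rcases zmod2_cases i with rfl | rfl <;> rcases zmod2_cases j with rfl | rfl <;> simp [h11, h]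

theorem mem_deg_iff (h2 : (2 : k) ≠ 0) {i : ZMod 2} {v : V} :
    v ∈ G.deg i ↔ G.parity v = psign k i • v := by
  refine ⟨G.parity_of_mem, fun h => ?_⟩
  have e : G.parity v = G.proj 0 v - G.proj 1 v := rfl
  have s := G.proj_add v
  rw [e] at h
  rcases zmod2_cases i with rfl | rfl
  · have : (2 : k) • v = (2 : k) • G.proj 0 v := by
      rw [psign_zero, one_smul] at h
      rw [two_smul, two_smul]
      calc v + v = (G.proj 0 v - G.proj 1 v) + (G.proj 0 v + G.proj 1 v) := by rw [h, s]
        _ = _ := by abel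
    rw [(smul_right_injective V h2 this : v = G.proj 0 v)]
    exact G.proj_mem _ _
  · have : (2 : k) • v = (2 : k) • G.proj 1 v := by
      rw [psign_one, neg_one_smul] at h
      have h' : v = G.proj 1 v - G.proj 0 v := by rw [← neg_sub, h, neg_neg]
      rw [two_smul, two_smul]
      calc v + v = (G.proj 1 v - G.proj 0 v) + (G.proj 0 v + G.proj 1 v) := by rw [← h', s]
        _ = _ := by abel
    rw [(smul_right_injective V h2 this : v = G.proj 1 v)]
    exact G.proj_mem _ _

end

section

variable {k : Type*} [Field k] {V : Type*} [AddCommGroup V] [Module k V]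

/-- The superspace structure whose parity operator is a given involution `γ`
(in characteristic different from two). -/
def ofInvolution (h2 : (2 : k) ≠ 0) (γ : Module.End k V) (hγ : ∀ v, γ (γ v) = v) :
    SuperGrading k V where
  deg i := LinearMap.ker (γ - psign k i • (1 : Module.End k V))
  isCompl := by
    constructor
    · rw [Submodule.disjoint_def]
      intro v h0 h1
      simp only [LinearMap.mem_ker, LinearMap.sub_apply, LinearMap.add_apply, Module.End.one_apply,
        psign_zero, psign_one, one_smul, neg_smul, sub_neg_eq_add] at h0 h1
      rw [sub_eq_zero] at h0
      rw [h0, ← two_smul k] at h1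
      exact (smul_eq_zero.mp h1).resolve_left h2
    · rw [codisjoint_iff, Submodule.eq_top_iff']
      intro v
      rw [Submodule.mem_sup]
      refine ⟨(2 : k)⁻¹ • (v + γ v), ?_, (2 : k)⁻¹ • (v - γ v), ?_, ?_⟩
      · simp [hγ, add_comm]
      · simp [hγ]
      · rw [← smul_add, add_add_sub_cancel, ← two_smul k, smul_smul, inv_mul_cancel₀ h2, one_smul]

theorem mem_ofInvolution (h2 : (2 : k) ≠ 0) (γ : Module.End k V) (hγ : ∀ v, γ (γ v) = v)
    {i : ZMod 2} {v : V} : v ∈ (ofInvolution h2 γ hγ).deg i ↔ γ v = psign k i • v := by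
  simp [ofInvolution, sub_eq_zero]

theorem parity_ofInvolution (h2 : (2 : k) ≠ 0) (γ : Module.End k V) (hγ : ∀ v, γ (γ v) = v)
    (v : V) : (ofInvolution h2 γ hγ).parity v = γ v := by
  set G := ofInvolution h2 γ hγ
  have h0 := (mem_ofInvolution h2 γ hγ).1 (G.proj_mem 0 v)
  have h1 := (mem_ofInvolution h2 γ hγ).1 (G.proj_mem 1 v)
  have e : G.parity v = G.proj 0 v - G.proj 1 v := rfl
  rw [e]
  nth_rewrite 3 [← G.proj_add v]
  rw [map_add, h0, h1]
  simp [sub_eq_add_neg]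

/-- The field `k`, placed in parity `j`; for `j = m mod 2` this is `Πᵐ k`. -/
def shifted (k : Type*) [Field k] (j : ZMod 2) : SuperGrading k k where
  deg i := if i = j then ⊤ else ⊥
  isCompl := by
    rcases zmod2_cases j with rfl | rfl
    · simpa using isCompl_top_bot
    · simpa using isCompl_bot_top

/-- The tensor product of two superspaces: `|v ⊗ w| = |v| + |w|`. -/
def tensor (h2 : (2 : k) ≠ 0) {W : Type*} [AddCommGroup W] [Module k W]
    (G : SuperGrading k V) (H : SuperGrading k W) : SuperGrading k (V ⊗[k] W) :=
  ofInvolution h2 (TensorProduct.map G.parity H.parity) (by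
    intro t
    rw [← LinearMap.comp_apply, ← TensorProduct.map_comp]
    have h1 : G.parity ∘ₗ G.parity = LinearMap.id := LinearMap.ext G.parity_parity
    have h2 : H.parity ∘ₗ H.parity = LinearMap.id := LinearMap.ext H.parity_parity
    rw [h1, h2, TensorProduct.map_id, LinearMap.id_apply])

/-- The supertrace of an endomorphism `f` of a superspace: the trace of the diagonal block
`V₀ → V₀` of `f` minus the trace of the diagonal block `V₁ → V₁`. -/
def supertrace (G : SuperGrading k V) : Module.End k V →ₗ[k] k :=
  LinearMap.trace k V ∘ₗ LinearMap.mulLeft k (G.proj 0) -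
    LinearMap.trace k V ∘ₗ LinearMap.mulLeft k (G.proj 1)

theorem supertrace_apply (G : SuperGrading k V) (f : Module.End k V) :
    G.supertrace f = LinearMap.trace k V (G.parity * f) := by
  simp [supertrace, parity, sub_mul]

end

end SuperGrading

/-! ### Restricted Lie superalgebras -/

/-- A restricted Lie superalgebra over a field `k` of characteristic `p > 2`, with underlying
vector space `L`. The first fields are those of a Lie superalgebra; `bracket_odd_cube` follows
from `jacobi` unless `p = 3`. The remaining ones say that the even part is a restricted Lie
algebra (`pmap_add` is Jacobson's formula `(x + y)^[p] = x^[p] + y^[p] + ∑ sᵢ(x, y)`, where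
`i sᵢ(x, y)` is the coefficient of `t ^ (i - 1)` in `ad (t x + y) ^ (p - 1) x`) and that
`ad (x^[p]) = (ad x) ^ p` on the even part and on the odd part. -/
structure RestrictedLieSuperalgebra (k : Type*) [Field k] (p : ℕ) (L : Type*) [AddCommGroup L]
    [Module k L] where
  grading : SuperGrading k L
  bracket : L →ₗ[k] L →ₗ[k] L
  bracket_mem : ∀ {i j : ZMod 2} {x y : L}, x ∈ grading.deg i → y ∈ grading.deg j →
    bracket x y ∈ grading.deg (i + j)
  bracket_skew : ∀ {i j : ZMod 2} {x y : L}, x ∈ grading.deg i → y ∈ grading.deg j →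
    bracket x y = -(psign k (i * j) • bracket y x)
  jacobi : ∀ {i j l : ZMod 2} {x y z : L}, x ∈ grading.deg i → y ∈ grading.deg j →
    z ∈ grading.deg l →
    bracket x (bracket y z) = bracket (bracket x y) z + psign k (i * j) • bracket y (bracket x z)
  bracket_odd_cube : ∀ {x : L}, x ∈ grading.deg 1 → bracket x (bracket x x) = 0
  /-- The `p`-operation `x ↦ x^[p]` on the even part. -/
  pmap : grading.deg 0 → grading.deg 0
  pmap_smul : ∀ (c : k) (x : grading.deg 0), pmap (c • x) = c ^ p • pmap x
  pmap_add : ∀ x y : grading.deg 0, (pmap (x + y) : L) = pmap x + pmap y +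
    ∑ i ∈ Finset.Icc 1 (p - 1), (i : k)⁻¹ •
      ((Polynomial.X * Polynomial.C (bracket x) + Polynomial.C (bracket y) :
        Polynomial (Module.End k L)) ^ (p - 1)).coeff (i - 1) (x : L)
  bracket_pmap : ∀ (x : grading.deg 0) (y : L),
    bracket (pmap x : L) y = ((bracket (x : L) : Module.End k L) ^ p) y

namespace RestrictedLieSuperalgebra

variable {k : Type*} [Field k] {p : ℕ} {L : Type*} [AddCommGroup L] [Module k L]

/-- A restricted subsuperalgebra: a homogeneous subspace closed under the bracket and under the
`p`-operation. -/
structure Sub (g : RestrictedLieSuperalgebra k p L) where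
  carrier : Submodule k L
  proj_mem : ∀ (i : ZMod 2) {x : L}, x ∈ carrier → g.grading.proj i x ∈ carrier
  bracket_mem : ∀ {x y : L}, x ∈ carrier → y ∈ carrier → g.bracket x y ∈ carrier
  pmap_mem : ∀ x : g.grading.deg 0, (x : L) ∈ carrier → (g.pmap x : L) ∈ carrier

/-- A restricted representation of `g` on the vector space `V`: a superspace structure on `V` and
an even linear map `g → gl(V)` compatible with the superbracket and with the `p`-operation. -/
structure Rep (g : RestrictedLieSuperalgebra k p L) (V : Type*) [AddCommGroup V] [Module k V] where
  grading : SuperGrading k V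
  act : L →ₗ[k] Module.End k V
  act_mem : ∀ {i j : ZMod 2} {x : L} {v : V}, x ∈ g.grading.deg i → v ∈ grading.deg j →
    act x v ∈ grading.deg (i + j)
  act_bracket : ∀ {i j : ZMod 2} {x y : L}, x ∈ g.grading.deg i → y ∈ g.grading.deg j →
    act (g.bracket x y) = act x * act y - psign k (i * j) • (act y * act x)
  act_pmap : ∀ x : g.grading.deg 0, act (g.pmap x) = act x ^ p

/-! ### The restricted enveloping superalgebra -/

/-- The relations `x y = (-1)^(|x||y|) y x + [x, y]` of the enveloping superalgebra, together with
the relations `x ^ p = x^[p]` for even `x`. -/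
inductive EnvRel (g : RestrictedLieSuperalgebra k p L) :
    TensorAlgebra k L → TensorAlgebra k L → Prop
  | bracket {i j : ZMod 2} {x y : L} (hx : x ∈ g.grading.deg i) (hy : y ∈ g.grading.deg j) :
      EnvRel g (TensorAlgebra.ι k x * TensorAlgebra.ι k y)
        (psign k (i * j) • (TensorAlgebra.ι k y * TensorAlgebra.ι k x) +
          TensorAlgebra.ι k (g.bracket x y))
  | pow (x : g.grading.deg 0) :
      EnvRel g (TensorAlgebra.ι k (x : L) ^ p) (TensorAlgebra.ι k (g.pmap x : L))

/-- The restricted enveloping superalgebra `U'(g)`. -/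
def Env (g : RestrictedLieSuperalgebra k p L) : Type _ := RingQuot g.EnvRel

instance (g : RestrictedLieSuperalgebra k p L) : Ring g.Env :=
  inferInstanceAs (Ring (RingQuot g.EnvRel))

instance (g : RestrictedLieSuperalgebra k p L) : Algebra k g.Env :=
  inferInstanceAs (Algebra k (RingQuot g.EnvRel))

/-- The quotient map from the tensor algebra. -/
def mkEnv (g : RestrictedLieSuperalgebra k p L) : TensorAlgebra k L →ₐ[k] g.Env :=
  RingQuot.mkAlgHom k g.EnvRel

/-- The canonical map `g → U'(g)`. -/
def ι (g : RestrictedLieSuperalgebra k p L) : L →ₗ[k] g.Env :=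
  g.mkEnv.toLinearMap ∘ₗ TensorAlgebra.ι k

theorem ι_mul_ι (g : RestrictedLieSuperalgebra k p L) {i j : ZMod 2} {x y : L}
    (hx : x ∈ g.grading.deg i) (hy : y ∈ g.grading.deg j) :
    g.ι x * g.ι y = psign k (i * j) • (g.ι y * g.ι x) + g.ι (g.bracket x y) := by
  have h : g.mkEnv _ = g.mkEnv _ := RingQuot.mkAlgHom_rel k (EnvRel.bracket (g := g) hx hy)
  rw [map_mul, map_add, map_smul, map_mul] at h
  exact h

theorem ι_pow (g : RestrictedLieSuperalgebra k p L) (x : g.grading.deg 0) :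
    g.ι x ^ p = g.ι (g.pmap x) := by
  have h : g.mkEnv _ = g.mkEnv _ := RingQuot.mkAlgHom_rel k (EnvRel.pow (g := g) x)
  rw [map_pow] at h
  exact h

/-- The universal property of `U'(g)`. -/
def lift (g : RestrictedLieSuperalgebra k p L) {A : Type*} [Ring A] [Algebra k A] (f : L →ₗ[k] A)
    (hf : ∀ {i j : ZMod 2} {x y : L}, x ∈ g.grading.deg i → y ∈ g.grading.deg j →
      f x * f y = psign k (i * j) • (f y * f x) + f (g.bracket x y))
    (hp : ∀ x : g.grading.deg 0, f x ^ p = f (g.pmap x)) : g.Env →ₐ[k] A :=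
  RingQuot.liftAlgHom k ⟨TensorAlgebra.lift k f, by
    intro a b hab
    induction hab with
    | bracket hx hy =>
      simp only [map_mul, map_add, map_smul, TensorAlgebra.lift_ι_apply]
      exact hf hx hy
    | pow x =>
      simp only [map_pow, TensorAlgebra.lift_ι_apply]
      exact hp x⟩

@[simp] theorem lift_ι (g : RestrictedLieSuperalgebra k p L) {A : Type*} [Ring A] [Algebra k A]
    (f : L →ₗ[k] A) (hf) (hp) (x : L) : g.lift f hf hp (g.ι x) = f x := by
  have h := RingQuot.liftAlgHom_mkAlgHom_apply k (TensorAlgebra.lift k f) (s := g.EnvRel)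
    (by
      intro a b hab
      induction hab with
      | bracket hx hy =>
        simp only [map_mul, map_add, map_smul, TensorAlgebra.lift_ι_apply]
        exact hf hx hy
      | pow x =>
        simp only [map_pow, TensorAlgebra.lift_ι_apply]
        exact hp x) (TensorAlgebra.ι k x)
  rw [TensorAlgebra.lift_ι_apply] at h
  exact h

@[ext] theorem env_hom_ext (g : RestrictedLieSuperalgebra k p L) {A : Type*} [Ring A] [Algebra k A]
    {f₁ f₂ : g.Env →ₐ[k] A} (h : ∀ x, f₁ (g.ι x) = f₂ (g.ι x)) : f₁ = f₂ := by
  have h' : f₁.comp g.mkEnv = f₂.comp g.mkEnv := TensorAlgebra.hom_ext (LinearMap.ext h)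
  exact RingQuot.ringQuot_ext' k (s := g.EnvRel) (f := f₁) f₂ h'

theorem env_induction (g : RestrictedLieSuperalgebra k p L) {P : g.Env → Prop}
    (h_scalar : ∀ c : k, P (algebraMap k _ c)) (h_ι : ∀ x, P (g.ι x))
    (h_mul : ∀ a b, P a → P b → P (a * b)) (h_add : ∀ a b, P a → P b → P (a + b)) (a : g.Env) :
    P a := by
  obtain ⟨t, rfl⟩ := RingQuot.mkAlgHom_surjective k g.EnvRel a
  induction t using TensorAlgebra.induction with
  | algebraMap r => rw [AlgHom.commutes]; exact h_scalar r
  | ι x => exact h_ι x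
  | mul a b ha hb => rw [map_mul]; exact h_mul _ _ ha hb
  | add a b ha hb => rw [map_add]; exact h_add _ _ ha hb

/-- The `U'(g)`-module structure of a restricted representation of `g`. -/
def Rep.env {g : RestrictedLieSuperalgebra k p L} {V : Type*} [AddCommGroup V] [Module k V]
    (ρ : g.Rep V) : g.Env →ₐ[k] Module.End k V :=
  g.lift ρ.act (fun hx hy => by rw [ρ.act_bracket hx hy]; abel) (fun x => (ρ.act_pmap x).symm)

end RestrictedLieSuperalgebra

theorem SuperGrading.isInternal {k : Type*} [Field k] {V : Type*} [AddCommGroup V] [Module k V]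
    (G : SuperGrading k V) : DirectSum.IsInternal G.deg :=
  (DirectSum.isInternal_submodule_iff_isCompl G.deg (i := 0) (j := 1) (by decide)
    (by ext i; simpa using zmod2_cases i)).2 G.isCompl

theorem psign_smul (k : Type*) [Field k] {V : Type*} [AddCommGroup V] [Module k V] (i : ZMod 2)
    (v : V) : ((-1 : ℤˣ) ^ i) • v = psign k i • v := by
  rcases zmod2_cases i with rfl | rfl <;> simp [Units.smul_def]

theorem two_ne_zero_of_char (k : Type*) [Field k] (p : ℕ) [CharP k p] [Fact (2 < p)] :
    (2 : k) ≠ 0 := by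
  intro h
  have h' : ((2 : ℕ) : k) = 0 := by exact_mod_cast h
  rw [CharP.cast_eq_zero_iff k p] at h'
  exact absurd (Nat.le_of_dvd (by norm_num) h') (not_le.2 Fact.out)

theorem add_pow_char_of_commute' {k : Type*} [Field k] (p : ℕ) [CharP k p] [Fact p.Prime]
    {A : Type*} [Ring A] [Algebra k A] {a b : A} (h : Commute a b) :
    (a + b) ^ p = a ^ p + b ^ p := by
  obtain ⟨r, hr⟩ := h.exists_add_pow_prime_eq (Fact.out : p.Prime)
  have : (p : A) = 0 := by
    rw [← map_natCast (algebraMap k A), CharP.cast_eq_zero, map_zero]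
  rw [hr, this]
  simp

namespace RestrictedLieSuperalgebra

variable {k : Type*} [Field k] {p : ℕ} {L : Type*} [AddCommGroup L] [Module k L]

section Hopf

variable [CharP k p] [Fact p.Prime] [Fact (2 < p)] (g : RestrictedLieSuperalgebra k p L)

/-- The counit of `U'(g)`: the morphism `U'(g) → k` that vanishes on `g`. -/
def counit : g.Env →ₐ[k] k :=
  g.lift (0 : L →ₗ[k] k) (fun _ _ => by simp)
    (fun _ => by simp [zero_pow (Fact.out : p.Prime).ne_zero])

@[simp] theorem counit_ι (x : L) : g.counit (g.ι x) = 0 := by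
  simp [counit]

/-- The automorphism of `U'(g)` extending the parity operator of `g`: it multiplies a product of
homogeneous elements `x₁ ⋯ xᵣ` of `g` by `(-1) ^ (|x₁| + ⋯ + |xᵣ|)`. -/
def envParity : g.Env →ₐ[k] g.Env :=
  g.lift (g.ι ∘ₗ g.grading.parity)
    (by
      intro i j x y hx hy
      simp only [LinearMap.comp_apply, g.grading.parity_of_mem hx, g.grading.parity_of_mem hy,
        g.grading.parity_of_mem (g.bracket_mem hx hy), map_smul, smul_mul_smul_comm, psign_add]
      rw [g.ι_mul_ι hx hy, smul_add, smul_comm (psign k (i * j)), mul_comm (psign k j)])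
    (by
      intro x
      simp only [LinearMap.comp_apply, g.grading.parity_of_mem x.2,
        g.grading.parity_of_mem (g.pmap x).2, psign_zero, one_smul]
      exact g.ι_pow x)

@[simp] theorem envParity_ι (x : L) : g.envParity (g.ι x) = g.ι (g.grading.parity x) :=
  g.lift_ι _ _ _ _

theorem envParity_envParity (a : g.Env) : g.envParity (g.envParity a) = a := by
  have : g.envParity.comp g.envParity = AlgHom.id k _ := by
    ext x
    simp [SuperGrading.parity_parity]
  exact DFunLike.congr_fun this a

/-- The superspace structure of `U'(g)`: a product `x₁ ⋯ xᵣ` of homogeneous elements of `g` has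
parity `|x₁| + ⋯ + |xᵣ|`. -/
def envGrading : SuperGrading k g.Env :=
  SuperGrading.ofInvolution (two_ne_zero_of_char k p) g.envParity.toLinearMap g.envParity_envParity

theorem mem_envGrading {i : ZMod 2} {a : g.Env} :
    a ∈ g.envGrading.deg i ↔ g.envParity a = psign k i • a :=
  SuperGrading.mem_ofInvolution _ _ _

theorem parity_envGrading (a : g.Env) : g.envGrading.parity a = g.envParity a :=
  SuperGrading.parity_ofInvolution _ _ _ _

theorem ι_mem {i : ZMod 2} {x : L} (hx : x ∈ g.grading.deg i) :
    g.ι x ∈ g.envGrading.deg i := by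
  rw [mem_envGrading, envParity_ι, g.grading.parity_of_mem hx, map_smul]

theorem one_mem : (1 : g.Env) ∈ g.envGrading.deg 0 := by
  rw [mem_envGrading]; simp

theorem mul_mem {i j : ZMod 2} {a b : g.Env} (ha : a ∈ g.envGrading.deg i)
    (hb : b ∈ g.envGrading.deg j) : a * b ∈ g.envGrading.deg (i + j) := by
  rw [mem_envGrading] at *
  rw [map_mul, ha, hb, smul_mul_smul_comm, psign_add]

instance : GradedAlgebra g.envGrading.deg :=
  { g.envGrading.isInternal.chooseDecomposition with
    one_mem := g.one_mem
    mul_mem := fun _ _ _ _ ha hb => g.mul_mem ha hb }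

/-- `U'(g) ⊗ U'(g)` with the product `(a ⊗ b)(a' ⊗ b') = (-1) ^ (|b||a'|) aa' ⊗ bb'`. -/
abbrev EnvTensor : Type _ := GradedTensorProduct k g.envGrading.deg g.envGrading.deg

/-- The elementary tensor `a ⊗ b`. -/
def tmul (a b : g.Env) : g.EnvTensor := GradedTensorProduct.tmul k a b

theorem tmul_mul_tmul {i j : ZMod 2} (a : g.Env) {b a' : g.Env} (b' : g.Env)
    (hb : b ∈ g.envGrading.deg i) (ha' : a' ∈ g.envGrading.deg j) :
    g.tmul a b * g.tmul a' b' = psign k (i * j) • g.tmul (a * a') (b * b') := by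
  have h := GradedTensorProduct.tmul_coe_mul_coe_tmul g.envGrading.deg g.envGrading.deg
    a ⟨b, hb⟩ ⟨a', ha'⟩ b'
  rw [psign_smul k] at h
  exact h

/-- The map `x ↦ x ⊗ 1 + 1 ⊗ x`. -/
def primitive : L →ₗ[k] g.EnvTensor :=
  (GradedTensorProduct.includeLeft g.envGrading.deg g.envGrading.deg).toLinearMap ∘ₗ g.ι +
    (GradedTensorProduct.includeRight g.envGrading.deg g.envGrading.deg).toLinearMap ∘ₗ g.ι

theorem primitive_apply (x : L) : g.primitive x = g.tmul (g.ι x) 1 + g.tmul 1 (g.ι x) := rfl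

theorem tmul_add (a b b' : g.Env) : g.tmul a (b + b') = g.tmul a b + g.tmul a b' := by
  simp [tmul, GradedTensorProduct.tmul, TensorProduct.tmul_add]

theorem add_tmul (a a' b : g.Env) : g.tmul (a + a') b = g.tmul a b + g.tmul a' b := by
  simp [tmul, GradedTensorProduct.tmul, TensorProduct.add_tmul]

theorem tmul_smul (c : k) (a b : g.Env) : g.tmul a (c • b) = c • g.tmul a b := by
  simp [tmul, GradedTensorProduct.tmul]

theorem smul_tmul (c : k) (a b : g.Env) : g.tmul (c • a) b = c • g.tmul a b := by
  rw [tmul, GradedTensorProduct.tmul, ← TensorProduct.smul_tmul', map_smul]; rfl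

/-- The coproduct of `U'(g)`: the morphism of superalgebras for which the elements of `g` are
primitive. -/
def comul : g.Env →ₐ[k] g.EnvTensor :=
  g.lift g.primitive
    (by
      intro i j x y hx hy
      have hx' := g.ι_mem hx
      have hy' := g.ι_mem hy
      simp only [primitive_apply, mul_add, add_mul, g.tmul_mul_tmul _ _ g.one_mem hy',
        g.tmul_mul_tmul _ _ hx' g.one_mem, g.tmul_mul_tmul _ _ hx' hy',
        g.tmul_mul_tmul _ _ g.one_mem hx', g.tmul_mul_tmul _ _ hy' g.one_mem,
        g.tmul_mul_tmul _ _ hy' hx', g.tmul_mul_tmul _ _ g.one_mem g.one_mem,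
        zero_mul, mul_zero, psign_zero, one_smul, mul_one, one_mul]
      rw [g.ι_mul_ι hx hy]
      simp only [tmul_add, add_tmul, tmul_smul, smul_tmul, smul_add, smul_smul, mul_comm j i,
        psign_mul_self, one_smul]
      abel)
    (by
      intro x
      have hx' := g.ι_mem x.2
      have hl : ∀ n : ℕ, g.tmul (g.ι x) 1 ^ n = g.tmul (g.ι x ^ n) 1 := fun n =>
        (map_pow (GradedTensorProduct.includeLeft g.envGrading.deg g.envGrading.deg) _ n).symm
      have hr : ∀ n : ℕ, g.tmul 1 (g.ι x) ^ n = g.tmul 1 (g.ι x ^ n) := fun n =>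
        (map_pow (GradedTensorProduct.includeRight g.envGrading.deg g.envGrading.deg) _ n).symm
      have hc : Commute (g.tmul (g.ι x) 1) (g.tmul 1 (g.ι x)) := by
        simp only [Commute, SemiconjBy, g.tmul_mul_tmul _ _ g.one_mem g.one_mem,
          g.tmul_mul_tmul _ _ hx' hx', zero_mul, psign_zero, one_smul, mul_one, one_mul]
      rw [primitive_apply, primitive_apply, add_pow_char_of_commute' (k := k) p hc, hl, hr,
        g.ι_pow x])

theorem comul_ι (x : L) : g.comul (g.ι x) = g.tmul (g.ι x) 1 + g.tmul 1 (g.ι x) :=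
  g.lift_ι _ _ _ _

end Hopf

/-! ### Operations on restricted representations -/

section Reps

variable [CharP k p] [Fact p.Prime] [Fact (2 < p)] {g : RestrictedLieSuperalgebra k p L}

theorem Rep.act_parity {V : Type*} [AddCommGroup V] [Module k V] (ρ : g.Rep V) {i : ZMod 2} {x : L}
    (hx : x ∈ g.grading.deg i) (v : V) :
    ρ.grading.parity (ρ.act x v) = psign k i • ρ.act x (ρ.grading.parity v) := by
  have key : ∀ {j : ZMod 2} {w : V}, w ∈ ρ.grading.deg j →
      ρ.grading.parity (ρ.act x w) = psign k i • ρ.act x (ρ.grading.parity w) := by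
    intro j w hw
    rw [ρ.grading.parity_of_mem (ρ.act_mem hx hw), ρ.grading.parity_of_mem hw, map_smul, smul_smul,
      psign_add]
  rw [← ρ.grading.proj_add v]
  simp only [map_add, smul_add]
  rw [key (ρ.grading.proj_mem 0 v), key (ρ.grading.proj_mem 1 v)]

/-- The trivial representation. -/
def trivialRep (g : RestrictedLieSuperalgebra k p L) : g.Rep k where
  grading := SuperGrading.shifted k 0
  act := 0
  act_mem := by intros; simp
  act_bracket := by intros; simp
  act_pmap := by intro x; simp [zero_pow (Fact.out : p.Prime).ne_zero]

/-- The linear map `x ↦ (v ⊗ w ↦ x v ⊗ w + (-1) ^ (|x||v|) v ⊗ x w)`. -/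
def tensorAct {V W : Type*} [AddCommGroup V] [Module k V] [AddCommGroup W] [Module k W]
    (ρ : g.Rep V) (σ : g.Rep W) : L →ₗ[k] Module.End k (V ⊗[k] W) :=
  (TensorProduct.mapBilinear (.id k) V W V W).flip LinearMap.id ∘ₗ ρ.act +
    ∑ i : ZMod 2, (TensorProduct.mapBilinear (.id k) V W V W) (ρ.grading.signOp i) ∘ₗ
      σ.act ∘ₗ g.grading.proj i

theorem sum_zmod2 {M : Type*} [AddCommMonoid M] (f : ZMod 2 → M) : ∑ i, f i = f 0 + f 1 :=
  Fin.sum_univ_two f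

theorem sum_proj {V M : Type*} [AddCommGroup V] [Module k V] [AddCommMonoid M]
    (G : SuperGrading k V) {i : ZMod 2} {v : V} (hv : v ∈ G.deg i) (f : ZMod 2 → V → M)
    (hf : ∀ j, f j 0 = 0) : ∑ j, f j (G.proj j v) = f i v := by
  rw [Finset.sum_eq_single i, G.proj_self hv]
  · intro j _ hj
    rw [G.proj_ne hj.symm hv, hf]
  · simp

theorem tensorAct_of_mem {V W : Type*} [AddCommGroup V] [Module k V] [AddCommGroup W] [Module k W]
    (ρ : g.Rep V) (σ : g.Rep W) {i : ZMod 2} {x : L} (hx : x ∈ g.grading.deg i) :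
    tensorAct ρ σ x = TensorProduct.map (ρ.act x) LinearMap.id +
      TensorProduct.map (ρ.grading.signOp i) (σ.act x) := by
  simp only [tensorAct, LinearMap.add_apply, LinearMap.sum_apply, LinearMap.comp_apply,
    LinearMap.flip_apply, TensorProduct.mapBilinear_apply]
  congr 1
  exact sum_proj g.grading hx (fun j x => TensorProduct.map (ρ.grading.signOp j) (σ.act x))
    (fun j => by simp)

theorem Rep.signOp_mul_act {V : Type*} [AddCommGroup V] [Module k V] (ρ : g.Rep V) {i j : ZMod 2}
    {x : L} (hx : x ∈ g.grading.deg i) :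
    ρ.grading.signOp j * ρ.act x = psign k (i * j) • (ρ.act x * ρ.grading.signOp j) := by
  rcases zmod2_cases j with rfl | rfl
  · simp [SuperGrading.signOp]
  · ext v
    simpa [SuperGrading.signOp] using ρ.act_parity hx v

/-- The tensor product of two restricted representations. -/
def tensorRep {V W : Type*} [AddCommGroup V] [Module k V] [AddCommGroup W] [Module k W]
    (ρ : g.Rep V) (σ : g.Rep W) : g.Rep (V ⊗[k] W) where
  grading := SuperGrading.tensor (two_ne_zero_of_char k p) ρ.grading σ.grading
  act := tensorAct ρ σ
  act_mem := by
    intro i j x t hx ht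
    unfold SuperGrading.tensor at ht ⊢
    rw [SuperGrading.mem_ofInvolution] at ht ⊢
    have hop : (TensorProduct.map ρ.grading.parity σ.grading.parity : Module.End k (V ⊗[k] W)) *
        tensorAct ρ σ x = psign k i • (tensorAct ρ σ x *
          TensorProduct.map ρ.grading.parity σ.grading.parity) := by
      rw [tensorAct_of_mem ρ σ hx, mul_add, add_mul, ← TensorProduct.map_mul,
        ← TensorProduct.map_mul, ← TensorProduct.map_mul, ← TensorProduct.map_mul]
      have h1 := ρ.signOp_mul_act (j := 1) hx
      have h2 := σ.signOp_mul_act (j := 1) hx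
      have h3 : ρ.grading.parity * ρ.grading.signOp i =
          ρ.grading.signOp i * ρ.grading.parity := by
        rcases zmod2_cases i with rfl | rfl <;> simp [SuperGrading.signOp]
      simp only [SuperGrading.signOp_one, mul_one] at h1 h2
      rw [h1, h2, h3, TensorProduct.map_smul_left, TensorProduct.map_smul_right, smul_add]
      rfl
    have h := LinearMap.congr_fun hop t
    simp only [Module.End.mul_apply, LinearMap.smul_apply] at h
    rw [h, ht, map_smul, smul_smul, psign_add]
  act_bracket := by
    intro i j x y hx hy
    rw [tensorAct_of_mem ρ σ hx, tensorAct_of_mem ρ σ hy,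
      tensorAct_of_mem ρ σ (g.bracket_mem hx hy), ρ.act_bracket hx hy, σ.act_bracket hx hy]
    have h1 := ρ.signOp_mul_act (j := j) hx
    have h2 := ρ.signOp_mul_act (j := i) hy
    have e : (LinearMap.id : Module.End k W) = 1 := rfl
    simp only [e, mul_add, add_mul, ← TensorProduct.map_mul, one_mul, mul_one, h1, h2,
      SuperGrading.signOp_mul, mul_comm j i, add_comm j i, TensorProduct.map_smul_left, smul_add,
      smul_smul, psign_mul_self, one_smul, sub_eq_add_neg, TensorProduct.map_add_left,
      TensorProduct.map_add_right, ← neg_smul, TensorProduct.map_smul_right]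
    module
  act_pmap := by
    intro x
    rw [tensorAct_of_mem ρ σ x.2, tensorAct_of_mem ρ σ (g.pmap x).2, ρ.act_pmap, σ.act_pmap]
    have e : (LinearMap.id : Module.End k W) = 1 := rfl
    rw [SuperGrading.signOp_zero, e, add_pow_char_of_commute' (k := k) p]
    · rw [TensorProduct.map_pow, TensorProduct.map_pow, one_pow, one_pow]
    · simp only [Commute, SemiconjBy, ← TensorProduct.map_mul, one_mul, mul_one]

/-- In characteristic `p`, the trace of a `p`-th power is the `p`-th power of the trace. -/
theorem trace_pow_char (p : ℕ) [CharP k p] [Fact p.Prime] {V : Type*} [AddCommGroup V] [Module k V]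
    [FiniteDimensional k V] (f : Module.End k V) :
    LinearMap.trace k V (f ^ p) = LinearMap.trace k V f ^ p := by
  classical
  let b := Module.finBasis k V
  rw [LinearMap.trace_eq_matrix_trace k b, LinearMap.trace_eq_matrix_trace k b,
    ← LinearMap.toMatrix_pow]
  generalize LinearMap.toMatrix b b f = M
  rcases isEmpty_or_nonempty (Fin (Module.finrank k V)) with hE | hN
  · simp [Matrix.trace, zero_pow (Fact.out : p.Prime).ne_zero]
  have key : (M ^ p).charpoly = M.charpoly.map (frobenius k p) := by
    apply Polynomial.expand_injective (Fact.out : p.Prime).pos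
    rw [← Polynomial.map_expand, Polynomial.map_frobenius_expand]
    unfold Matrix.charpoly
    rw [AlgHom.map_det, ← Matrix.coe_detMonoidHom, ← map_pow]
    apply congr_arg Matrix.det
    refine matPolyEquiv.injective ?_
    rw [map_pow, Matrix.matPolyEquiv_charmatrix, sub_pow_char_of_commute, ← Polynomial.C_pow]
    · exact (matPolyEquiv_eq_X_pow_sub_C p M :)
    · exact (Polynomial.C M).commute_X
  rw [Matrix.trace_eq_neg_charpoly_coeff, Matrix.trace_eq_neg_charpoly_coeff, key,
    Polynomial.coeff_map, ← frobenius_def p (-_), map_neg]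

theorem Rep.supertrace_odd {V : Type*} [AddCommGroup V] [Module k V] (ρ : g.Rep V) {f : Module.End k V}
    (hf : ρ.grading.parity * f = -(f * ρ.grading.parity)) : ρ.grading.supertrace f = 0 := by
  have h : ρ.grading.supertrace f = -ρ.grading.supertrace f := by
    rw [SuperGrading.supertrace_apply]
    nth_rewrite 1 [hf]
    rw [map_neg, LinearMap.trace_mul_comm]
  have h2 : (2 : k) * ρ.grading.supertrace f = 0 := by rw [two_mul]; nth_rewrite 1 [h]; simp
  exact (mul_eq_zero.1 h2).resolve_left (two_ne_zero_of_char k p)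

theorem Rep.supertrace_act_odd {V : Type*} [AddCommGroup V] [Module k V] (ρ : g.Rep V) {x : L}
    (hx : x ∈ g.grading.deg 1) : ρ.grading.supertrace (ρ.act x) = 0 := by
  refine ρ.supertrace_odd ?_
  have h := ρ.signOp_mul_act (j := 1) hx
  simpa using h

theorem Rep.supertrace_bracket {V : Type*} [AddCommGroup V] [Module k V] (ρ : g.Rep V)
    {i j : ZMod 2} {x y : L} (hx : x ∈ g.grading.deg i) (hy : y ∈ g.grading.deg j) :
    ρ.grading.supertrace (ρ.act (g.bracket x y)) = 0 := by
  by_cases hij : i = j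
  · subst hij
    have h := ρ.signOp_mul_act (j := 1) hy
    rw [ρ.act_bracket hx hy, map_sub, map_smul, SuperGrading.supertrace_apply,
      SuperGrading.supertrace_apply]
    rw [SuperGrading.signOp_one, mul_one] at h
    rw [← mul_assoc _ (ρ.act y), h, smul_mul_assoc, map_smul, mul_assoc (ρ.act y),
      LinearMap.trace_mul_comm k (ρ.act y), smul_smul, mul_assoc]
    have : psign k (i * i) * psign k i = 1 := by
      rcases zmod2_cases i with rfl | rfl <;> simp
    rw [this, one_smul, sub_self]
  · have : i + j = 1 := by clear hx hy; revert i j; decide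
    have h := g.bracket_mem hx hy
    rw [this] at h
    exact ρ.supertrace_act_odd h

/-- For a finite dimensional restricted representation `ρ` of `g`, the character
`x ↦ str (ρ x)` of `g`, as a restricted representation on the line `k` placed in parity `j`.
For `j = m mod 2` this is `Πᵐ k_{str ∘ ρ}`. -/
def Rep.strRep {V : Type*} [AddCommGroup V] [Module k V] [FiniteDimensional k V] (ρ : g.Rep V)
    (j : ZMod 2) : g.Rep k where
  grading := SuperGrading.shifted k j
  act := (LinearMap.toSpanSingleton k (Module.End k k) 1) ∘ₗ ρ.grading.supertrace ∘ₗ ρ.act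
  act_mem := by
    intro i l x v hx hv
    rcases zmod2_cases i with rfl | rfl
    · rw [zero_add]
      simpa using Submodule.smul_mem _ _ hv
    · simp [ρ.supertrace_act_odd hx]
  act_bracket := by
    intro i l x y hx hy
    simp only [LinearMap.comp_apply, ρ.supertrace_bracket hx hy]
    by_cases h : i = 1 ∧ l = 1
    · obtain ⟨rfl, rfl⟩ := h
      simp [ρ.supertrace_act_odd hx]
    · have : i * l = 0 := by clear hx hy; revert i l; decide
      simp [this, smul_smul, mul_comm]
  act_pmap := by
    intro x
    have h := ρ.signOp_mul_act (j := 1) x.2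
    simp only [SuperGrading.signOp_one, mul_one, psign_zero, one_smul] at h
    have hp : ρ.grading.parity ^ p = ρ.grading.parity := by
      obtain ⟨n, hn⟩ := (Fact.out : p.Prime).odd_of_ne_two (Fact.out : 2 < p).ne'
      have h2 : ρ.grading.parity ^ 2 = 1 := by
        rw [pow_two]; exact LinearMap.ext ρ.grading.parity_parity
      rw [congrArg (ρ.grading.parity ^ ·) hn]
      simp only [pow_succ _ (2 * n), pow_mul, h2, one_pow, one_mul]
    have key : ρ.grading.supertrace (ρ.act x ^ p) = ρ.grading.supertrace (ρ.act x) ^ p := by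
      rw [SuperGrading.supertrace_apply, SuperGrading.supertrace_apply, ← trace_pow_char p,
        Commute.mul_pow h, hp]
    simp only [LinearMap.comp_apply, ρ.act_pmap, key, LinearMap.toSpanSingleton_apply, smul_pow,
      one_pow]

end Reps

/-- The monomial `e₁^a₁ ⋯ eₙ^aₙ ε₁^α₁ ⋯ εₘ^αₘ` of `U'(g)`. -/
def monomial (g : RestrictedLieSuperalgebra k p L) {n m : ℕ} (e : Fin n → L)
    (ε : Fin m → L) (a : Fin n → Fin p) (α : Fin m → Fin 2) : g.Env :=
  (List.ofFn fun i => g.ι (e i) ^ (a i : ℕ)).prod *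
    (List.ofFn fun s => g.ι (ε s) ^ (α s : ℕ)).prod

/-! ### Restricted subsuperalgebras -/

namespace Sub

variable {g : RestrictedLieSuperalgebra k p L} (h : g.Sub)

theorem coeff_bracket_pow {M N : Type*} [AddCommGroup M] [Module k M] [AddCommGroup N] [Module k N]
    (f : M →ₗ[k] N) {a b : Module.End k M} {a' b' : Module.End k N} (ha : ∀ x, f (a x) = a' (f x))
    (hb : ∀ x, f (b x) = b' (f x)) (n i : ℕ) (x : M) :
    f (((Polynomial.X * Polynomial.C a + Polynomial.C b : Polynomial (Module.End k M)) ^ n).coeff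
      i x) = ((Polynomial.X * Polynomial.C a' + Polynomial.C b' :
        Polynomial (Module.End k N)) ^ n).coeff i (f x) := by
  induction n generalizing i x with
  | zero => by_cases hi : i = 0 <;> simp [Polynomial.coeff_one, hi]
  | succ n ih =>
    rw [pow_succ, pow_succ]
    generalize (Polynomial.X * Polynomial.C a + Polynomial.C b) ^ n = P at ih ⊢
    generalize (Polynomial.X * Polynomial.C a' + Polynomial.C b') ^ n = P' at ih ⊢
    rw [mul_add, mul_add, ← mul_assoc, ← mul_assoc]
    cases i with
    | zero => simp [ih, hb]
    | succ i => simp [ih, ha, hb, Polynomial.coeff_mul_X]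

theorem map_pow_apply {M N : Type*} [AddCommGroup M] [Module k M] [AddCommGroup N] [Module k N]
    (f : M →ₗ[k] N) {a : Module.End k M} {a' : Module.End k N} (ha : ∀ x, f (a x) = a' (f x))
    (n : ℕ) (x : M) : f ((a ^ n) x) = (a' ^ n) (f x) := by
  induction n with
  | zero => simp
  | succ n ih => rw [pow_succ', pow_succ', Module.End.mul_apply, ha, ih, Module.End.mul_apply]

/-- The superspace structure of a restricted subsuperalgebra. -/
def grading : SuperGrading k h.carrier where
  deg i := (g.grading.deg i).comap h.carrier.subtype
  isCompl := by
    constructor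
    · rw [Submodule.disjoint_def]
      intro x h0 h1
      rw [Submodule.mem_comap] at h0 h1
      exact Subtype.ext (Submodule.disjoint_def.1 g.grading.isCompl.disjoint _ h0 h1)
    · rw [codisjoint_iff, Submodule.eq_top_iff']
      intro x
      rw [Submodule.mem_sup]
      exact ⟨⟨_, h.proj_mem 0 x.2⟩, g.grading.proj_mem 0 _, ⟨_, h.proj_mem 1 x.2⟩,
        g.grading.proj_mem 1 _, Subtype.ext (g.grading.proj_add _)⟩

/-- The bracket of a restricted subsuperalgebra. -/
def bracket : h.carrier →ₗ[k] h.carrier →ₗ[k] h.carrier :=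
  LinearMap.mk₂ k (fun x y => ⟨g.bracket x y, h.bracket_mem x.2 y.2⟩)
    (fun x y z => Subtype.ext (by simp)) (fun c x y => Subtype.ext (by simp))
    (fun x y z => Subtype.ext (by simp)) (fun c x y => Subtype.ext (by simp))

theorem coe_bracket (x y : h.carrier) : (h.bracket x y : L) = g.bracket x y := rfl

/-- The inclusion of the even part of a restricted subsuperalgebra. -/
def evenIncl : h.grading.deg 0 →ₗ[k] g.grading.deg 0 :=
  (h.carrier.subtype ∘ₗ (h.grading.deg 0).subtype).codRestrict _ (fun x => x.2)

/-- A restricted subsuperalgebra, as a restricted Lie superalgebra. -/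
def toRestricted : RestrictedLieSuperalgebra k p h.carrier where
  grading := h.grading
  bracket := h.bracket
  bracket_mem := fun hx hy => g.bracket_mem hx hy
  bracket_skew := fun hx hy => Subtype.ext (g.bracket_skew hx hy)
  jacobi := fun hx hy hz => Subtype.ext (g.jacobi hx hy hz)
  bracket_odd_cube := fun hx => Subtype.ext (g.bracket_odd_cube hx)
  pmap x := ⟨⟨g.pmap (h.evenIncl x), h.pmap_mem (h.evenIncl x) x.1.2⟩, (g.pmap (h.evenIncl x)).2⟩
  pmap_smul c x := by
    refine Subtype.ext (Subtype.ext ?_)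
    simp only [map_smul, g.pmap_smul]
    rfl
  pmap_add x y := by
    refine h.carrier.subtype_injective ?_
    simp only [map_add, map_sum, map_smul]
    refine (g.pmap_add (h.evenIncl x) (h.evenIncl y)).trans
      (congrArg₂ _ rfl (Finset.sum_congr rfl fun i _ => congrArg _ ?_))
    exact (coeff_bracket_pow (a := h.bracket x.1) (b := h.bracket y.1) (a' := g.bracket x.1.1)
      (b' := g.bracket y.1.1) h.carrier.subtype (fun _ => rfl) (fun _ => rfl) _ _ _).symm
  bracket_pmap x y := by
    refine Subtype.ext ((g.bracket_pmap (h.evenIncl x) y).trans ?_)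
    exact (map_pow_apply (a := h.bracket x.1) (a' := g.bracket x.1.1) h.carrier.subtype
      (fun _ => rfl) _ _).symm

/-- The morphism `U'(h) → U'(g)` induced by the inclusion. -/
def envIncl : h.toRestricted.Env →ₐ[k] g.Env :=
  h.toRestricted.lift (g.ι ∘ₗ h.carrier.subtype) (fun hx hy => g.ι_mul_ι hx hy)
    (fun x => g.ι_pow (h.evenIncl x))

theorem mk_proj_eq_zero (i : ZMod 2) {x : L} (hx : x ∈ h.carrier) :
    h.carrier.mkQ (g.grading.proj i x) = 0 := by
  simpa using h.proj_mem i hx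

/-- The superspace structure of `g/h`. -/
def quotGrading : SuperGrading k (L ⧸ h.carrier) where
  deg i := (g.grading.deg i).map h.carrier.mkQ
  isCompl := by
    constructor
    · rw [Submodule.disjoint_def]
      rintro _ ⟨x, hx, rfl⟩ ⟨y, hy, hxy⟩
      have hm : x - y ∈ h.carrier := by
        rw [← Submodule.ker_mkQ h.carrier, LinearMap.mem_ker, map_sub, hxy, sub_self]
      have := h.mk_proj_eq_zero 0 hm
      rwa [map_sub, g.grading.proj_self hx, g.grading.proj_ne (by decide) hy, sub_zero] at this
    · rw [codisjoint_iff, ← Submodule.map_sup, codisjoint_iff.1 g.grading.isCompl.codisjoint,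
        Submodule.map_top, Submodule.range_mkQ]

/-- The adjoint representation of `h` on `g/h`. -/
def adQuot : h.toRestricted.Rep (L ⧸ h.carrier) where
  grading := h.quotGrading
  act :=
    { toFun := fun x => h.carrier.mapQ h.carrier (g.bracket x) (fun _ hy => h.bracket_mem x.2 hy)
      map_add' := fun x y => Submodule.linearMap_qext _ (by ext; simp)
      map_smul' := fun c x => Submodule.linearMap_qext _ (by ext; simp) }
  act_mem := by
    rintro i j x _ hx ⟨y, hy, rfl⟩
    exact ⟨_, g.bracket_mem hx hy, rfl⟩
  act_bracket := by
    intro i j x y hx hy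
    refine Submodule.linearMap_qext _ (LinearMap.ext fun z => ?_)
    have key : ∀ {l : ZMod 2} {z : L}, z ∈ g.grading.deg l →
        g.bracket (g.bracket x y) z = g.bracket x (g.bracket y z) -
          psign k (i * j) • g.bracket y (g.bracket x z) := by
      intro l z hz
      exact eq_sub_of_add_eq (g.jacobi hx hy hz).symm
    have key' : g.bracket (g.bracket x y) z = g.bracket x (g.bracket y z) -
          psign k (i * j) • g.bracket y (g.bracket x z) := by
      rw [← g.grading.proj_add z]
      simp only [map_add]
      rw [key (g.grading.proj_mem 0 z), key (g.grading.proj_mem 1 z), smul_add]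
      abel
    exact congrArg h.carrier.mkQ key'
  act_pmap := by
    intro x
    refine Submodule.linearMap_qext _ (LinearMap.ext fun z => ?_)
    refine (congrArg h.carrier.mkQ (g.bracket_pmap (h.evenIncl x) z)).trans ?_
    exact map_pow_apply h.carrier.mkQ (fun _ => rfl) _ _

theorem envIncl_ι (x : h.carrier) : h.envIncl (h.toRestricted.ι x) = g.ι (x : L) :=
  h.toRestricted.lift_ι _ _ _ _

/-! ### Restricted induction and coinduction -/

section Induction

variable [CharP k p] [Fact p.Prime] [Fact (2 < p)]
variable {V : Type*} [AddCommGroup V] [Module k V] (ρ : h.toRestricted.Rep V)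

/-- The `U'(g)`-submodule of `U'(g) ⊗ V` generated by the elements `u a ⊗ v - u ⊗ a v` with `a` in
`U'(h)`. -/
def indRel : Submodule g.Env (g.Env ⊗[k] V) :=
  Submodule.span g.Env {t | ∃ (u : g.Env) (a : h.toRestricted.Env) (v : V),
    t = (u * h.envIncl a) ⊗ₜ[k] v - u ⊗ₜ[k] ρ.env a v}

/-- The restricted induced module `U'(g) ⊗_{U'(h)} V`, with its action of `U'(g)` by left
multiplication. -/
abbrev Ind : Type _ := (g.Env ⊗[k] V) ⧸ h.indRel ρ

/-- The element `u ⊗ v` of the restricted induced module. -/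
def indMk (u : g.Env) (v : V) : h.Ind ρ := (h.indRel ρ).mkQ (u ⊗ₜ[k] v)

/-- The homogeneous part of parity `i` of the restricted induced module. -/
def indDeg (i : ZMod 2) : Submodule k (h.Ind ρ) :=
  Submodule.span k {x | ∃ (j l : ZMod 2) (u : g.Env) (v : V), j + l = i ∧
    u ∈ g.envGrading.deg j ∧ v ∈ ρ.grading.deg l ∧ x = h.indMk ρ u v}

/-- The restricted coinduced module `Hom_{U'(h)}(U'(g), V)`. An element `μ` is recorded by the map
`u ↦ ⟨u, μ⟩`, where `⟨u, μ⟩ = (-1) ^ (|u||μ|) μ(u)`, so that no sign appears in the condition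
`⟨a u, μ⟩ = a ⟨u, μ⟩` for `a` in `U'(h)`. -/
def Coind : Submodule k (g.Env →ₗ[k] V) where
  carrier := {μ | ∀ (a : h.toRestricted.Env) (u : g.Env), μ (h.envIncl a * u) = ρ.env a (μ u)}
  add_mem' := by
    intro μ ν hμ hν a u
    simp [hμ a u, hν a u]
  zero_mem' := by
    intro a u
    simp
  smul_mem' := by
    intro c μ hμ a u
    simp [hμ a u]

/-- The action of `U'(g)` on the restricted coinduced module by the transpose of right
multiplication: `⟨w, u μ⟩ = ⟨w u, μ⟩`. -/
instance : Module g.Env (h.Coind ρ) where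
  smul u μ := ⟨μ.1 ∘ₗ LinearMap.mulRight k u, fun a w => by
    simpa [mul_assoc] using μ.2 a (w * u)⟩
  one_smul μ := Subtype.ext (LinearMap.ext fun w => congrArg μ.1 (mul_one w))
  mul_smul u u' μ := Subtype.ext (LinearMap.ext fun w => congrArg μ.1 (mul_assoc w u u').symm)
  smul_zero u := rfl
  smul_add u μ ν := rfl
  add_smul u u' μ := Subtype.ext (LinearMap.ext fun w =>
    (congrArg μ.1 (mul_add w u u')).trans (map_add μ.1 _ _))
  zero_smul μ := Subtype.ext (LinearMap.ext fun w =>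
    (congrArg μ.1 (mul_zero w)).trans (map_zero μ.1))

/-- The homogeneous part of parity `i` of the restricted coinduced module. -/
def coindDeg (i : ZMod 2) : Submodule k (h.Coind ρ) where
  carrier := {μ | ∀ (j : ZMod 2) (u : g.Env), u ∈ g.envGrading.deg j →
    μ.1 u ∈ ρ.grading.deg (i + j)}
  add_mem' := fun hμ hν j u hu => add_mem (hμ j u hu) (hν j u hu)
  zero_mem' := fun _ _ _ => zero_mem _
  smul_mem' := fun c _ hμ j u hu => Submodule.smul_mem _ c (hμ j u hu)

/-- The coinduced module `𝒜` of the trivial representation. -/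
abbrev Coord : Type _ := h.Coind h.toRestricted.trivialRep

/-- The map `a ⊗ b ↦ ∑ᵢ (-1) ^ (i|b|) ⟨a, λᵢ⟩ ⟨b, μ⟩`, where `λᵢ = λ ∘ projᵢ` is the component of
parity `i` of the linear form `λ = lam`. -/
def convAux (lam : g.Env →ₗ[k] k) (μ : g.Env →ₗ[k] V) : g.Env ⊗[k] g.Env →ₗ[k] V :=
  ∑ i : ZMod 2, (TensorProduct.lid k V).toLinearMap ∘ₗ
    TensorProduct.map (lam ∘ₗ g.envGrading.proj i) (μ ∘ₗ g.envGrading.signOp i)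

/-- The map `u ↦ ∑ (-1) ^ (|λ||u₂|) ⟨u₁, λ⟩ ⟨u₂, μ⟩`, where `∑ u₁ ⊗ u₂` is the coproduct of `u`. -/
def conv (lam : g.Env →ₗ[k] k) (μ : g.Env →ₗ[k] V) : g.Env →ₗ[k] V :=
  convAux lam μ ∘ₗ
    (GradedTensorProduct.of k g.envGrading.deg g.envGrading.deg).symm.toLinearMap ∘ₗ
      g.comul.toLinearMap

theorem convAux_tmul (lam : g.Env →ₗ[k] k) (μ : g.Env →ₗ[k] V) {i : ZMod 2} {a : g.Env}
    (ha : a ∈ g.envGrading.deg i) (b : g.Env) :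
    convAux lam μ ((GradedTensorProduct.of k g.envGrading.deg g.envGrading.deg).symm (g.tmul a b)) =
      lam a • μ (g.envGrading.signOp i b) := by
  have e : (GradedTensorProduct.of k g.envGrading.deg g.envGrading.deg).symm (g.tmul a b) =
    a ⊗ₜ[k] b := rfl
  rw [e]
  simp only [convAux, LinearMap.sum_apply, LinearMap.comp_apply, TensorProduct.map_tmul,
    LinearEquiv.coe_coe, TensorProduct.lid_tmul]
  exact sum_proj g.envGrading ha (fun j a => lam a • μ (g.envGrading.signOp j b))
    (fun j => by simp)

theorem Coind_ι {μ : g.Env →ₗ[k] V} (hμ : μ ∈ h.Coind ρ) (x : h.carrier) (u : g.Env) :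
    μ (g.ι x * u) = ρ.act x (μ u) := by
  have := hμ (h.toRestricted.ι x) u
  rwa [h.envIncl_ι, Rep.env, lift_ι] at this

theorem signOp_ι_mul {i j : ZMod 2} {x : L} (hx : x ∈ g.grading.deg i) (b : g.Env) :
    g.envGrading.signOp j (g.ι x * b) = psign k (i * j) • (g.ι x * g.envGrading.signOp j b) := by
  rcases zmod2_cases j with rfl | rfl
  · simp
  · simp only [SuperGrading.signOp_one, g.parity_envGrading, map_mul, envParity_ι,
      g.grading.parity_of_mem hx, map_smul, smul_mul_assoc, mul_one]

theorem conv_ι_mul {lam : g.Env →ₗ[k] k} (hl : lam ∈ h.Coind h.toRestricted.trivialRep)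
    {μ : g.Env →ₗ[k] V} (hμ : μ ∈ h.Coind ρ) {i : ZMod 2} {x : h.carrier}
    (hx : (x : L) ∈ g.grading.deg i) (u : g.Env) :
    conv lam μ (g.ι x * u) = ρ.act x (conv lam μ u) := by
  simp only [conv, LinearMap.comp_apply, AlgHom.toLinearMap_apply, map_mul, comul_ι]
  generalize g.comul u = t
  have hx' := g.ι_mem hx
  have key : ∀ (j : ZMod 2) (a b : g.Env), a ∈ g.envGrading.deg j →
      convAux lam μ ((GradedTensorProduct.of k g.envGrading.deg g.envGrading.deg).symm
        ((g.tmul (g.ι x) 1 + g.tmul 1 (g.ι x)) * g.tmul a b)) =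
      ρ.act x (convAux lam μ ((GradedTensorProduct.of k g.envGrading.deg
        g.envGrading.deg).symm (g.tmul a b))) := by
    intro j a b ha
    rw [add_mul, g.tmul_mul_tmul _ _ g.one_mem ha, g.tmul_mul_tmul _ _ hx' ha, map_add, map_add,
      zero_mul, psign_zero, one_smul, one_mul, one_mul, map_smul, map_smul,
      convAux_tmul lam μ (g.mul_mem hx' ha), convAux_tmul lam μ ha, convAux_tmul lam μ ha,
      h.Coind_ι _ hl, signOp_ι_mul hx, map_smul, h.Coind_ι ρ hμ, smul_comm (lam a), smul_smul,
      psign_mul_self, one_smul, map_smul]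
    simp [trivialRep]
  have hk : ∀ t : g.Env ⊗[k] g.Env,
      convAux lam μ ((GradedTensorProduct.of k g.envGrading.deg g.envGrading.deg).symm
        ((g.tmul (g.ι x) 1 + g.tmul 1 (g.ι x)) *
          GradedTensorProduct.of k g.envGrading.deg g.envGrading.deg t)) =
      ρ.act x (convAux lam μ ((GradedTensorProduct.of k g.envGrading.deg
        g.envGrading.deg).symm (GradedTensorProduct.of k g.envGrading.deg g.envGrading.deg t))) := by
    intro t
    induction t with
    | zero => simp
    | add s t hs ht => simp only [map_add, mul_add, hs, ht]
    | tmul a b =>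
      rw [← g.envGrading.proj_add a, TensorProduct.add_tmul]
      simp only [map_add, mul_add]
      exact congrArg₂ _ (key 0 _ b (g.envGrading.proj_mem 0 a))
        (key 1 _ b (g.envGrading.proj_mem 1 a))
  exact hk ((GradedTensorProduct.of k g.envGrading.deg g.envGrading.deg).symm t)

theorem conv_mem {lam : g.Env →ₗ[k] k} (hl : lam ∈ h.Coind h.toRestricted.trivialRep)
    {μ : g.Env →ₗ[k] V} (hμ : μ ∈ h.Coind ρ) : conv lam μ ∈ h.Coind ρ := by
  intro a
  induction a using env_induction with
  | h_scalar c =>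
    intro u
    rw [AlgHom.commutes, AlgHom.commutes, ← Algebra.smul_def, map_smul]
    rfl
  | h_ι x =>
    intro u
    rw [h.envIncl_ι, Rep.env, lift_ι, ← h.grading.proj_add x]
    simp only [Submodule.coe_add, map_add, add_mul, LinearMap.add_apply]
    rw [h.conv_ι_mul ρ hl hμ (h.grading.proj_mem 0 x), h.conv_ι_mul ρ hl hμ (h.grading.proj_mem 1 x)]
  | h_mul a b ha hb =>
    intro u
    rw [map_mul h.envIncl, map_mul ρ.env, mul_assoc, ha, hb]
    rfl
  | h_add a b ha hb =>
    intro u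
    rw [map_add, map_add, add_mul, map_add, ha, hb]
    rfl

/-- The product `λ μ` of an element `λ` of `𝒜` with an element `μ` of the coinduced module:
`⟨u, λ μ⟩ = ∑ (-1) ^ (|λ||u₂|) ⟨u₁, λ⟩ ⟨u₂, μ⟩`. For the trivial representation this is the product
of the superalgebra `𝒜`. -/
def coindMul (lam : h.Coord) (μ : h.Coind ρ) : h.Coind ρ :=
  ⟨conv lam.1 μ.1, h.conv_mem ρ lam.2 μ.2⟩

theorem trivialRep_env (a : h.toRestricted.Env) (c : k) :
    h.toRestricted.trivialRep.env a c = g.counit (h.envIncl a) * c := by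
  have : h.toRestricted.trivialRep.env = (Algebra.lmul k k).comp (g.counit.comp h.envIncl) := by
    apply env_hom_ext
    intro x
    ext
    simp [Rep.env, trivialRep, h.envIncl_ι]
  rw [this]
  rfl

/-- The unit of the superalgebra `𝒜`, which is the counit of `U'(g)`. -/
def coordOne : h.Coord :=
  ⟨g.counit.toLinearMap, fun a u => by simp [h.trivialRep_env]⟩

/-- The product `λ₁ ⋯ λᵣ` of a list of elements of `𝒜`. -/
def coordProd (l : List h.Coord) : h.Coord :=
  l.foldr (h.coindMul h.toRestricted.trivialRep) h.coordOne

/-- The character `strad_{g/h}` of `h`: the supertrace of the adjoint action on `g/h`. -/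
def strad (x : h.carrier) : k := h.quotGrading.supertrace (h.adQuot.act x)

/-- The restricted representation `Πᵐ k_{strad_{g/h}} ⊗ ρ` of `h`. -/
def twist [FiniteDimensional k (L ⧸ h.carrier)] (m : ℕ) : h.toRestricted.Rep (k ⊗[k] V) :=
  tensorRep (h.adQuot.strRep (m : ZMod 2)) ρ

/-- The families `e` and `ε`, of even and of odd elements of `g` respectively, form a basis of a
supplement of `h` in `g`. -/
structure IsSupplementBasis {n m : ℕ} (e : Fin n → L) (ε : Fin m → L) : Prop where
  even : ∀ i, e i ∈ g.grading.deg 0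
  odd : ∀ s, ε s ∈ g.grading.deg 1
  linearIndependent : LinearIndependent k (Sum.elim e ε)
  isCompl : IsCompl h.carrier (Submodule.span k (Set.range (Sum.elim e ε)))

open scoped Classical in
/-- The elements `ηᵢ`, `ζₛ` of `𝒜` and `v̂` of the coinduced module attached to `e` and `ε`: they
take the values `1`, `1` and `v` on the monomials `eᵢ`, `εₛ` and `1` respectively, and vanish on
the other monomials `e₁^a₁ ⋯ eₙ^aₙ ε₁^α₁ ⋯ εₘ^αₘ`, `0 ≤ aᵢ < p`, `0 ≤ αₛ < 2`. -/
structure IsCoordinates {n m : ℕ} (e : Fin n → L) (ε : Fin m → L)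
    (η : Fin n → h.Coord) (ζ : Fin m → h.Coord) (hat : V → h.Coind ρ) : Prop where
  eta : ∀ i a α, (η i).1 (g.monomial e ε a α) =
    if (∀ j, (a j : ℕ) = if j = i then 1 else 0) ∧ (∀ s, (α s : ℕ) = 0) then 1 else 0
  zeta : ∀ s a α, (ζ s).1 (g.monomial e ε a α) =
    if (∀ j, (a j : ℕ) = 0) ∧ (∀ t, (α t : ℕ) = if t = s then 1 else 0) then 1 else 0
  hat : ∀ v a α, (hat v).1 (g.monomial e ε a α) =
    if (∀ j, (a j : ℕ) = 0) ∧ (∀ t, (α t : ℕ) = 0) then v else 0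

/-- The element `Λ = η₁^(p-1) ⋯ ηₙ^(p-1) ζ₁ ⋯ ζₘ` of `𝒜`. -/
def topCoord {n m : ℕ} (η : Fin n → h.Coord) (ζ : Fin m → h.Coord) : h.Coord :=
  h.coordProd ((List.ofFn fun i => List.replicate (p - 1) (η i)).flatten ++ List.ofFn ζ)

/-- The isomorphism `Φ` of an induced with a coinduced module preserves parities. -/
def PreservesParity {W : Type*} [AddCommGroup W] [Module k W] {σ : h.toRestricted.Rep W}
    {ρ : h.toRestricted.Rep V} (Φ : h.Ind σ ≃ₗ[g.Env] h.Coind ρ) : Prop :=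
  ∀ (i : ZMod 2) (x : h.Ind σ), x ∈ h.indDeg σ i ↔ Φ x ∈ h.coindDeg ρ i

end Induction

end Sub

end RestrictedLieSuperalgebra

end RestrictedSuper

end

open RestrictedSuper

/-!
The proof has three ingredients: a Poincaré–Birkhoff–Witt theorem for the restricted enveloping
superalgebra `U'(g)`, the supersymmetry of leading terms with respect to the number of factors
outside `h`, and a triangularity argument for the pairing of complementary monomials.

*Poincaré–Birkhoff–Witt.* Fix a totally ordered homogeneous basis `xᵢ` of `g` and let `q = p` for
even and `q = 2` for odd `xᵢ`. The relations of `U'(g)` are equivalent to the exchange relations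
`xᵢ xⱼ = ± xⱼ xᵢ + [xᵢ, xⱼ]` and the power relations `xᵢ ^ q = pw i`; for the `p`-operation on
linear combinations this is Jacobson's formula (`jacobson_formula`, `pow_pmap`). Used as rewriting
rules on words they terminate, since they decrease words in the length-lexicographic order, and they
are confluent (`swap_and_pow`): overlaps of exchanges are resolved by the Jacobi identity, overlaps
with powers by `(ad xᵢ) ^ q = ad (pw i)`. So `U'(g)` acts on combinations of words by
multiplying and taking normal forms, and the products of the words that are increasing and contain
each letter fewer than `q` times form a basis of `U'(g)` (`mem_span_irr`, `nform_wp_of_irr`).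
For a basis that consists of a basis of `h` and of a basis of a supplement, elements of a coinduced module
can be prescribed freely
on the irreducible words in the supplement (`coind_ext`, `exists_coind`), and an induced module is
spanned by the tensors of such words with elements of the inducing module (`mem_span_back`).

*Leading terms.* `U'(g)` is filtered by the number of factors outside `h` (`fil`, `low`). Up to
shorter words, the letters of a word in the supplement supercommute (`sw_perm`), and a word with too
many repetitions is zero. The top word contains each even letter `p - 1` times and each odd letter
once. If `H ∈ h` is moved through it, each occurrence of a letter contributes minus the
corresponding diagonal coefficient of `ad H` on `g/h`; as `p - 1 = -1` in `k`, these add up to the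
supertrace (`IsTop.mul_ι`). The elements of `g` are primitive, so that orders of vanishing add up
under convolution (`conv_eq_zero_of_low`). Therefore `Λ` vanishes on all words shorter than the top
word, and its value on the top word is, up to sign, a power of `(p - 1)!`, hence nonzero
(`coordProd_sw_ne_zero`). Likewise `Λ v̂` is the element with value `Λ(top) v` on the top word
that vanishes on the other irreducible words (`IsTopFamily`, `conv_sw_left`). The commutation of
`H` with the top word then shows that `H Λ v̂` is as required for `Φ` to be well defined
(`IsTopFamily.ι_smul`, `IsTopFamily.toHom`).

*Bijectivity.* An irreducible word `b` has a complement `a` in the top word, which is a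
rearrangement of `a b` (`IsTop.exists_compl`). The value of `b Λ v̂` at `a` is that of `Λ v̂` at
`a b`: a nonzero multiple of `v` for the complement of `b`, and zero for the other words `a` whose
length is at most that of the complement (`smul_apply_of_perm`, `smul_apply_eq_zero`). So the matrix
of `Φ` with respect to irreducible words is triangular with invertible diagonal entries
(`toHom_injective`, `toHom_surjective`). Parities are compared on irreducible words
(`mem_coindDeg`).
-/

noncomputable section

namespace RestrictedSuper

/-! ### Binomial sums and Jacobson's formula in characteristic `p` -/

section Jacobson

variable {M E : Type*} [AddCommGroup M]

/-- Iterating `x D = D x + [x, D]`: this is the expansion of `x ^ r y x ^ s` along powers of the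
derivation `D = ad x`, for expressions `c r s y` of total degree less than `p`. -/
theorem moveLeft_expand {p : ℕ} (c : ℕ → ℕ → E → M) (D : E → E)
    (hc : ∀ r s y, r + s + 2 ≤ p → c (r + 1) s y = c r (s + 1) y + c r s (D y)) (r : ℕ) :
    ∀ s y, r + s + 1 ≤ p → c r s y =
      ∑ t ∈ Finset.range (r + 1), r.choose t • c 0 (r - t + s) (D^[t] y) := by
  induction r with
  | zero => intro s y _; simp
  | succ r ih =>
    intro s y hs
    rw [hc r s y (by omega), ih (s + 1) y (by omega), ih s (D y) (by omega)]
    rw [Finset.sum_range_succ' _ (r + 1)]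
    simp only [Nat.choose_succ_succ', add_smul, Finset.sum_add_distrib]
    rw [Finset.sum_range_succ' _ r, Finset.sum_range_succ (fun t => r.choose (t + 1) •
      c 0 (r + 1 - (t + 1) + s) (D^[t + 1] y)) r]
    simp only [Nat.choose_succ_self, zero_smul, Function.iterate_succ_apply, Nat.choose_zero_right]
    have : ∑ t ∈ Finset.range r, r.choose (t + 1) • c 0 (r - (t + 1) + (s + 1)) (D^[t] (D y)) =
        ∑ t ∈ Finset.range r, r.choose (t + 1) • c 0 (r + 1 - (t + 1) + s) (D^[t] (D y)) := by
      refine Finset.sum_congr rfl fun t ht => ?_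
      have := Finset.mem_range.1 ht
      rw [show r - (t + 1) + (s + 1) = r + 1 - (t + 1) + s by omega]
    rw [this, show r - 0 + (s + 1) = r + 1 - 0 + s by omega]
    have : ∑ t ∈ Finset.range (r + 1), r.choose t • c 0 (r - t + s) (D^[t] (D y)) =
        ∑ t ∈ Finset.range (r + 1), r.choose t • c 0 (r + 1 - (t + 1) + s) (D^[t] (D y)) := by
      refine Finset.sum_congr rfl fun t ht => ?_
      rw [show r - t + s = r + 1 - (t + 1) + s by omega]
    rw [this]
    simp only [Function.iterate_zero_apply]
    abel

/-- The sum of `xʳ y xˢ⁺ᵐ` over `r + s = n - 1`, expanded along powers of `D = ad x`: summing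
`moveLeft_expand` over `r` turns the coefficients `r.choose t` into `n.choose (t + 1)`. -/
theorem sum_moveLeft {p : ℕ} (c : ℕ → ℕ → E → M) (D : E → E)
    (hc : ∀ r s y, r + s + 2 ≤ p → c (r + 1) s y = c r (s + 1) y + c r s (D y)) (y : E) (n : ℕ) :
    ∀ m, n + m ≤ p → ∑ r ∈ Finset.range n, c r (n - 1 - r + m) y =
      ∑ t ∈ Finset.range n, n.choose (t + 1) • c 0 (n - 1 - t + m) (D^[t] y) := by
  induction n with
  | zero => simp
  | succ n ih =>
    intro m hm
    rw [Finset.sum_range_succ]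
    have h1 : ∑ r ∈ Finset.range n, c r (n + 1 - 1 - r + m) y =
        ∑ r ∈ Finset.range n, c r (n - 1 - r + (m + 1)) y := by
      refine Finset.sum_congr rfl fun t ht => ?_
      have := Finset.mem_range.1 ht
      rw [show n + 1 - 1 - t + m = n - 1 - t + (m + 1) by omega]
    have h2 : ∑ t ∈ Finset.range n, n.choose (t + 1) • c 0 (n - 1 - t + (m + 1)) (D^[t] y) =
        ∑ t ∈ Finset.range (n + 1), n.choose (t + 1) • c 0 (n - t + m) (D^[t] y) := by
      rw [Finset.sum_range_succ, Nat.choose_succ_self, zero_smul, add_zero]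
      refine Finset.sum_congr rfl fun t ht => ?_
      have := Finset.mem_range.1 ht
      rw [show n - 1 - t + (m + 1) = n - t + m by omega]
    rw [h1, ih (m + 1) (by omega), h2, show n + 1 - 1 - n + m = m by omega,
      moveLeft_expand c D hc n m y (by omega), ← Finset.sum_add_distrib]
    refine Finset.sum_congr rfl fun t _ => ?_
    rw [Nat.choose_succ_succ', add_smul, add_comm, Nat.add_sub_cancel]

/-- In characteristic `p`, `∑ xʳ y xˢ = (ad x) ^ (p - 1) y`, where the sum is over
`r + s = p - 1`. -/
theorem sum_moveLeft_char (k : Type*) [Field k] [Module k M] (p : ℕ) [CharP k p] [Fact p.Prime]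
    (c : ℕ → ℕ → E → M) (D : E → E)
    (hc : ∀ r s y, r + s + 2 ≤ p → c (r + 1) s y = c r (s + 1) y + c r s (D y)) (y : E) :
    ∑ r ∈ Finset.range p, c r (p - 1 - r) y = c 0 0 (D^[p - 1] y) := by
  have h := sum_moveLeft c D hc y p 0 (by omega)
  simp only [add_zero] at h
  have hp := (Fact.out : p.Prime).pos
  rw [h, Finset.sum_eq_single (p - 1)]
  · simp [Nat.sub_add_cancel hp]
  · intro t ht htp
    have ht' := Finset.mem_range.1 ht
    obtain ⟨d, hd⟩ := (Fact.out : p.Prime).dvd_choose_self (k := t + 1) (by omega) (by omega)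
    rw [hd, ← Nat.cast_smul_eq_nsmul k]
    simp
  · intro h0
    exact absurd (Finset.mem_range.2 (by omega)) h0

variable {k : Type*} [Field k] {A : Type*} [Ring A] [Algebra k A]

/-- The inner derivation `x ↦ a x - x a`. -/
def innerDer (k : Type*) [Field k] {A : Type*} [Ring A] [Algebra k A] (a : A) : Module.End k A :=
  LinearMap.mulLeft k a - LinearMap.mulRight k a

theorem innerDer_apply (a x : A) : innerDer k a x = a * x - x * a := rfl

open Polynomial in
/-- The polynomial in `X` with operator coefficients that occurs in the additivity
axiom of the `p`-operation computes powers of the inner derivation of `A[X]` given by `a X + b`. -/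
theorem coeff_innerDer_pow (a b x : A) (n i : ℕ) :
    ((X * C (innerDer k a) + C (innerDer k b) : Polynomial (Module.End k A)) ^ n).coeff i x =
      ((innerDer k (X * C a + C b : A[X]) ^ n) (C x)).coeff i := by
  induction n generalizing i with
  | zero => by_cases hi : i = 0 <;> simp [Polynomial.coeff_one, Polynomial.coeff_C, hi]
  | succ n ih =>
    rw [pow_succ', pow_succ', Module.End.mul_apply, innerDer_apply]
    generalize (innerDer k (X * C a + C b : A[X]) ^ n) (C x) = Q at ih ⊢
    generalize (X * C (innerDer k a) + C (innerDer k b)) ^ n = P at ih ⊢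
    rw [add_mul, mul_assoc X]
    have e1 : (X * C a + C b) * Q - Q * (X * C a + C b) =
        X * (C a * Q - Q * C a) + (C b * Q - Q * C b) := by
      rw [add_mul, mul_add, ← mul_assoc Q, ← X_mul (p := Q)]
      noncomm_ring
    rw [e1]
    cases i with
    | zero => simp [ih, innerDer_apply]
    | succ i => simp [ih, innerDer_apply]

open Polynomial in
theorem derivative_pow_noncomm (u : A[X]) (n : ℕ) :
    derivative (u ^ n) = ∑ r ∈ Finset.range n, u ^ r * derivative u * u ^ (n - 1 - r) := by
  induction n with
  | zero => simp
  | succ n ih =>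
    rw [pow_succ, derivative_mul, ih, Finset.sum_range_succ, Finset.sum_mul]
    congr 1
    · refine Finset.sum_congr rfl fun r hr => ?_
      have := Finset.mem_range.1 hr
      rw [mul_assoc, ← pow_succ, show n - 1 - r + 1 = n + 1 - 1 - r by omega]
    · simp

open Polynomial in
/-- Jacobson's formula for `(a + b) ^ p` in an associative algebra. -/
theorem jacobson_formula (p : ℕ) [CharP k p] [Fact p.Prime] (a b : A) :
    (a + b) ^ p = a ^ p + b ^ p + ∑ i ∈ Finset.Icc 1 (p - 1), (i : k)⁻¹ •
      ((X * C (innerDer k a) + C (innerDer k b) :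
        Polynomial (Module.End k A)) ^ (p - 1)).coeff (i - 1) a := by
  have hp := (Fact.out : p.Prime).pos
  -- with `u = a X + b`, the derivative of `u ^ p` is `∑ uʳ a uˢ = (ad u) ^ (p - 1) a`; this
  -- determines the coefficients of `u ^ p` in the degrees `1, …, p - 1`
  set u : A[X] := X * C a + C b with hu
  have hdu : derivative u = C a := by simp [hu, derivative_mul]
  have key : (innerDer k u ^ (p - 1)) (C a) = derivative (u ^ p) := by
    rw [derivative_pow_noncomm, hdu,
      sum_moveLeft_char k p (fun r s y => u ^ r * y * u ^ s) (innerDer k u) _ (C a)]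
    · simp [Module.End.pow_apply]
    · intro r s y _
      rw [innerDer_apply, pow_succ u r, pow_succ' u s]
      noncomm_ring
  have hterm : ∀ i ∈ Finset.Icc 1 (p - 1), (i : k)⁻¹ •
      ((X * C (innerDer k a) + C (innerDer k b) :
        Polynomial (Module.End k A)) ^ (p - 1)).coeff (i - 1) a = (u ^ p).coeff i := by
    intro i hi
    obtain ⟨h1, h2⟩ := Finset.mem_Icc.1 hi
    have hi0 : (i : k) ≠ 0 := by
      intro h0
      rw [CharP.cast_eq_zero_iff k p] at h0
      have := Nat.le_of_dvd h1 h0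
      omega
    rw [coeff_innerDer_pow, ← hu, key, coeff_derivative, Nat.sub_add_cancel h1]
    have : ((i - 1 : ℕ) : A) + 1 = ((i : k) • (1 : A)) := by
      rw [Nat.cast_smul_eq_nsmul, nsmul_one, ← Nat.cast_succ, Nat.succ_eq_add_one,
        Nat.sub_add_cancel h1]
    rw [this, mul_smul_comm, mul_one, smul_smul, inv_mul_cancel₀ hi0, one_smul]
  rw [Finset.sum_congr rfl hterm]
  have hdeg : (u ^ p).natDegree ≤ p := by
    have h1 : u.natDegree ≤ 1 := by
      refine (natDegree_add_le _ _).trans (max_le ?_ (by simp))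
      rw [X_mul]
      exact (natDegree_C_mul_le _ _).trans natDegree_X_le
    exact (natDegree_pow_le_of_le p h1).trans (by simp)
  have htop : ∀ n, (u ^ n).coeff n = a ^ n := by
    intro n
    induction n with
    | zero => simp
    | succ n ih =>
      have hn : (u ^ n).coeff (n + 1) = 0 := by
        refine coeff_eq_zero_of_natDegree_lt (lt_of_le_of_lt (natDegree_pow_le_of_le n
          (?_ : u.natDegree ≤ 1)) (by simp))
        refine (natDegree_add_le _ _).trans (max_le ?_ (by simp))
        rw [X_mul]
        exact (natDegree_C_mul_le _ _).trans natDegree_X_le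
      rw [pow_succ, hu, mul_add, ← hu, ← mul_assoc, coeff_add, coeff_mul_C, coeff_mul_C,
        coeff_mul_X, ih, hn, zero_mul, add_zero, pow_succ]
  have hbot : ∀ n, (u ^ n).coeff 0 = b ^ n := by
    intro n
    induction n with
    | zero => simp
    | succ n ih => rw [pow_succ, mul_coeff_zero, ih, pow_succ]; simp [hu]
  let ev : A[X] →+* A := eval₂RingHom' (RingHom.id A) 1 (fun _ => Commute.one_right _)
  have hev : ev u = a + b := by
    simp only [ev, hu, eval₂RingHom', map_add, map_mul]
    simp
  have hsum : ev (u ^ p) = ∑ i ∈ Finset.range (p + 1), (u ^ p).coeff i := by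
    have : ev (u ^ p) = eval₂ (RingHom.id A) 1 (u ^ p) := rfl
    rw [this, eval₂_eq_sum_range' _ (Nat.lt_succ_of_le hdeg)]
    simp
  rw [← hev, ← map_pow, hsum, Finset.sum_range_succ, htop, Finset.range_eq_Ico,
    Finset.sum_eq_sum_Ico_succ_bot hp, hbot]
  have : Finset.Icc 1 (p - 1) = Finset.Ico (0 + 1) p := by
    ext x; simp only [Finset.mem_Icc, Finset.mem_Ico]; omega
  rw [this]
  abel

end Jacobson

end RestrictedSuper

end

noncomputable section

namespace RestrictedSuper

namespace RestrictedLieSuperalgebra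

variable {k : Type*} [Field k] {p : ℕ} {L : Type*} [AddCommGroup L] [Module k L]

/-! ### Homogeneous bases -/

/-- A basis of `g` consisting of homogeneous elements. -/
structure HomogeneousBasis (g : RestrictedLieSuperalgebra k p L) (I : Type*) where
  basis : Module.Basis I k L
  par : I → ZMod 2
  mem : ∀ i, basis i ∈ g.grading.deg (par i)

theorem bracket_even_self [CharP k p] [Fact (2 < p)] (g : RestrictedLieSuperalgebra k p L) {x : L}
    (hx : x ∈ g.grading.deg 0) : g.bracket x x = 0 := by
  have h := g.bracket_skew hx hx
  rw [mul_zero, psign_zero, one_smul, eq_neg_iff_add_eq_zero, ← two_smul k] at h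
  exact (smul_eq_zero.1 h).resolve_left (two_ne_zero_of_char k p)

theorem bracket_bracket_odd (g : RestrictedLieSuperalgebra k p L) {x : L}
    (hx : x ∈ g.grading.deg 1) (y : L) :
    g.bracket (g.bracket x x) y = (2 : k) • g.bracket x (g.bracket x y) := by
  have key : ∀ {l : ZMod 2} {z : L}, z ∈ g.grading.deg l →
      g.bracket (g.bracket x x) z = (2 : k) • g.bracket x (g.bracket x z) := by
    intro l z hz
    have h := g.jacobi hx hx hz
    rw [mul_one, psign_one, neg_one_smul, ← sub_eq_add_neg, eq_sub_iff_add_eq] at h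
    rw [← h, two_smul]
  rw [← g.grading.proj_add y, map_add, map_add, map_add, key (g.grading.proj_mem 0 y),
    key (g.grading.proj_mem 1 y), smul_add]

/-- The bracket with an even element is an honest Lie bracket, also on inhomogeneous elements. -/
theorem bracket_even_skew (g : RestrictedLieSuperalgebra k p L) {x : L}
    (hx : x ∈ g.grading.deg 0) (y : L) : g.bracket x y = -g.bracket y x := by
  have h0 := g.bracket_skew hx (g.grading.proj_mem 0 y)
  have h1 := g.bracket_skew hx (g.grading.proj_mem 1 y)
  simp only [zero_mul, psign_zero, one_smul] at h0 h1
  rw [← g.grading.proj_add y, map_add, map_add, LinearMap.add_apply, h0, h1, neg_add]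

namespace HomogeneousBasis

variable {g : RestrictedLieSuperalgebra k p L} {I : Type*} (B : HomogeneousBasis g I)

theorem deg_le_span (α : ZMod 2) :
    g.grading.deg α ≤ Submodule.span k (B.basis '' {i | B.par i = α}) := by
  intro x hx
  rw [← g.grading.proj_self hx]
  have h : (Submodule.span k (Set.range B.basis)).map (g.grading.proj α) ≤
      Submodule.span k (B.basis '' {i | B.par i = α}) := by
    rw [Submodule.map_span_le]
    rintro _ ⟨i, rfl⟩
    by_cases hi : B.par i = α
    · rw [g.grading.proj_self (hi ▸ B.mem i)]
      exact Submodule.subset_span ⟨i, hi, rfl⟩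
    · rw [g.grading.proj_ne hi (B.mem i)]
      exact zero_mem _
  rw [B.basis.span_eq] at h
  exact h ⟨x, trivial, rfl⟩

/-- To check a linear statement on homogeneous elements it is enough to check it on the basis. -/
theorem induction_deg {α : ZMod 2} {P : L → Prop} (h0 : P 0) (hadd : ∀ x y, P x → P y → P (x + y))
    (hsmul : ∀ (c : k) x, P x → P (c • x)) (hb : ∀ i, B.par i = α → P (B.basis i)) {x : L}
    (hx : x ∈ g.grading.deg α) : P x := by
  refine Submodule.span_induction (p := fun x _ => P x) ?_ h0 (fun x y _ _ => hadd x y)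
    (fun c x _ => hsmul c x) (B.deg_le_span α hx)
  rintro _ ⟨i, hi, rfl⟩
  exact hb i hi

/-- The exponent `q` of the relation `xᵢ ^ q = pw i`: it is `p` for even and `2` for odd `xᵢ`. -/
def q (i : I) : ℕ := if B.par i = 0 then p else 2

/-- The value of `xᵢ ^ q` in the enveloping superalgebra: `xᵢ^[p]` for even `xᵢ` and
`[xᵢ, xᵢ] / 2` for odd `xᵢ`. -/
def pw (i : I) : L :=
  if h : B.par i = 0 then (g.pmap ⟨B.basis i, h ▸ B.mem i⟩ : L)
  else (2 : k)⁻¹ • g.bracket (B.basis i) (B.basis i)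

theorem par_cases (i : I) : (B.par i = 0) ∨ (B.par i ≠ 0 ∧ B.par i = 1) := by
  rcases zmod2_cases (B.par i) with h | h
  · exact Or.inl h
  · exact Or.inr ⟨by rw [h]; decide, h⟩

theorem pw_mem (i : I) : B.pw i ∈ g.grading.deg 0 := by
  rcases B.par_cases i with h | ⟨h, h1⟩
  · rw [pw, dif_pos h]; exact (g.pmap _).2
  · rw [pw, dif_neg h]
    refine Submodule.smul_mem _ _ ?_
    have := g.bracket_mem (B.mem i) (B.mem i)
    rwa [h1, show (1 + 1 : ZMod 2) = 0 by decide] at this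

variable [CharP k p] [Fact p.Prime] [Fact (2 < p)]

theorem two_le_q (i : I) : 2 ≤ B.q i := by
  have : 2 < p := Fact.out
  unfold q; split <;> omega

/-- The relation `xᵢ ^ q = pw i` is compatible with the adjoint action. -/
theorem bracket_pw (i : I) (y : L) :
    g.bracket (B.pw i) y = (g.bracket (B.basis i) : Module.End k L)^[B.q i] y := by
  rcases B.par_cases i with h | ⟨h, h1⟩
  · rw [pw, dif_pos h, g.bracket_pmap, q, if_pos h, Module.End.pow_apply]
  · have hi := B.mem i
    rw [h1] at hi
    rw [pw, dif_neg h, q, if_neg h, map_smul, LinearMap.smul_apply, g.bracket_bracket_odd hi,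
      smul_smul, inv_mul_cancel₀ (two_ne_zero_of_char k p), one_smul]
    rfl

/-- The relation `xᵢ ^ q = pw i` is compatible with the associativity of `xᵢ ^ (q + 1)`. For odd
`xᵢ` this is the axiom `[x, [x, x]] = 0`. -/
theorem bracket_basis_pw (i : I) : g.bracket (B.basis i) (B.pw i) = 0 := by
  rcases B.par_cases i with h | ⟨h, h1⟩
  · have hi := B.mem i
    rw [h] at hi
    have hq : B.q i = (B.q i - 1) + 1 := by have := B.two_le_q i; omega
    rw [g.bracket_even_skew hi, bracket_pw, hq, Function.iterate_succ_apply,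
      g.bracket_even_self hi, ← Module.End.pow_apply, map_zero, neg_zero]
  · have hi := B.mem i
    rw [h1] at hi
    rw [pw, dif_neg h, map_smul, g.bracket_odd_cube hi, smul_zero]

/-! ### Straightening of words -/

variable [LinearOrder I]

/-- A word in the basis is irreducible if its letters are in increasing order, and if the letter
`i` occurs fewer than `p` or `2` times, according to its parity. -/
def Irr (w : List I) : Prop := w.Pairwise (· ≤ ·) ∧ ∀ i, w.count i < B.q i

theorem replicate_count_prefix {w : List I} (hw : w.Pairwise (· ≤ ·)) {i : I}
    (hi : ∀ j ∈ w, i ≤ j) :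
    List.replicate (w.count i) i <+: w := by
  induction w with
  | nil => simp
  | cons j C ih =>
    rw [List.pairwise_cons] at hw
    by_cases hji : j = i
    · subst hji
      rw [List.count_cons_self, List.replicate_succ, List.prefix_cons_inj]
      exact ih hw.2 hw.1
    · rw [List.count_eq_zero.2, List.replicate_zero]
      · exact List.nil_prefix
      · intro hmem
        rcases List.mem_cons.1 hmem with h | h
        · exact hji h.symm
        · exact hji (le_antisymm (hw.1 i h) (hi j List.mem_cons_self))

theorem irr_nil : B.Irr [] :=
  ⟨List.Pairwise.nil, fun i => by have := B.two_le_q i; simp; omega⟩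

/-- Irreducibility is a local condition: only the beginning of the word has to be checked for an
inversion of adjacent letters and for a power `xᵢ ^ q`. -/
theorem irr_cons {i : I} {w : List I} : B.Irr (i :: w) ↔
    B.Irr w ∧ (∀ j C, w = j :: C → i ≤ j) ∧ ¬ List.replicate (B.q i) i <+: i :: w := by
  constructor
  · rintro ⟨h1, h2⟩
    rw [List.pairwise_cons] at h1
    refine ⟨⟨h1.2, fun j => lt_of_le_of_lt (List.count_le_count_cons) (h2 j)⟩, ?_, ?_⟩
    · rintro j C rfl
      exact h1.1 j List.mem_cons_self
    · intro hp
      have := hp.sublist.count_le i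
      rw [List.count_replicate_self] at this
      exact absurd (h2 i) (not_lt.2 this)
  · rintro ⟨⟨h1, h2⟩, h3, h4⟩
    have hle : ∀ j ∈ w, i ≤ j := by
      cases w with
      | nil => simp
      | cons j C =>
        rw [List.pairwise_cons] at h1
        intro l hl
        rcases List.mem_cons.1 hl with rfl | hl
        · exact h3 _ _ rfl
        · exact (h3 _ _ rfl).trans (h1.1 _ hl)
    have hs : (i :: w).Pairwise (· ≤ ·) := List.pairwise_cons.2 ⟨hle, h1⟩
    refine ⟨hs, fun j => ?_⟩
    by_cases hji : j = i
    · subst hji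
      by_contra hcon
      refine h4 (List.IsPrefix.trans ?_ (replicate_count_prefix hs (i := j) ?_))
      · rw [List.prefix_replicate_iff]
        simpa using hcon
      · intro l hl
        rcases List.mem_cons.1 hl with rfl | hl
        · exact le_rfl
        · exact hle _ hl
    · rw [List.count_cons_of_ne (fun h => hji h.symm)]
      exact h2 j

/-- The linear combination consisting of a single word. -/
abbrev wd (k : Type*) [Field k] (w : List I) : List I →₀ k := Finsupp.single w 1

/-- Left multiplication by elements of `g`, on linear combinations of words. -/
def op : L →ₗ[k] Module.End k (List I →₀ k) :=
  B.basis.constr k fun i => Finsupp.lmapDomain k k (List.cons i)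

@[simp] theorem op_wd (i : I) (w : List I) : B.op (B.basis i) (wd k w) = wd k (i :: w) := by
  simp [op]

theorem op_basis_apply (y : L) (w : List I) (A : Set (List I))
    (hA : ∀ i, B.basis.repr y i ≠ 0 → i :: w ∈ A) :
    B.op y (wd k w) ∈ Finsupp.supported k k A := by
  have : B.op y (wd k w) = ∑ i ∈ (B.basis.repr y).support, B.basis.repr y i • wd k (i :: w) := by
    conv_lhs => rw [← B.basis.linearCombination_repr y]
    rw [Finsupp.linearCombination_apply, Finsupp.sum, map_sum, LinearMap.sum_apply]
    simp only [map_smul, LinearMap.smul_apply, op_wd]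
  rw [this]
  refine Submodule.sum_mem _ fun i hi => Submodule.smul_mem _ _ ?_
  exact Finsupp.single_mem_supported k _ (hA i (Finsupp.mem_support_iff.1 hi))

theorem op_basis_mem (i : I) {t : List I →₀ k} {A A' : Set (List I)}
    (ht : t ∈ Finsupp.supported k k A') (hA : ∀ w ∈ A', i :: w ∈ A) :
    B.op (B.basis i) t ∈ Finsupp.supported k k A := by
  rw [Finsupp.supported_eq_span_single] at ht
  refine Submodule.span_induction ?_ (by simp) (fun x y _ _ hx hy => ?_) (fun c x _ hx => ?_) ht
  · rintro _ ⟨w, hw, rfl⟩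
    have := B.op_wd i w
    rw [wd, wd] at this
    rw [this]
    exact Finsupp.single_mem_supported k _ (hA w hw)
  · rw [map_add]; exact add_mem hx hy
  · rw [map_smul]; exact Submodule.smul_mem _ _ hx

open scoped Classical in
/-- One straightening step at the beginning of the word `i :: w`. -/
def front (i : I) (w : List I) : List I →₀ k :=
  if List.replicate (B.q i) i <+: i :: w then B.op (B.pw i) (wd k ((i :: w).drop (B.q i)))
  else match w with
    | [] => 0
    | j :: C => psign k (B.par i * B.par j) • wd k (j :: i :: C) +
        B.op (g.bracket (B.basis i) (B.basis j)) (wd k C)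

open scoped Classical in
/-- One straightening step, applied as far to the right as possible. -/
def red : List I → (List I →₀ k)
  | [] => 0
  | i :: w => if B.Irr w then B.front i w else B.op (B.basis i) (red w)

theorem red_cons_of_not_irr {i : I} {w : List I} (hw : ¬ B.Irr w) :
    B.red (i :: w) = B.op (B.basis i) (B.red w) := by
  rw [red, if_neg hw]

theorem red_pow {i : I} {C : List I} (hw : B.Irr ((List.replicate (B.q i) i ++ C).tail)) :
    B.red (List.replicate (B.q i) i ++ C) = B.op (B.pw i) (wd k C) := by
  obtain ⟨n, hn⟩ : ∃ n, B.q i = n + 1 := ⟨B.q i - 1, by have := B.two_le_q i; omega⟩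
  have e : List.replicate (B.q i) i ++ C = i :: (List.replicate n i ++ C) := by
    rw [hn, List.replicate_succ, List.cons_append]
  have hw' : B.Irr (List.replicate n i ++ C) := by rwa [e] at hw
  rw [e, red, if_pos hw']
  refine (if_pos ?_).trans ?_
  · rw [← e]
    exact List.prefix_append _ _
  · rw [← e, List.drop_left' (by simp)]

theorem red_swap {i j : I} {C : List I} (hji : j < i) (hw : B.Irr (j :: C)) :
    B.red (i :: j :: C) = psign k (B.par i * B.par j) • wd k (j :: i :: C) +
        B.op (g.bracket (B.basis i) (B.basis j)) (wd k C) := by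
  rw [red, if_pos hw]
  refine if_neg ?_
  intro hp
  obtain ⟨n, hn⟩ : ∃ n, B.q i = n + 2 := ⟨B.q i - 2, by have := B.two_le_q i; omega⟩
  rw [hn, List.replicate_succ, List.replicate_succ, List.prefix_cons_inj,
    List.cons_prefix_cons] at hp
  exact hji.ne' hp.1

/-- The length-lexicographic order on words. -/
def Less (w w' : List I) : Prop := List.Shortlex (· < ·) w w'

theorem Less.of_length {w w' : List I} (h : w.length < w'.length) : Less w w' :=
  List.Shortlex.of_length_lt h

theorem Less.of_lt {i j : I} {w w' : List I} (hl : w.length = w'.length) (h : i < j) :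
    Less (i :: w) (j :: w') :=
  List.Shortlex.of_lex (by simp [hl]) (List.Lex.rel h)

theorem Less.cons {w w' : List I} (h : Less w w') (i : I) : Less (i :: w) (i :: w') :=
  List.Shortlex.cons h

theorem Less.length_le {w w' : List I} (h : Less w w') : w.length ≤ w'.length := by
  rcases List.shortlex_def.1 h with h | h
  · exact h.le
  · exact h.1.le

theorem Less.trans {w w' w'' : List I} (h : Less w w') (h' : Less w' w'') : Less w w'' := by
  rcases List.shortlex_def.1 h with h | h
  · exact Less.of_length (h.trans_le h'.length_le)
  · rcases List.shortlex_def.1 h' with h' | h'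
    · exact Less.of_length (h.1.trans_lt h')
    · exact List.Shortlex.of_lex (h.1.trans h'.1) (List.lt_trans h.2 h'.2)

variable [WellFoundedLT I]

theorem less_wf : WellFounded (Less (I := I)) := List.Shortlex.wf wellFounded_lt

@[elab_as_elim]
theorem less_induction {C : List I → Prop} (w : List I)
    (h : ∀ w, (∀ w', Less w' w → C w') → C w) : C w := less_wf.induction w h

/-- A word that becomes irreducible after removing its first letter starts with an inversion or
with a power `xᵢ ^ q`. -/
theorem front_cases {i : I} {w : List I} (hw' : B.Irr w) (hw : ¬ B.Irr (i :: w)) :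
    (∃ j C, j < i ∧ w = j :: C) ∨ ∃ C, List.replicate (B.q i) i ++ C = i :: w := by
  by_cases hp : List.replicate (B.q i) i <+: i :: w
  · exact Or.inr hp
  · left
    by_contra hcon
    push Not at hcon
    exact hw (B.irr_cons.2 ⟨hw', fun j C hC => not_lt.1 fun hji => hcon j C hji hC, hp⟩)

/-- Induction on reducible words, following the straightening strategy of `red`. -/
theorem not_irr_induction {P : List I → Prop} (h1 : ∀ i w, ¬ B.Irr w → P w → P (i :: w))
    (h2 : ∀ i j C, j < i → B.Irr (j :: C) → P (i :: j :: C))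
    (h3 : ∀ i C, B.Irr ((List.replicate (B.q i) i ++ C).tail) →
      P (List.replicate (B.q i) i ++ C)) : ∀ w, ¬ B.Irr w → P w := by
  intro w
  induction w with
  | nil => exact fun hw => absurd B.irr_nil hw
  | cons i w ih =>
    intro hw
    by_cases hw' : B.Irr w
    · rcases B.front_cases hw' hw with ⟨j, C, hji, rfl⟩ | ⟨C, hC⟩
      · exact h2 i j C hji hw'
      · rw [← hC]
        exact h3 i C (by rw [hC]; exact hw')
    · exact h1 i w hw' (ih hw')

/-- A straightening step produces smaller words. -/
theorem red_mem : ∀ w, ¬ B.Irr w → B.red w ∈ Finsupp.supported k k {w' | Less w' w} := by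
  refine B.not_irr_induction ?_ ?_ ?_
  · intro i w hw ih
    rw [B.red_cons_of_not_irr hw]
    exact B.op_basis_mem i ih fun w' hw' => Less.cons hw' i
  · intro i j C hji hw
    rw [B.red_swap hji hw]
    refine add_mem (Submodule.smul_mem _ _ ?_) (B.op_basis_apply _ _ _ fun l _ => ?_)
    · exact Finsupp.single_mem_supported k _ (Less.of_lt rfl hji)
    · exact Less.of_length (by simp)
  · intro i C hw
    rw [B.red_pow hw]
    have := B.two_le_q i
    exact B.op_basis_apply _ _ _ fun l _ => Less.of_length (by simp; omega)

open scoped Classical in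
/-- The normal form of a word: the straightening step `red` is iterated until only irreducible
words are left. -/
def nf : List I → (List I →₀ k) :=
  less_wf.fix fun w F => if B.Irr w then wd k w else
    (B.red w).sum fun w' c => if h : Less w' w then c • F w' h else 0

/-- The normal form of a linear combination of words. -/
def NF : Module.End k (List I →₀ k) := Finsupp.linearCombination k B.nf

theorem NF_wd (w : List I) : B.NF (wd k w) = B.nf w := by
  rw [NF, Finsupp.linearCombination_single, one_smul]

theorem NF_of_irr {w : List I} (hw : B.Irr w) : B.NF (wd k w) = wd k w := by
  rw [NF_wd, nf, WellFounded.fix_eq, if_pos hw]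

theorem NF_of_not_irr {w : List I} (hw : ¬ B.Irr w) : B.NF (wd k w) = B.NF (B.red w) := by
  rw [NF_wd, nf, WellFounded.fix_eq, if_neg hw]
  change _ = Finsupp.linearCombination k B.nf (B.red w)
  rw [Finsupp.linearCombination_apply]
  refine Finsupp.sum_congr fun w' hw' => ?_
  exact dif_pos ((Finsupp.mem_supported k _).1 (B.red_mem w hw) hw')

theorem map_supported {M : Type*} [AddCommGroup M] [Module k M] {A : Set (List I)}
    (f : (List I →₀ k) →ₗ[k] M) (S : Submodule k M) (hf : ∀ w ∈ A, f (wd k w) ∈ S)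
    {t : List I →₀ k} (ht : t ∈ Finsupp.supported k k A) : f t ∈ S := by
  rw [Finsupp.supported_eq_span_single] at ht
  have h : (Submodule.span k ((fun w => Finsupp.single w (1 : k)) '' A)).map f ≤ S := by
    rw [Submodule.map_span_le]
    rintro _ ⟨w, hw, rfl⟩
    exact hf w hw
  exact h ⟨t, ht, rfl⟩

theorem eq_of_supported {M : Type*} [AddCommGroup M] [Module k M] {A : Set (List I)}
    (f f' : (List I →₀ k) →ₗ[k] M) (hf : ∀ w ∈ A, f (wd k w) = f' (wd k w))
    {t : List I →₀ k} (ht : t ∈ Finsupp.supported k k A) : f t = f' t := by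
  have := map_supported (f - f') ⊥ (fun w hw => by simp [hf w hw]) ht
  rwa [Submodule.mem_bot, LinearMap.sub_apply, sub_eq_zero] at this

/-- Normal forms stay in every set of words that is stable under straightening steps. -/
theorem NF_mem {A : Set (List I)}
    (hA : ∀ w ∈ A, ¬ B.Irr w → B.red w ∈ Finsupp.supported k k A) {t : List I →₀ k}
    (ht : t ∈ Finsupp.supported k k A) :
    B.NF t ∈ Finsupp.supported k k {w | w ∈ A ∧ B.Irr w} := by
  refine map_supported B.NF _ (fun w hw => ?_) ht
  induction w using less_induction with
  | h w ih =>
    by_cases hi : B.Irr w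
    · rw [B.NF_of_irr hi]
      exact Finsupp.single_mem_supported k _ ⟨hw, hi⟩
    · rw [B.NF_of_not_irr hi]
      have hr : B.red w ∈ Finsupp.supported k k (A ∩ {w' | Less w' w}) := by
        rw [Finsupp.supported_inter]
        exact ⟨hA w hw hi, B.red_mem w hi⟩
      exact map_supported B.NF _ (fun w' hw' => ih w' hw'.2 hw'.1) hr

theorem NF_op_basis_NF (i : I) (t : List I →₀ k) :
    B.NF (B.op (B.basis i) (B.NF t)) = B.NF (B.op (B.basis i) t) := by
  refine eq_of_supported (A := Set.univ) (B.NF ∘ₗ B.op (B.basis i) ∘ₗ B.NF)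
    (B.NF ∘ₗ B.op (B.basis i)) (fun w _ => ?_) (by simp)
  induction w using less_induction with
  | h w ih =>
    simp only [LinearMap.comp_apply] at ih ⊢
    by_cases hi : B.Irr w
    · rw [B.NF_of_irr hi]
    · rw [B.NF_of_not_irr hi, op_wd, B.NF_of_not_irr (w := i :: w), B.red_cons_of_not_irr hi]
      · exact eq_of_supported (B.NF ∘ₗ B.op (B.basis i) ∘ₗ B.NF)
          (B.NF ∘ₗ B.op (B.basis i)) (fun w' hw' => ih w' hw' trivial) (B.red_mem w hi)
      · rw [irr_cons]
        exact fun h => hi h.1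

/-- Normal forms may be taken after removing a first factor. -/
theorem NF_op_NF (y : L) (t : List I →₀ k) : B.NF (B.op y (B.NF t)) = B.NF (B.op y t) := by
  have h : ∀ y ∈ Submodule.span k (Set.range B.basis),
      B.NF (B.op y (B.NF t)) = B.NF (B.op y t) := by
    intro y hy
    induction hy using Submodule.span_induction with
    | mem x hx => obtain ⟨i, rfl⟩ := hx; exact B.NF_op_basis_NF i t
    | zero => simp
    | add x y _ _ hx hy => simp only [map_add, LinearMap.add_apply, hx, hy]
    | smul c x _ hx => simp only [map_smul, LinearMap.smul_apply, hx]
  exact h y (by rw [B.basis.span_eq]; trivial)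

theorem NF_op_congr (y : L) {s t : List I →₀ k} (h : B.NF s = B.NF t) :
    B.NF (B.op y s) = B.NF (B.op y t) := by
  rw [← B.NF_op_NF y s, h, B.NF_op_NF]

end HomogeneousBasis

end RestrictedLieSuperalgebra

end RestrictedSuper

end

noncomputable section

namespace RestrictedSuper

theorem psign_cases (k : Type*) [Field k] (i : ZMod 2) : psign k i = 1 ∨ psign k i = -1 := by
  rcases zmod2_cases i with rfl | rfl <;> simp

namespace RestrictedLieSuperalgebra

namespace HomogeneousBasis

variable {k : Type*} [Field k] {p : ℕ} {L : Type*} [AddCommGroup L] [Module k L]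
variable {g : RestrictedLieSuperalgebra k p L} {I : Type*} (B : HomogeneousBasis g I)
variable [CharP k p] [Fact p.Prime] [Fact (2 < p)] [LinearOrder I] [WellFoundedLT I]

/-! ### Confluence of straightening -/

/-- Normal forms respect the relation `xᵢ xⱼ = ± xⱼ xᵢ + [xᵢ, xⱼ]`, in front of `t`. -/
def Swap (i j : I) (t : List I →₀ k) : Prop :=
  B.NF (B.op (B.basis i) (B.op (B.basis j) t)) =
    psign k (B.par i * B.par j) • B.NF (B.op (B.basis j) (B.op (B.basis i) t)) +
      B.NF (B.op (g.bracket (B.basis i) (B.basis j)) t)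

/-- Normal forms respect the relation `xᵢ ^ q = pw i`, in front of `t`. -/
def Pow (i : I) (t : List I →₀ k) : Prop :=
  B.NF ((B.op (B.basis i) ^ B.q i) t) = B.NF (B.op (B.pw i) t)

variable {B}

theorem Swap.eq {i j : I} {t : List I →₀ k} (h : B.Swap i j t) :
    B.NF (B.op (B.basis i) (B.op (B.basis j) t)) =
      B.NF (psign k (B.par i * B.par j) • B.op (B.basis j) (B.op (B.basis i) t) +
        B.op (g.bracket (B.basis i) (B.basis j)) t) := by
  rw [map_add, map_smul]; exact h

theorem Swap.symm {i j : I} {t : List I →₀ k} (h : B.Swap i j t) : B.Swap j i t := by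
  unfold Swap at h ⊢
  rw [h, g.bracket_skew (B.mem j) (B.mem i), mul_comm (B.par j), smul_add, smul_smul,
    psign_mul_self, one_smul, map_neg, map_smul, LinearMap.neg_apply, LinearMap.smul_apply,
    map_neg, map_smul]
  abel

variable (B)

theorem op_pow_wd (i : I) (n : ℕ) (w : List I) :
    (B.op (B.basis i) ^ n) (wd k w) = wd k (List.replicate n i ++ w) := by
  induction n with
  | zero => simp
  | succ n ih =>
    rw [pow_succ', Module.End.mul_apply, ih, op_wd, List.replicate_succ, List.cons_append]

theorem NF_pow_congr (y : L) (n : ℕ) {s t : List I →₀ k} (h : B.NF s = B.NF t) :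
    B.NF ((B.op y ^ n) s) = B.NF ((B.op y ^ n) t) := by
  induction n with
  | zero => simpa
  | succ n ih =>
    rw [pow_succ', Module.End.mul_apply, Module.End.mul_apply]
    exact B.NF_op_congr y ih

theorem NF_NF (t : List I →₀ k) : B.NF (B.NF t) = B.NF t := by
  refine eq_of_supported (A := Set.univ) (B.NF ∘ₗ B.NF) B.NF (fun w _ => ?_) (by simp)
  induction w using less_induction with
  | h w ih =>
    by_cases hi : B.Irr w
    · rw [LinearMap.comp_apply, B.NF_of_irr hi, B.NF_of_irr hi]
    · rw [LinearMap.comp_apply, B.NF_of_not_irr hi]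
      exact eq_of_supported (B.NF ∘ₗ B.NF) B.NF (fun w' hw' => ih w' hw' trivial) (B.red_mem w hi)

theorem swap_of_NF {i j : I} {t : List I →₀ k} (h : B.Swap i j (B.NF t)) : B.Swap i j t := by
  have e : ∀ y y', B.NF (B.op y (B.op y' (B.NF t))) = B.NF (B.op y (B.op y' t)) := fun y y' =>
    B.NF_op_congr y (B.NF_op_NF y' t)
  unfold Swap at h ⊢
  rwa [e, e, B.NF_op_NF] at h

theorem pow_of_NF {i : I} {t : List I →₀ k} (h : B.Pow i (B.NF t)) : B.Pow i t := by
  unfold Pow at h ⊢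
  rwa [B.NF_op_NF, B.NF_pow_congr _ _ (B.NF_NF t)] at h

theorem swap_of_supported {i j : I} {A : Set (List I)} (h : ∀ w ∈ A, B.Swap i j (wd k w))
    {t : List I →₀ k} (ht : t ∈ Finsupp.supported k k A) : B.Swap i j t :=
  eq_of_supported (B.NF ∘ₗ B.op (B.basis i) ∘ₗ B.op (B.basis j))
    (psign k (B.par i * B.par j) • (B.NF ∘ₗ B.op (B.basis j) ∘ₗ B.op (B.basis i)) +
      B.NF ∘ₗ B.op (g.bracket (B.basis i) (B.basis j))) h ht

theorem pow_of_supported {i : I} {A : Set (List I)} (h : ∀ w ∈ A, B.Pow i (wd k w))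
    {t : List I →₀ k} (ht : t ∈ Finsupp.supported k k A) : B.Pow i t :=
  eq_of_supported (B.NF ∘ₗ (B.op (B.basis i) ^ B.q i)) (B.NF ∘ₗ B.op (B.pw i)) h ht

theorem swap_self_iff_pow {i : I} (hi : B.par i = 1) (t : List I →₀ k) :
    B.Swap i i t ↔ B.Pow i t := by
  have h2 := two_ne_zero_of_char k p
  have hq : B.q i = 2 := if_neg (by rw [hi]; decide)
  have hw : B.pw i = (2 : k)⁻¹ • g.bracket (B.basis i) (B.basis i) :=
    dif_neg (by rw [hi]; decide)
  unfold Swap Pow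
  rw [hq, hw, hi, map_smul, LinearMap.smul_apply, map_smul,
    pow_two, Module.End.mul_apply, mul_one, psign_one, eq_inv_smul_iff₀ h2, two_smul,
    neg_one_smul, eq_neg_add_iff_add_eq]

theorem swap_self_even {i : I} (hi : B.par i = 0) (t : List I →₀ k) : B.Swap i i t := by
  have h := B.mem i
  rw [hi] at h
  unfold Swap
  rw [hi, g.bracket_even_self h]
  simp

/-- The exchange relations hold in front of all words of length less than `ℓ - 2`. -/
def LowSwap (ℓ : ℕ) : Prop := ∀ i j C, C.length + 2 < ℓ → B.Swap i j (wd k C)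

variable {B}

theorem LowSwap.comm {ℓ : ℕ} (h : B.LowSwap ℓ) {α β : ZMod 2} {y y' : L}
    (hy : y ∈ g.grading.deg α) (hy' : y' ∈ g.grading.deg β) {C : List I} (hC : C.length + 2 < ℓ) :
    B.NF (B.op y (B.op y' (wd k C))) = psign k (α * β) • B.NF (B.op y' (B.op y (wd k C))) +
      B.NF (B.op (g.bracket y y') (wd k C)) := by
  refine B.induction_deg (P := fun y => B.NF (B.op y (B.op y' (wd k C))) =
    psign k (α * β) • B.NF (B.op y' (B.op y (wd k C))) + B.NF (B.op (g.bracket y y') (wd k C)))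
    (by simp) (fun x z hx hz => ?_) (fun c x hx => ?_) (fun i hi => ?_) hy
  · simp only [map_add, LinearMap.add_apply, hx, hz]; module
  · simp only [map_smul, LinearMap.smul_apply, hx]; module
  · refine B.induction_deg (P := fun y' => B.NF (B.op (B.basis i) (B.op y' (wd k C))) =
      psign k (α * β) • B.NF (B.op y' (B.op (B.basis i) (wd k C))) +
        B.NF (B.op (g.bracket (B.basis i) y') (wd k C)))
      (by simp) (fun x z hx hz => ?_) (fun c x hx => ?_) (fun j hj => ?_) hy'
    · simp only [map_add, LinearMap.add_apply, hx, hz]; module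
    · simp only [map_smul, LinearMap.smul_apply, hx]; module
    · rw [← hi, ← hj]
      exact h i j C hC

theorem LowSwap.comm_even {ℓ : ℕ} (h : B.LowSwap ℓ) {y : L}
    (hy : y ∈ g.grading.deg 0) (y' : L) {C : List I} (hC : C.length + 2 < ℓ) :
    B.NF (B.op y (B.op y' (wd k C))) = B.NF (B.op y' (B.op y (wd k C))) +
      B.NF (B.op (g.bracket y y') (wd k C)) := by
  have h0 := h.comm hy (g.grading.proj_mem 0 y') hC
  have h1 := h.comm hy (g.grading.proj_mem 1 y') hC
  rw [← g.grading.proj_add y']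
  simp only [zero_mul, psign_zero, one_smul] at h0 h1
  simp only [map_add, LinearMap.add_apply, h0, h1]
  abel

/-- The overlap `xᵢ xⱼ xₗ` is resolved by the Jacobi identity. -/
theorem LowSwap.triple {ℓ : ℕ} (h : B.LowSwap ℓ) {i j l : I} {C : List I} (hC : C.length + 3 ≤ ℓ)
    (h1 : B.Swap j l (wd k (i :: C))) (h2 : B.Swap i l (wd k (j :: C))) :
    B.Swap i j (wd k (l :: C)) := by
  have hC' : C.length + 2 < ℓ := by omega
  have e1 := B.NF_op_congr (B.basis i) (h j l C hC').eq
  simp only [map_add, map_smul] at e1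
  have e2 := B.NF_op_congr (B.basis l) (h i j C hC').eq
  simp only [map_add, map_smul] at e2
  have e3 := B.NF_op_congr (B.basis j) (h i l C hC').eq
  simp only [map_add, map_smul] at e3
  have f1 := h.comm (g.bracket_mem (B.mem i) (B.mem j)) (B.mem l) hC'
  have f2 := h.comm (B.mem i) (g.bracket_mem (B.mem j) (B.mem l)) hC'
  have f3 := h.comm (B.mem j) (g.bracket_mem (B.mem i) (B.mem l)) hC'
  rw [g.jacobi (B.mem i) (B.mem j) (B.mem l), map_add, map_smul, LinearMap.add_apply,
    LinearMap.smul_apply, map_add, map_smul] at f2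
  rw [add_mul, psign_add] at f1
  rw [mul_add, psign_add] at f2 f3
  unfold Swap at h1 h2 ⊢
  rw [← B.op_wd i C] at h1
  rw [← B.op_wd j C] at h2
  rw [← B.op_wd l C]
  rw [e1, h2, e2, e3, h1, f1, f2, f3, mul_comm (B.par j) (B.par i)]
  rcases psign_cases k (B.par i * B.par j) with ha | ha <;> rw [ha] <;> module

/-- The overlap `xᵢ ^ q xₗ` is resolved by `(ad xᵢ) ^ q = ad (pw i)`: moving `xₗ` to the left
through `xᵢ ^ q` yields `∑ xᵢʳ [xᵢ, xₗ] xᵢˢ` over `r + s = q - 1`, up to signs, which is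
`[pw i, xₗ]`. In this form, the statement covers the overlap of the power with an inversion on either side. -/
theorem LowSwap.pow_iff_swap {i l : I} {C : List I} (h : B.LowSwap (B.q i + 1 + C.length))
    (h' : B.Pow i (wd k C)) :
    B.Pow i (wd k (l :: C)) ↔ B.Swap i l (wd k (List.replicate (B.q i - 1) i ++ C)) := by
  have hpre := B.NF_op_congr (B.basis l) h'
  have hcomm := h.comm_even (B.pw_mem i) (B.basis l) (C := C) (by have := B.two_le_q i; omega)
  rcases B.par_cases i with hi | ⟨hi, hi1⟩
  · have hq : B.q i = p := if_pos hi
    have hpos := (Fact.out : p.Prime).pos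
    have hmem := B.mem i
    rw [hi] at hmem
    -- `c r s y` is the normal form of `xᵢʳ y xᵢˢ C`
    let c : ℕ → ℕ → L → (List I →₀ k) := fun r s y =>
      B.NF ((B.op (B.basis i) ^ r) (B.op y ((B.op (B.basis i) ^ s) (wd k C))))
    have step : ∀ r s y, s + 2 ≤ p →
        c (r + 1) s y = c r (s + 1) y + c r s (g.bracket (B.basis i) y) := by
      intro r s y hs
      have h1 := h.comm_even hmem y (C := List.replicate s i ++ C) (by simp; omega)
      rw [← B.op_pow_wd, ← map_add] at h1
      have h2 := B.NF_pow_congr (B.basis i) r h1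
      rw [map_add, map_add] at h2
      have e : B.op (B.basis i) ((B.op (B.basis i) ^ s) (wd k C)) =
          (B.op (B.basis i) ^ (s + 1)) (wd k C) := by rw [pow_succ', Module.End.mul_apply]
      rw [e] at h2
      simpa only [c, pow_succ, Module.End.mul_apply] using h2
    have hsum := sum_moveLeft_char k p c (g.bracket (B.basis i)) (fun r s y hrs =>
      step r s y (by omega)) (g.bracket (B.basis i) (B.basis l))
    -- the intermediate exchanges of `xₗ` with `xᵢ` take place in front of short words, all but the
    -- first one
    have htel : ∀ n, n + 1 ≤ p → c (n + 1) (p - (n + 1)) (B.basis l) = c 1 (p - 1) (B.basis l) +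
        ∑ r ∈ Finset.range n, c (r + 1) (p - 1 - (r + 1)) (g.bracket (B.basis i) (B.basis l)) := by
      intro n
      induction n with
      | zero => intro _; simp
      | succ n ih =>
        intro hn
        rw [Finset.sum_range_succ, ← add_assoc, ← ih (by omega), step _ _ _ (by omega)]
        rw [show p - (n + 1 + 1) + 1 = p - (n + 1) by omega, show p - 1 - (n + 1) = p - (n + 1 + 1)
          by omega]
    have htel' := htel (p - 1) (by omega)
    obtain ⟨n, hn⟩ : ∃ n, n = p - 1 := ⟨p - 1, rfl⟩
    have hn' : p = n + 1 := by omega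
    have hr : Finset.range p = Finset.range (n + 1) := by rw [hn']
    have hp1 : p - (n + 1) = 0 := by omega
    have hbr : g.bracket (B.pw i) (B.basis l) = (g.bracket (B.basis i))^[p] (B.basis l) := by
      rw [B.bracket_pw, hq]
    rw [hr, Finset.sum_range_succ', ← hn, ← Function.iterate_succ_apply, Nat.succ_eq_add_one,
      ← hn', ← hbr, Nat.sub_zero] at hsum
    rw [← hn, hp1] at htel'
    unfold Pow Swap
    rw [← B.op_pow_wd, ← B.op_wd l C]
    have hb : (B.op (B.basis i) ^ (B.q i - 1) : Module.End k _) = B.op (B.basis i) ^ n := by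
      rw [hq, hn]
    rw [hb, hi, zero_mul, psign_zero, one_smul]
    have e0 : B.NF (B.op (B.basis l) (B.op (B.basis i) ((B.op (B.basis i) ^ n) (wd k C)))) =
        B.NF (B.op (B.basis l) (B.op (B.pw i) (wd k C))) := by
      rw [← hpre, hq, congrArg (B.op (B.basis i) ^ ·) hn', pow_succ', Module.End.mul_apply]
    have e1 : B.NF ((B.op (B.basis i) ^ B.q i) (B.op (B.basis l) (wd k C))) =
        c (n + 1) 0 (B.basis l) := by
      simp only [c, hq, hn'.symm, pow_zero, Module.End.one_apply]
    have e2 : B.NF (B.op (B.basis i) (B.op (B.basis l) ((B.op (B.basis i) ^ n) (wd k C)))) =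
        c 1 n (B.basis l) := by
      simp only [c, pow_one]
    have e3 : B.NF (B.op (g.bracket (B.basis i) (B.basis l)) ((B.op (B.basis i) ^ n) (wd k C))) =
        c 0 n (g.bracket (B.basis i) (B.basis l)) := by
      simp only [c, pow_zero, Module.End.one_apply]
    have e4 : c 0 0 (g.bracket (B.pw i) (B.basis l)) =
        B.NF (B.op (g.bracket (B.pw i) (B.basis l)) (wd k C)) := by
      simp only [c, pow_zero, Module.End.one_apply]
    rw [e0, e1, e2, e3, op_wd]
    rw [op_wd] at hcomm
    rw [hcomm, ← e4, ← hsum, htel']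
    constructor
    · intro hh
      have := congrArg (fun x => x - ∑ r ∈ Finset.range n, c (r + 1) (n - (r + 1))
        (g.bracket (B.basis i) (B.basis l))) hh
      simp only [add_sub_cancel_right] at this
      rw [this]; abel
    · intro hh
      rw [hh]; abel
  · have hq : B.q i = 2 := if_neg hi
    have hmem := B.mem i
    rw [hi1] at hmem
    have e1 := B.NF_op_congr (B.basis i) (h i l C (by omega)).eq
    have e2 := h.comm hmem (g.bracket_mem hmem (B.mem l)) (C := C) (by omega)
    have e3 : g.bracket (B.basis i) (g.bracket (B.basis i) (B.basis l)) =
        g.bracket (B.pw i) (B.basis l) := by rw [B.bracket_pw, hq]; rfl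
    unfold Pow Swap
    rw [hq, pow_two, Module.End.mul_apply] at hpre ⊢
    rw [← B.op_wd l C, e1, hcomm, hi1, ← e3, ← B.op_pow_wd,
      show 2 - 1 = 1 from rfl, pow_one, ← hpre]
    rw [mul_add, psign_add, mul_one, psign_one, one_mul] at e2
    simp only [map_add, map_smul, one_mul]
    rw [e2]
    generalize B.NF (B.op (B.basis i) (B.op (B.basis l) (B.op (B.basis i) (wd k C)))) = x
    generalize B.NF (B.op (B.basis l) (B.op (B.basis i) (B.op (B.basis i) (wd k C)))) = y
    generalize B.NF (B.op (g.bracket (B.basis i) (B.basis l)) (B.op (B.basis i) (wd k C))) = z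
    generalize B.NF (B.op (g.bracket (B.basis i) (g.bracket (B.basis i) (B.basis l))) (wd k C)) = v
    rcases psign_cases k (B.par l) with ha | ha <;> rw [ha] <;> constructor <;> intro hh
    · linear_combination (norm := module) (1 : k) • hh
    · linear_combination (norm := module) (1 : k) • hh
    · linear_combination (norm := module) (-1 : k) • hh
    · linear_combination (norm := module) (-1 : k) • hh

/-- Normal forms respect the defining relations at the beginning of a word. The proof is by
induction on the word; only words both of whose letters and tails can be straightened, the
overlaps, require an argument. -/
theorem swap_and_pow (w : List I) :
    (∀ i j C, j < i → w = i :: j :: C → B.Swap i j (wd k C)) ∧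
      ∀ i C, w = List.replicate (B.q i) i ++ C → B.Pow i (wd k C) := by
  induction w using less_induction with
  | h w ih =>
  -- the relations in front of short words hold by induction
  have lowPow : ∀ i C, B.q i + C.length < w.length → B.Pow i (wd k C) := fun i C hC =>
    (ih (List.replicate (B.q i) i ++ C) (Less.of_length (by simpa using hC))).2 i C rfl
  have low : B.LowSwap w.length := by
    intro i j C hC
    rcases lt_trichotomy i j with hij | rfl | hij
    · exact ((ih (j :: i :: C) (Less.of_length (by simpa using hC))).1 j i C hij rfl).symm
    · rcases B.par_cases i with hi | ⟨hi, hi1⟩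
      · exact B.swap_self_even hi _
      · rw [B.swap_self_iff_pow hi1]
        refine lowPow i C ?_
        rw [q, if_neg hi]
        omega
    · exact (ih (i :: j :: C) (Less.of_length (by simpa using hC))).1 i j C hij rfl
  refine ⟨?_, ?_⟩
  · rintro i j C hji rfl
    by_cases hirr : B.Irr (j :: C)
    · -- the straightening strategy uses this exchange
      have hw : ¬ B.Irr (i :: j :: C) := fun h => not_le.2 hji ((B.irr_cons.1 h).2.1 j C rfl)
      unfold Swap
      rw [op_wd, op_wd, B.NF_of_not_irr hw, B.red_swap hji hirr, map_add, map_smul, op_wd, op_wd]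
    · by_cases hC : B.Irr C
      · rcases B.front_cases hC hirr with ⟨l, C', hlj, rfl⟩ | ⟨C', hC'⟩
        · -- overlap of two inversions
          exact low.triple (by simp)
            ((ih (j :: l :: i :: C') (Less.of_lt (by simp) hji)).1 j l _ hlj rfl)
            ((ih (i :: l :: j :: C') ((Less.of_lt (by simp) hlj).cons i)).1 i l _
              (hlj.trans hji) rfl)
        · -- overlap of an inversion with a power
          obtain ⟨n, hn⟩ : ∃ n, B.q j = n + 1 := ⟨B.q j - 1, by have := B.two_le_q j; omega⟩
          have hC2 : C = List.replicate (B.q j - 1) j ++ C' := by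
            rw [hn, List.replicate_succ, List.cons_append] at hC'
            rw [hn, Nat.add_sub_cancel]
            exact (List.cons.inj hC').2.symm
          have hlen : (i :: j :: C).length = B.q j + 1 + C'.length := by
            rw [← hC']; simp; omega
          rw [hlen] at low lowPow
          rw [hC2]
          refine (low.pow_iff_swap (lowPow j C' (by omega)) |>.1 ?_).symm
          refine (ih (List.replicate (B.q j) j ++ i :: C') ?_).2 j _ rfl
          rw [← hC', hn, List.replicate_succ, List.cons_append]
          exact Less.of_lt (by simp; omega) hji
      · -- the tail `C` may be replaced by its normal form, which consists of smaller words
        refine B.swap_of_NF (B.swap_of_supported (A := {C' | Less C' C}) (fun C' hC' => ?_) ?_)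
        · exact (ih (i :: j :: C') ((Less.cons hC' j).cons i)).1 i j C' hji rfl
        · rw [B.NF_of_not_irr hC]
          refine Finsupp.supported_mono (fun w' hw' => hw'.1)
            (B.NF_mem (A := {C' | Less C' C}) ?_ (B.red_mem C hC))
          exact fun w' hw' hi => Finsupp.supported_mono (fun w'' hw'' => Less.trans hw'' hw')
            (B.red_mem w' hi)
  · rintro i C rfl
    have hq2 := B.two_le_q i
    obtain ⟨n, hn⟩ : ∃ n, B.q i = n + 1 := ⟨B.q i - 1, by omega⟩
    have hlen : (List.replicate (B.q i) i ++ C).length = B.q i + C.length := by simp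
    by_cases hirr : B.Irr (List.replicate (B.q i) i ++ C).tail
    · -- the straightening strategy uses this power
      have hw : ¬ B.Irr (List.replicate (B.q i) i ++ C) := fun h => by
        have := h.2 i
        rw [List.count_append, List.count_replicate_self] at this
        omega
      unfold Pow
      rw [op_pow_wd, B.NF_of_not_irr hw, B.red_pow hirr]
    · by_cases hC : B.Irr C
      · obtain ⟨l, C', hl, rfl⟩ : ∃ l C', l ≤ i ∧ C = l :: C' := by
          by_contra hcon
          push Not at hcon
          refine hirr ?_
          have hgt : ∀ j ∈ C, i < j := by
            cases C with
            | nil => simp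
            | cons j C =>
              have h1 : i < j := not_le.1 fun hle => hcon j C hle rfl
              intro l hl
              rcases List.mem_cons.1 hl with rfl | hl
              · exact h1
              · exact h1.trans_le ((List.pairwise_cons.1 hC.1).1 l hl)
          rw [hn, List.replicate_succ, List.cons_append, List.tail_cons]
          refine ⟨List.pairwise_append.2 ⟨List.pairwise_replicate.2 (Or.inr le_rfl), hC.1, ?_⟩, ?_⟩
          · intro a ha b hb
            rw [List.eq_of_mem_replicate ha]
            exact (hgt b hb).le
          · intro j
            rw [List.count_append, List.count_replicate]
            split_ifs with hij
            · have : i = j := by simpa using hij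
              subst this
              rw [List.count_eq_zero.2 (fun hmem => lt_irrefl _ (hgt _ hmem))]
              omega
            · rw [zero_add]
              exact hC.2 j
        rcases hl.lt_or_eq with hl | rfl
        · have hlen' : (List.replicate (B.q i) i ++ l :: C').length = B.q i + 1 + C'.length := by
            simp; omega
          rw [hlen'] at low lowPow
          -- overlap of a power with an inversion
          refine (low.pow_iff_swap (lowPow i C' (by omega))).2 ?_
          refine (ih (i :: l :: (List.replicate (B.q i - 1) i ++ C')) ?_).1 i l _ hl rfl
          obtain ⟨r, hr⟩ : ∃ r, B.q i = r + 2 := ⟨B.q i - 2, by omega⟩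
          rw [hr, List.replicate_succ, List.replicate_succ, List.cons_append, List.cons_append]
          refine Less.cons (Less.of_lt (by simp; omega) hl) i
        · -- overlap of a power with itself
          have hp : B.Pow l (wd k C') := lowPow l C' (by simp)
          have hc := low.comm (B.mem l) (B.pw_mem l) (C := C') (by simp; omega)
          rw [B.bracket_basis_pw, map_zero, LinearMap.zero_apply, map_zero, add_zero, mul_zero,
            psign_zero, one_smul] at hc
          unfold Pow at hp ⊢
          rw [← B.op_wd l C', ← hc, ← B.NF_op_congr _ hp]
          refine congrArg B.NF ?_
          rw [← Module.End.mul_apply, ← pow_succ, pow_succ', Module.End.mul_apply]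
      · -- the tail `C` may be replaced by its normal form, which consists of smaller words
        refine B.pow_of_NF (B.pow_of_supported (A := {C' | Less C' C}) (fun C' hC' => ?_) ?_)
        · refine (ih (List.replicate (B.q i) i ++ C') ?_).2 i C' rfl
          exact List.Shortlex.append_left hC' _
        · rw [B.NF_of_not_irr hC]
          refine Finsupp.supported_mono (fun w' hw' => hw'.1)
            (B.NF_mem (A := {C' | Less C' C}) ?_ (B.red_mem C hC))
          exact fun w' hw' hi => Finsupp.supported_mono (fun w'' hw'' => Less.trans hw'' hw')
            (B.red_mem w' hi)

variable (B)

/-- Normal forms respect the exchange relations. -/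
theorem swap (i j : I) (t : List I →₀ k) : B.Swap i j t := by
  refine B.swap_of_supported (A := Set.univ) (fun C _ => ?_) (by simp)
  rcases lt_trichotomy i j with hij | rfl | hij
  · exact ((swap_and_pow (j :: i :: C)).1 j i C hij rfl).symm
  · rcases B.par_cases i with hi | ⟨hi, hi1⟩
    · exact B.swap_self_even hi _
    · rw [B.swap_self_iff_pow hi1]
      exact (swap_and_pow _).2 i C rfl
  · exact (swap_and_pow (i :: j :: C)).1 i j C hij rfl

/-- Normal forms respect the power relations. -/
theorem pow (i : I) (t : List I →₀ k) : B.Pow i t :=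
  B.pow_of_supported (A := Set.univ) (fun C _ => (swap_and_pow _).2 i C rfl) (by simp)

end HomogeneousBasis

end RestrictedLieSuperalgebra

end RestrictedSuper

end

noncomputable section

namespace RestrictedSuper

namespace RestrictedLieSuperalgebra

variable {k : Type*} [Field k] {p : ℕ} {L : Type*} [AddCommGroup L] [Module k L]

namespace HomogeneousBasis

variable {g : RestrictedLieSuperalgebra k p L} {I : Type*} (B : HomogeneousBasis g I)
variable [CharP k p] [Fact p.Prime] [Fact (2 < p)] [LinearOrder I] [WellFoundedLT I]

/-! ### The Poincaré–Birkhoff–Witt theorem -/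

/-- By Jacobson's formula, the relation `f x ^ p = f x^[p]` has to be checked on basis elements
only. -/
theorem pow_pmap {A : Type*} [Ring A] [Algebra k A] (f : L →ₗ[k] A)
    (hf : ∀ {x : L}, x ∈ g.grading.deg 0 → ∀ y, f (g.bracket x y) = innerDer k (f x) (f y))
    (hb : ∀ i, B.par i = 0 → f (B.basis i) ^ p = f (B.pw i))
    {x : L} (hx : x ∈ g.grading.deg 0) : f x ^ p = f (g.pmap ⟨x, hx⟩) := by
  have hp0 := (Fact.out : p.Prime).ne_zero
  have : ∃ hx : x ∈ g.grading.deg 0, f x ^ p = f (g.pmap ⟨x, hx⟩) := by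
    refine B.induction_deg (P := fun x => ∃ hx : x ∈ g.grading.deg 0,
      f x ^ p = f (g.pmap ⟨x, hx⟩)) ⟨zero_mem _, ?_⟩ ?_ ?_ ?_ hx
    · have h := g.pmap_smul 0 0
      rw [zero_smul, zero_pow hp0, zero_smul] at h
      have h' : g.pmap ⟨0, zero_mem _⟩ = 0 := h
      rw [h', map_zero, zero_pow hp0]
      simp
    · rintro x y ⟨hx, hx'⟩ ⟨hy, hy'⟩
      refine ⟨add_mem hx hy, ?_⟩
      have h := congrArg f (g.pmap_add ⟨x, hx⟩ ⟨y, hy⟩)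
      rw [map_add, jacobson_formula (k := k) p, hx', hy']
      refine Eq.trans ?_ h.symm
      rw [map_add, map_add, map_sum]
      refine congrArg₂ _ rfl (Finset.sum_congr rfl fun i _ => ?_)
      rw [map_smul]
      exact congrArg _ (Sub.coeff_bracket_pow f (hf hx) (hf hy) _ _ _).symm
    · rintro c x ⟨hx, hx'⟩
      refine ⟨Submodule.smul_mem _ c hx, ?_⟩
      have h := congrArg (fun z : g.grading.deg 0 => f z) (g.pmap_smul c ⟨x, hx⟩)
      rw [map_smul, smul_pow, hx']
      refine Eq.trans ?_ h.symm
      simp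
    · intro i hi
      have hm := B.mem i
      rw [hi] at hm
      refine ⟨hm, ?_⟩
      rw [hb i hi, pw, dif_pos hi]
  exact this.2

/-- The operators on combinations of words through which `U'(g)` will act. -/
def normOp : L →ₗ[k] Module.End k (List I →₀ k) := LinearMap.mulLeft k B.NF ∘ₗ B.op

theorem normOp_apply (y : L) (t : List I →₀ k) : B.normOp y t = B.NF (B.op y t) := rfl

theorem normOp_mul (x y : L) (t : List I →₀ k) :
    (B.normOp x * B.normOp y) t = B.NF (B.op x (B.op y t)) := by
  rw [Module.End.mul_apply, normOp_apply, normOp_apply, NF_op_NF]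

/-- By confluence, the operators `normOp` satisfy the defining relations of `U'(g)`. -/
theorem normOp_comm {i j : ZMod 2} {x y : L} (hx : x ∈ g.grading.deg i)
    (hy : y ∈ g.grading.deg j) : B.normOp x * B.normOp y =
      psign k (i * j) • (B.normOp y * B.normOp x) + B.normOp (g.bracket x y) := by
  refine B.induction_deg (P := fun x => B.normOp x * B.normOp y =
      psign k (i * j) • (B.normOp y * B.normOp x) + B.normOp (g.bracket x y))
    (by simp) (fun x z hx hz => ?_) (fun c x hx => ?_) (fun a ha => ?_) hx
  · simp only [map_add, add_mul, mul_add, LinearMap.add_apply, hx, hz]; module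
  · simp only [map_smul, smul_mul_assoc, mul_smul_comm, LinearMap.smul_apply, hx]; module
  · refine B.induction_deg (P := fun y => B.normOp (B.basis a) * B.normOp y =
      psign k (i * j) • (B.normOp y * B.normOp (B.basis a)) + B.normOp (g.bracket (B.basis a) y))
      (by simp) (fun x z hx hz => ?_) (fun c x hx => ?_) (fun b hb => ?_) hy
    · simp only [map_add, add_mul, mul_add, hx, hz]; module
    · simp only [map_smul, smul_mul_assoc, mul_smul_comm, hx]; module
    · refine LinearMap.ext fun t => ?_
      rw [normOp_mul, LinearMap.add_apply, LinearMap.smul_apply, normOp_mul, ← ha, ← hb]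
      exact B.swap a b t

theorem normOp_bracket_even {x : L} (hx : x ∈ g.grading.deg 0) (y : L) :
    B.normOp (g.bracket x y) = innerDer k (B.normOp x) (B.normOp y) := by
  have h0 := B.normOp_comm hx (g.grading.proj_mem 0 y)
  have h1 := B.normOp_comm hx (g.grading.proj_mem 1 y)
  simp only [zero_mul, psign_zero, one_smul] at h0 h1
  rw [innerDer_apply, ← g.grading.proj_add y]
  simp only [map_add, mul_add, add_mul, h0, h1]
  abel

theorem normOp_pow_basis {i : I} (hi : B.par i = 0) :
    B.normOp (B.basis i) ^ p = B.normOp (B.pw i) := by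
  refine LinearMap.ext fun t => ?_
  have hpow : ∀ n, (B.normOp (B.basis i) ^ (n + 1)) t = B.NF ((B.op (B.basis i) ^ (n + 1)) t) := by
    intro n
    induction n with
    | zero => simp [normOp_apply]
    | succ n ih =>
      rw [pow_succ', Module.End.mul_apply, ih, normOp_apply, NF_op_NF, pow_succ' _ (n + 1),
        Module.End.mul_apply]
  have hq : B.q i = p := if_pos hi
  have := B.pow i t
  unfold Pow at this
  rw [hq] at this
  obtain ⟨n, hn⟩ : ∃ n, p = n + 1 :=
    ⟨p - 1, (Nat.sub_add_cancel (Fact.out : p.Prime).one_le).symm⟩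
  rw [normOp_apply, ← this, congrArg (B.normOp (B.basis i) ^ ·) hn,
    congrArg (B.op (B.basis i) ^ ·) hn]
  exact hpow n

theorem normOp_pow {x : L} (hx : x ∈ g.grading.deg 0) :
    B.normOp x ^ p = B.normOp (g.pmap ⟨x, hx⟩) := by
  refine B.pow_pmap (A := Module.End k (List I →₀ k)) B.normOp
    (fun {x} hx y => B.normOp_bracket_even hx y) (fun i hi => ?_) hx
  exact B.normOp_pow_basis hi

/-- The action of `U'(g)` on combinations of words. -/
def wordAct : g.Env →ₐ[k] Module.End k (List I →₀ k) :=
  g.lift (A := Module.End k (List I →₀ k)) B.normOp (fun hx hy => B.normOp_comm hx hy)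
    (fun x => B.normOp_pow x.2)

/-- The product in `U'(g)` of the letters of a word. -/
def wp (w : List I) : g.Env := (w.map fun i => g.ι (B.basis i)).prod

@[simp] theorem wp_nil : B.wp [] = 1 := rfl

@[simp] theorem wp_cons (i : I) (w : List I) : B.wp (i :: w) = g.ι (B.basis i) * B.wp w := by
  simp [wp]

theorem wp_append (w w' : List I) : B.wp (w ++ w') = B.wp w * B.wp w' := by
  simp [wp]

/-- The evaluation of combinations of words in `U'(g)`. -/
def ev : (List I →₀ k) →ₗ[k] g.Env := Finsupp.linearCombination k B.wp

@[simp] theorem ev_wd (w : List I) : B.ev (wd k w) = B.wp w := by simp [ev]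

theorem ev_op (y : L) (t : List I →₀ k) : B.ev (B.op y t) = g.ι y * B.ev t := by
  have h : B.ev.compRight k ∘ₗ B.op =
      (LinearMap.lcomp k _ B.ev ∘ₗ LinearMap.mul k g.Env) ∘ₗ g.ι := by
    refine B.basis.ext fun i => ?_
    refine Finsupp.lhom_ext' fun w => LinearMap.ext_ring ?_
    have := B.op_wd i w
    simp only [wd] at this
    simp [this, ev]
  exact LinearMap.congr_fun (LinearMap.congr_fun h y) t

theorem ev_pow (i : I) : g.ι (B.basis i) ^ B.q i = g.ι (B.pw i) := by
  rcases B.par_cases i with hi | ⟨hi, hi1⟩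
  · rw [q, if_pos hi, pw, dif_pos hi]
    exact g.ι_pow ⟨_, _⟩
  · have h := g.ι_mul_ι (B.mem i) (B.mem i)
    rw [hi1, mul_one, psign_one, neg_one_smul, eq_neg_add_iff_add_eq, ← two_smul k,
      ← eq_inv_smul_iff₀ (two_ne_zero_of_char k p)] at h
    rw [q, if_neg hi, pw, dif_neg hi, pow_two, h, map_smul]

theorem ev_red : ∀ w, ¬ B.Irr w → B.ev (B.red w) = B.wp w := by
  refine B.not_irr_induction ?_ ?_ ?_
  · intro i w hw ih
    rw [B.red_cons_of_not_irr hw, ev_op, ih, wp_cons]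
  · intro i j C hji hw
    rw [B.red_swap hji hw, map_add, map_smul, ev_wd, ev_op, ev_wd, wp_cons, wp_cons, wp_cons,
      wp_cons, ← mul_assoc, ← mul_assoc, g.ι_mul_ι (B.mem i) (B.mem j), add_mul, smul_mul_assoc]
  · intro i C hw
    rw [B.red_pow hw, ev_op, ev_wd, wp_append, ← B.ev_pow]
    simp [wp]

theorem ev_NF (t : List I →₀ k) : B.ev (B.NF t) = B.ev t := by
  refine eq_of_supported (A := Set.univ) (B.ev ∘ₗ B.NF) B.ev (fun w _ => ?_) (by simp)
  induction w using less_induction with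
  | h w ih =>
    rw [LinearMap.comp_apply]
    by_cases hi : B.Irr w
    · rw [B.NF_of_irr hi]
    · rw [B.NF_of_not_irr hi, ev_wd, ← B.ev_red w hi]
      exact eq_of_supported (B.ev ∘ₗ B.NF) B.ev (fun w' hw' => ih w' hw' trivial) (B.red_mem w hi)

/-- The normal form of an element of `U'(g)`. -/
def nform : g.Env →ₗ[k] (List I →₀ k) := B.wordAct.toLinearMap.flip (wd k [])

theorem nform_apply (u : g.Env) : B.nform u = B.wordAct u (wd k []) := rfl

theorem nform_wp (w : List I) : B.nform (B.wp w) = B.NF (wd k w) := by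
  rw [nform_apply]
  induction w with
  | nil => rw [B.NF_of_irr B.irr_nil, wp_nil, map_one, Module.End.one_apply]
  | cons i w ih =>
    rw [wp_cons, map_mul, Module.End.mul_apply, ih, wordAct, lift_ι, normOp_apply, NF_op_NF, op_wd]

/-- Hence the products of the irreducible words are linearly independent in `U'(g)`. -/
theorem nform_wp_of_irr {w : List I} (hw : B.Irr w) : B.nform (B.wp w) = wd k w := by
  rw [nform_wp, B.NF_of_irr hw]

theorem nform_ev (t : List I →₀ k) : B.nform (B.ev t) = B.NF t :=
  eq_of_supported (A := Set.univ) (B.nform ∘ₗ B.ev) B.NF (fun w _ => by simp [nform_wp]) (by simp)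

theorem ev_wordAct (u : g.Env) (t : List I →₀ k) : B.ev (B.wordAct u t) = u * B.ev t := by
  induction u using env_induction generalizing t with
  | h_scalar c => rw [AlgHom.commutes, Module.algebraMap_end_apply, map_smul, Algebra.smul_def]
  | h_ι x => rw [wordAct, lift_ι, normOp_apply, ev_NF, ev_op]
  | h_mul a b ha hb => rw [map_mul, Module.End.mul_apply, ha, hb, mul_assoc]
  | h_add a b ha hb => rw [map_add, LinearMap.add_apply, map_add, ha, hb, add_mul]

theorem ev_nform (u : g.Env) : B.ev (B.nform u) = u := by
  rw [nform_apply, ev_wordAct, ev_wd, wp_nil, mul_one]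

theorem NF_mem_irr (t : List I →₀ k) : B.NF t ∈ Finsupp.supported k k {w | B.Irr w} :=
  Finsupp.supported_mono (fun _ hw => hw.2)
    (B.NF_mem (A := Set.univ) (fun _ _ _ => by simp) (by simp))

theorem nform_mem (u : g.Env) : B.nform u ∈ Finsupp.supported k k {w | B.Irr w} := by
  rw [← B.ev_nform u, nform_ev]
  exact B.NF_mem_irr _

/-- The products of irreducible words span `U'(g)`. -/
theorem mem_span_irr (u : g.Env) : u ∈ Submodule.span k (B.wp '' {w | B.Irr w}) := by
  rw [← B.ev_nform u]
  refine map_supported B.ev _ (fun w hw => ?_) (B.nform_mem u)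
  rw [ev_wd]
  exact Submodule.subset_span ⟨w, hw, rfl⟩

end HomogeneousBasis

end RestrictedLieSuperalgebra

end RestrictedSuper

end

noncomputable section

namespace RestrictedSuper

instance sumLex_wellFoundedLT {α β : Type*} [LinearOrder α] [LinearOrder β] [WellFoundedLT α]
    [WellFoundedLT β] : WellFoundedLT (α ⊕ₗ β) :=
  ⟨Sum.lex_wf wellFounded_lt wellFounded_lt⟩

section SumLists

variable {α β : Type*}

/-- The letters of a word that belong to the first alphabet. -/
def lefts (w : List (α ⊕ₗ β)) : List α := w.filterMap fun i => (ofLex i).getLeft?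

/-- The letters of a word that belong to the second alphabet. -/
def rights (w : List (α ⊕ₗ β)) : List β := w.filterMap fun i => (ofLex i).getRight?

@[simp] theorem lefts_nil : lefts ([] : List (α ⊕ₗ β)) = [] := rfl
@[simp] theorem rights_nil : rights ([] : List (α ⊕ₗ β)) = [] := rfl
@[simp] theorem lefts_cons_inl (a : α) (w : List (α ⊕ₗ β)) :
    lefts (toLex (Sum.inl a) :: w) = a :: lefts w := rfl
@[simp] theorem lefts_cons_inr (b : β) (w : List (α ⊕ₗ β)) :
    lefts (toLex (Sum.inr b) :: w) = lefts w := rfl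
@[simp] theorem rights_cons_inl (a : α) (w : List (α ⊕ₗ β)) :
    rights (toLex (Sum.inl a) :: w) = rights w := rfl
@[simp] theorem rights_cons_inr (b : β) (w : List (α ⊕ₗ β)) :
    rights (toLex (Sum.inr b) :: w) = b :: rights w := rfl

/-- The word `a` in the first alphabet followed by the word `b` in the second. -/
def joinWords (a : List α) (b : List β) : List (α ⊕ₗ β) :=
  a.map (fun x => toLex (Sum.inl x)) ++ b.map fun x => toLex (Sum.inr x)

@[simp] theorem lefts_joinWords (a : List α) (b : List β) : lefts (joinWords a b) = a := by
  induction a with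
  | nil =>
    induction b with
    | nil => rfl
    | cons b l ih => exact ih
  | cons x a ih => exact congrArg (x :: ·) ih

@[simp] theorem rights_joinWords (a : List α) (b : List β) : rights (joinWords a b) = b := by
  induction a with
  | nil =>
    induction b with
    | nil => rfl
    | cons b l ih => exact congrArg (b :: ·) ih
  | cons x a ih => exact ih

@[elab_as_elim]
theorem sumLex_cases {P : α ⊕ₗ β → Prop} (i : α ⊕ₗ β) (hl : ∀ a, P (toLex (Sum.inl a)))
    (hr : ∀ b, P (toLex (Sum.inr b))) : P i := by
  rcases h : ofLex i with a | b
  · exact (show i = toLex (Sum.inl a) from h) ▸ hl a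
  · exact (show i = toLex (Sum.inr b) from h) ▸ hr b

theorem eq_joinWords [LinearOrder α] [LinearOrder β] {w : List (α ⊕ₗ β)}
    (hw : w.Pairwise (· ≤ ·)) : w = joinWords (lefts w) (rights w) := by
  induction w with
  | nil => rfl
  | cons i w ih =>
    rw [List.pairwise_cons] at hw
    have ih := ih hw.2
    induction i using sumLex_cases with
    | hl a =>
      rw [lefts_cons_inl, rights_cons_inl]
      exact congrArg (toLex (Sum.inl a) :: ·) ih
    | hr b =>
      have hl : lefts w = [] := by
        rw [List.eq_nil_iff_forall_not_mem]
        intro a ha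
        have h1 : toLex (Sum.inl a) ∈ w := by
          rw [ih]
          exact List.mem_append_left _ (List.mem_map_of_mem ha)
        exact absurd (hw.1 _ h1) (not_le.2 (Sum.Lex.inl_lt_inr a b))
      rw [lefts_cons_inr, rights_cons_inr]
      rw [hl] at ih ⊢
      exact congrArg (toLex (Sum.inr b) :: ·) ih

theorem count_joinWords_inl [DecidableEq α] [DecidableEq (α ⊕ₗ β)] (a : List α) (b : List β)
    (x : α) : (joinWords a b).count (toLex (Sum.inl x)) = a.count x := by
  have hinj : Function.Injective fun x : α => (toLex (Sum.inl x) : α ⊕ₗ β) := fun x y h => by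
    simpa using h
  have h0 : (b.map fun x => (toLex (Sum.inr x) : α ⊕ₗ β)).count (toLex (Sum.inl x)) = 0 :=
    List.count_eq_zero.2 (by simp)
  rw [joinWords, List.count_append, List.count_map_of_injective a _ hinj, h0, add_zero]

theorem count_joinWords_inr [DecidableEq β] [DecidableEq (α ⊕ₗ β)] (a : List α) (b : List β)
    (x : β) : (joinWords a b).count (toLex (Sum.inr x)) = b.count x := by
  have hinj : Function.Injective fun x : β => (toLex (Sum.inr x) : α ⊕ₗ β) := fun x y h => by
    simpa using h
  have h0 : (a.map fun x => (toLex (Sum.inl x) : α ⊕ₗ β)).count (toLex (Sum.inr x)) = 0 :=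
    List.count_eq_zero.2 (by simp)
  rw [joinWords, List.count_append, List.count_map_of_injective b _ hinj, h0, zero_add]

end SumLists

namespace RestrictedLieSuperalgebra

variable {k : Type*} [Field k] {p : ℕ} {L : Type*} [AddCommGroup L] [Module k L]

/-- Relabelling of a homogeneous basis. -/
@[simps]
def HomogeneousBasis.reindex {g : RestrictedLieSuperalgebra k p L} {I I' : Type*}
    (B : HomogeneousBasis g I) (e : I ≃ I') : HomogeneousBasis g I' where
  basis := B.basis.reindex e
  par i := B.par (e.symm i)
  mem i := by rw [B.basis.reindex_apply]; exact B.mem _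

namespace Sub

variable {g : RestrictedLieSuperalgebra k p L} (h : g.Sub)

/-! ### Bases adapted to a subsuperalgebra -/

/-- A homogeneous basis of `g` that consists of a basis of `h`, indexed by `J`, and of a basis of
a supplement, indexed by `S`. -/
structure AdaptedBasis (J S : Type*) where
  whole : HomogeneousBasis g (J ⊕ S)
  sub : HomogeneousBasis h.toRestricted J
  inl : ∀ j, whole.basis (Sum.inl j) = (sub.basis j : L)
  par_inl : ∀ j, whole.par (Sum.inl j) = sub.par j

namespace AdaptedBasis

variable {h} {J S : Type*} (A : h.AdaptedBasis J S)

/-- The basis of the supplement. -/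
def x (s : S) : L := A.whole.basis (Sum.inr s)

/-- The parity of a basis element of the supplement. -/
def par (s : S) : ZMod 2 := A.whole.par (Sum.inr s)

theorem x_mem (s : S) : A.x s ∈ g.grading.deg (A.par s) := A.whole.mem _

/-- The coordinates along the supplement. -/
def coord (s : S) : L →ₗ[k] k := A.whole.basis.coord (Sum.inr s)

theorem coord_apply (s : S) (y : L) : A.coord s y = A.whole.basis.repr y (Sum.inr s) := rfl

theorem coord_x [DecidableEq S] (s t : S) : A.coord s (A.x t) = if s = t then 1 else 0 := by
  classical
  rw [coord_apply, x, A.whole.basis.repr_self, Finsupp.single_apply]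
  simp [eq_comm]

theorem coord_of_mem (s : S) {y : L} (hy : y ∈ h.carrier) : A.coord s y = 0 := by
  have : A.coord s ∘ₗ h.carrier.subtype = 0 := by
    refine A.sub.basis.ext fun j => ?_
    rw [LinearMap.comp_apply, Submodule.subtype_apply, ← A.inl, coord_apply,
      A.whole.basis.repr_self]
    simp
  exact LinearMap.congr_fun this ⟨y, hy⟩

theorem mem_iff_coord {y : L} : y ∈ h.carrier ↔ ∀ s, A.coord s y = 0 := by
  refine ⟨fun hy s => A.coord_of_mem s hy, fun hy => ?_⟩
  rw [← A.whole.basis.linearCombination_repr y, Finsupp.linearCombination_apply]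
  refine Submodule.sum_mem _ fun i _ => ?_
  rcases i with j | s
  · refine Submodule.smul_mem _ _ ?_
    rw [A.inl]
    exact (A.sub.basis j).2
  · change A.coord s y • _ ∈ _
    rw [hy s, zero_smul]
    exact zero_mem _

theorem sub_coord_mem [Fintype S] (y : L) : y - ∑ s, A.coord s y • A.x s ∈ h.carrier := by
  classical
  rw [A.mem_iff_coord]
  intro s
  simp [map_sum, coord_x]

/-- A word in the basis of the supplement is irreducible if it is increasing and no letter is
repeated `p` or `2` times, according to its parity. -/
def Irr [LinearOrder S] (b : List S) : Prop :=
  b.Pairwise (· ≤ ·) ∧ ∀ s, b.count s < A.whole.q (Sum.inr s)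

/-- The product in `U'(g)` of the letters of a word in the basis of the supplement. -/
def sw (b : List S) : g.Env := (b.map fun s => g.ι (A.x s)).prod

@[simp] theorem sw_nil : A.sw [] = 1 := rfl

@[simp] theorem sw_cons (s : S) (b : List S) : A.sw (s :: b) = g.ι (A.x s) * A.sw b := by
  simp [sw]

theorem sw_append (b b' : List S) : A.sw (b ++ b') = A.sw b * A.sw b' := by
  simp [sw]

/-- The adapted basis, with the basis of `h` in front. -/
def front : HomogeneousBasis g (J ⊕ₗ S) := A.whole.reindex toLex

/-- The adapted basis, with the basis of `h` at the end. -/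
def back : HomogeneousBasis g (S ⊕ₗ J) := A.whole.reindex ((Equiv.sumComm J S).trans toLex)

theorem front_inl (j : J) : A.front.basis (toLex (Sum.inl j)) = (A.sub.basis j : L) := by
  rw [← A.inl]; simp [front]

theorem front_inr (s : S) : A.front.basis (toLex (Sum.inr s)) = A.x s := by
  simp [front, x]

theorem back_inl (s : S) : A.back.basis (toLex (Sum.inl s)) = A.x s := by
  simp [back, x]

theorem back_inr (j : J) : A.back.basis (toLex (Sum.inr j)) = (A.sub.basis j : L) := by
  rw [← A.inl]; simp [back]

variable [CharP k p] [Fact p.Prime] [Fact (2 < p)]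
  [LinearOrder J] [WellFoundedLT J] [LinearOrder S] [WellFoundedLT S]

theorem front_irr {a : List J} {b : List S} :
    A.front.Irr (joinWords a b) ↔ A.sub.Irr a ∧ A.Irr b := by
  have hl : ∀ j, A.front.q (toLex (Sum.inl j)) = A.sub.q j := fun j => by
    simp [front, HomogeneousBasis.q, A.par_inl]
  have hr : ∀ s, A.front.q (toLex (Sum.inr s)) = A.whole.q (Sum.inr s) := fun s => by
    simp [front, HomogeneousBasis.q]
  have hml : ∀ l : List J, (l.map fun x => (toLex (Sum.inl x) : J ⊕ₗ S)).Pairwise (· ≤ ·) ↔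
      l.Pairwise (· ≤ ·) := fun l => by simp [List.pairwise_map]
  have hmr : ∀ l : List S, (l.map fun x => (toLex (Sum.inr x) : J ⊕ₗ S)).Pairwise (· ≤ ·) ↔
      l.Pairwise (· ≤ ·) := fun l => by simp [List.pairwise_map]
  constructor
  · rintro ⟨h1, h2⟩
    rw [joinWords, List.pairwise_append] at h1
    refine ⟨⟨(hml a).1 h1.1, fun j => ?_⟩, ⟨(hmr b).1 h1.2.1, fun s => ?_⟩⟩
    · rw [← hl, ← count_joinWords_inl a b j]; exact h2 _
    · rw [← hr, ← count_joinWords_inr a b s]; exact h2 _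
  · rintro ⟨h1, h2⟩
    refine ⟨List.pairwise_append.2 ⟨(hml a).2 h1.1, (hmr b).2 h2.1, ?_⟩, fun i => ?_⟩
    · intro i hi i' hi'
      obtain ⟨j, _, rfl⟩ := List.mem_map.1 hi
      obtain ⟨s, _, rfl⟩ := List.mem_map.1 hi'
      exact (Sum.Lex.inl_lt_inr j s).le
    · induction i using sumLex_cases with
      | hl j => rw [count_joinWords_inl, hl]; exact h1.2 j
      | hr s => rw [count_joinWords_inr, hr]; exact h2.2 s

theorem back_irr {a : List J} {b : List S} (hb : A.back.Irr (joinWords b a)) : A.Irr b := by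
  refine ⟨?_, fun s => ?_⟩
  · have h1 := (List.pairwise_append.1 hb.1).1
    rw [List.pairwise_map] at h1
    simpa using h1
  · have h1 := hb.2 (toLex (Sum.inl s))
    rw [count_joinWords_inl] at h1
    have hl : A.back.q (toLex (Sum.inl s)) = A.whole.q (Sum.inr s) := by
      simp [back, HomogeneousBasis.q]
    rwa [hl] at h1

theorem front_wp (a : List J) (b : List S) :
    A.front.wp (joinWords a b) = h.envIncl (A.sub.wp a) * A.sw b := by
  have h1 : (a.map (fun x => toLex (Sum.inl x : J ⊕ S))).map (fun i => g.ι (A.front.basis i)) =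
      (a.map fun j => h.toRestricted.ι (A.sub.basis j)).map h.envIncl := by
    simp [Function.comp_def, front_inl, h.envIncl_ι]
  rw [joinWords, HomogeneousBasis.wp_append, HomogeneousBasis.wp, HomogeneousBasis.wp, h1,
    HomogeneousBasis.wp, map_list_prod, sw]
  simp [Function.comp_def, front_inr]

theorem back_wp (a : List J) (b : List S) :
    A.back.wp (joinWords b a) = A.sw b * h.envIncl (A.sub.wp a) := by
  have h1 : (a.map (fun x => toLex (Sum.inr x : S ⊕ J))).map (fun i => g.ι (A.back.basis i)) =
      (a.map fun j => h.toRestricted.ι (A.sub.basis j)).map h.envIncl := by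
    simp [Function.comp_def, back_inr, h.envIncl_ι]
  rw [joinWords, HomogeneousBasis.wp_append, HomogeneousBasis.wp, HomogeneousBasis.wp, h1,
    HomogeneousBasis.wp, map_list_prod, sw]
  simp [Function.comp_def, back_inl]

/-- As a right `U'(h)`-module, `U'(g)` is generated by the irreducible words in the supplement. -/
theorem mem_span_back (u : g.Env) :
    u ∈ Submodule.span k {u | ∃ b a, A.Irr b ∧ u = A.sw b * h.envIncl a} := by
  refine Submodule.span_mono ?_ (A.back.mem_span_irr u)
  rintro _ ⟨w, hw, rfl⟩
  have e := eq_joinWords hw.1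
  rw [e, back_wp]
  exact ⟨_, _, A.back_irr (e ▸ hw : A.back.Irr (joinWords (lefts w) (rights w))), rfl⟩

end AdaptedBasis

end Sub

end RestrictedLieSuperalgebra

end RestrictedSuper

end

noncomputable section

namespace RestrictedSuper

namespace RestrictedLieSuperalgebra

namespace Sub

variable {k : Type*} [Field k] {p : ℕ} {L : Type*} [AddCommGroup L] [Module k L]
variable {g : RestrictedLieSuperalgebra k p L} (h : g.Sub)

/-! ### The filtration of the enveloping superalgebra relative to `h` -/

open scoped Classical in
/-- The span of the products of elements of `g` with at most `d` factors outside `h`. -/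
def fil (d : ℕ) : Submodule k g.Env :=
  Submodule.span k {u | ∃ l : List L, l.countP (fun y => y ∉ h.carrier) ≤ d ∧ u = (l.map g.ι).prod}

theorem fil_mono {d d' : ℕ} (hd : d ≤ d') : h.fil d ≤ h.fil d' := by
  refine Submodule.span_mono ?_
  rintro _ ⟨l, hl, rfl⟩
  exact ⟨l, hl.trans hd, rfl⟩

theorem one_mem_fil (d : ℕ) : (1 : g.Env) ∈ h.fil d :=
  Submodule.subset_span ⟨[], by simp, by simp⟩

theorem ι_mem_fil_one (y : L) : g.ι y ∈ h.fil 1 :=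
  Submodule.subset_span ⟨[y], List.countP_le_length, by simp⟩

theorem ι_mem_fil_zero {y : L} (hy : y ∈ h.carrier) : g.ι y ∈ h.fil 0 :=
  Submodule.subset_span ⟨[y], by simp [hy], by simp⟩

theorem mul_mem_fil {d d' e : ℕ} {u v : g.Env} (hu : u ∈ h.fil d) (hv : v ∈ h.fil d')
    (he : d + d' ≤ e) : u * v ∈ h.fil e := by
  refine h.fil_mono he ?_
  have key : ∀ u ∈ h.fil d, ∀ v ∈ h.fil d', u * v ∈ h.fil (d + d') := by
    intro u hu v hv
    induction hu using Submodule.span_induction with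
    | mem u hu =>
      obtain ⟨l, hl, rfl⟩ := hu
      induction hv using Submodule.span_induction with
      | mem v hv =>
        obtain ⟨l', hl', rfl⟩ := hv
        exact Submodule.subset_span ⟨l ++ l', by rw [List.countP_append]; omega, by simp⟩
      | zero => rw [mul_zero]; exact zero_mem _
      | add x y _ _ hx hy => rw [mul_add]; exact add_mem hx hy
      | smul c x _ hx => rw [mul_smul_comm]; exact Submodule.smul_mem _ _ hx
    | zero => rw [zero_mul]; exact zero_mem _
    | add x y _ _ hx hy => rw [add_mul]; exact add_mem hx hy
    | smul c x _ hx => rw [smul_mul_assoc]; exact Submodule.smul_mem _ _ hx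
  exact key u hu v hv

theorem exists_mem_fil (u : g.Env) : ∃ d, u ∈ h.fil d := by
  induction u using env_induction with
  | h_scalar c =>
    rw [Algebra.algebraMap_eq_smul_one]
    exact ⟨0, Submodule.smul_mem _ _ (h.one_mem_fil 0)⟩
  | h_ι x => exact ⟨1, h.ι_mem_fil_one x⟩
  | h_mul a b ha hb =>
    obtain ⟨d, hd⟩ := ha
    obtain ⟨e, he⟩ := hb
    exact ⟨d + e, h.mul_mem_fil hd he le_rfl⟩
  | h_add a b ha hb =>
    obtain ⟨d, hd⟩ := ha
    obtain ⟨e, he⟩ := hb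
    exact ⟨max d e, add_mem (h.fil_mono (le_max_left _ _) hd) (h.fil_mono (le_max_right _ _) he)⟩

namespace AdaptedBasis

variable {h} {J S : Type*} (A : h.AdaptedBasis J S)

theorem sw_mem_fil (b : List S) : A.sw b ∈ h.fil b.length := by
  induction b with
  | nil => exact h.one_mem_fil _
  | cons s b ih =>
    rw [sw_cons]
    exact h.mul_mem_fil (h.ι_mem_fil_one _) ih (by simp [add_comm])

/-- Elements of `h` only involve the letters of the first kind. -/
theorem exists_inl_of_repr_ne_zero {y : L} (hy : y ∈ h.carrier) {i : J ⊕ₗ S}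
    (hi : A.front.basis.repr y i ≠ 0) : ∃ j, i = toLex (Sum.inl j) := by
  induction i using sumLex_cases with
  | hl j => exact ⟨j, rfl⟩
  | hr s =>
    refine absurd ?_ hi
    simpa [front, coord_apply] using A.coord_of_mem s hy

variable [CharP k p] [Fact p.Prime] [Fact (2 < p)]
  [LinearOrder J] [WellFoundedLT J] [LinearOrder S] [WellFoundedLT S]

theorem rights_le (i : J ⊕ₗ S) (w : List (J ⊕ₗ S)) :
    (rights (i :: w)).length ≤ (rights w).length + 1 := by
  induction i using sumLex_cases with
  | hl j => simp
  | hr s => simp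

/-- Straightening does not increase the number of letters of the second kind. -/
theorem red_rights : ∀ w, ¬ A.front.Irr w → A.front.red w ∈
    Finsupp.supported k k {w' | (rights w').length ≤ (rights w).length} := by
  refine A.front.not_irr_induction ?_ ?_ ?_
  · intro i w hw ih
    rw [A.front.red_cons_of_not_irr hw]
    refine A.front.op_basis_mem i ih fun w' hw' => ?_
    rw [Set.mem_ofPred_eq] at hw'
    rw [Set.mem_ofPred_eq]
    induction i using sumLex_cases with
    | hl j => simpa using hw'
    | hr s => simpa using hw'
  · intro i j C hji hw
    rw [A.front.red_swap hji hw]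
    refine add_mem (Submodule.smul_mem _ _ (Finsupp.single_mem_supported k _ ?_))
      (A.front.op_basis_apply _ _ _ fun l hl => ?_)
    · rw [Set.mem_ofPred_eq]
      induction i using sumLex_cases with
      | hl i => induction j using sumLex_cases <;> simp
      | hr i => induction j using sumLex_cases <;> simp
    · rw [Set.mem_ofPred_eq]
      have h1 := rights_le l C
      induction i using sumLex_cases with
      | hl i =>
        induction j using sumLex_cases with
        | hl j =>
          have hm : g.bracket (A.front.basis (toLex (Sum.inl i)))
              (A.front.basis (toLex (Sum.inl j))) ∈ h.carrier := by
            rw [A.front_inl, A.front_inl]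
            exact h.bracket_mem (A.sub.basis i).2 (A.sub.basis j).2
          obtain ⟨j', rfl⟩ := A.exists_inl_of_repr_ne_zero hm hl
          simp
        | hr j => simpa using h1
      | hr i =>
        induction j using sumLex_cases with
        | hl j => simpa using h1
        | hr j => simp; omega
  · intro i C hw
    rw [A.front.red_pow hw]
    refine A.front.op_basis_apply _ _ _ fun l hl => ?_
    rw [Set.mem_ofPred_eq]
    have hq := A.front.two_le_q i
    induction i using sumLex_cases with
    | hl i =>
      have hm : A.front.pw (toLex (Sum.inl i)) ∈ h.carrier := by
        rcases A.front.par_cases (toLex (Sum.inl i)) with hp | ⟨hp, _⟩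
        · rw [HomogeneousBasis.pw, dif_pos hp]
          refine h.pmap_mem _ ?_
          change A.front.basis _ ∈ _
          rw [A.front_inl]
          exact (A.sub.basis i).2
        · rw [HomogeneousBasis.pw, dif_neg hp, A.front_inl]
          exact Submodule.smul_mem _ _ (h.bracket_mem (A.sub.basis i).2 (A.sub.basis i).2)
      obtain ⟨j', rfl⟩ := A.exists_inl_of_repr_ne_zero hm hl
      rw [rights_cons_inl]
      generalize A.front.q (toLex (Sum.inl i)) = n
      clear hl hw hq
      induction n with
      | zero => simp
      | succ n ih => rw [List.replicate_succ, List.cons_append, rights_cons_inl]; exact ih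
    | hr s =>
      refine (rights_le l C).trans ?_
      obtain ⟨n, hn⟩ : ∃ n, A.front.q (toLex (Sum.inr s)) = n + 1 :=
        ⟨A.front.q (toLex (Sum.inr s)) - 1, by omega⟩
      rw [hn]
      clear hl hw hq hn
      induction n with
      | zero => simp
      | succ n ih =>
        rw [List.replicate_succ, List.cons_append, rights_cons_inr, List.length_cons]
        omega

/-- Expanding the factors in the basis, only those outside `h` contribute letters of the second
kind. -/
theorem exists_ev_of_mem_fil {d : ℕ} {u : g.Env} (hu : u ∈ h.fil d) :
    u ∈ (Finsupp.supported k k {w | (rights w).length ≤ d}).map A.front.ev := by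
  classical
  revert u
  suffices h.fil d ≤ (Finsupp.supported k k {w | (rights w).length ≤ d}).map A.front.ev from
    fun {u} hu => this hu
  refine Submodule.span_le.2 ?_
  rintro _ ⟨l, hl, rfl⟩
  induction l generalizing d with
  | nil =>
    exact ⟨HomogeneousBasis.wd k [], Finsupp.single_mem_supported k _ (Nat.zero_le _), by simp⟩
  | cons y l ih =>
    by_cases hy : y ∈ h.carrier
    · obtain ⟨t, ht, ht'⟩ := ih (d := d) (by simpa [hy] using hl)
      refine ⟨A.front.op y t, ?_, by rw [A.front.ev_op, ht']; simp⟩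
      refine HomogeneousBasis.map_supported (A.front.op y) _ (fun w hw => ?_) ht
      refine A.front.op_basis_apply _ _ _ fun i hi => ?_
      obtain ⟨j, rfl⟩ := A.exists_inl_of_repr_ne_zero hy hi
      exact hw
    · rw [List.countP_cons_of_pos (by simpa using hy)] at hl
      obtain ⟨t, ht, ht'⟩ := ih (d := d - 1) (by omega)
      refine ⟨A.front.op y t, ?_, by rw [A.front.ev_op, ht']; simp⟩
      refine HomogeneousBasis.map_supported (A.front.op y) _ (fun w hw => ?_) ht
      refine A.front.op_basis_apply _ _ _ fun i hi => ?_
      rw [Set.mem_ofPred_eq] at hw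
      rw [Set.mem_ofPred_eq]
      have := rights_le i w
      omega

/-- The filtration is spanned over `U'(h)` by irreducible words in the supplement. -/
theorem mem_span_of_mem_fil {d : ℕ} {u : g.Env} (hu : u ∈ h.fil d) :
    u ∈ Submodule.span k {u | ∃ a b, A.Irr b ∧ b.length ≤ d ∧ u = h.envIncl a * A.sw b} := by
  obtain ⟨t, ht, rfl⟩ := A.exists_ev_of_mem_fil hu
  rw [← A.front.ev_NF]
  refine HomogeneousBasis.map_supported A.front.ev _ (fun w hw => ?_)
    (A.front.NF_mem (fun w hw hi => ?_) ht)
  · have e := eq_joinWords hw.2.1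
    rw [A.front.ev_wd, e, front_wp]
    have hi : A.front.Irr (joinWords (lefts w) (rights w)) := e ▸ hw.2
    exact Submodule.subset_span ⟨_, _, (A.front_irr.1 hi).2, hw.1, rfl⟩
  · exact Finsupp.supported_mono (fun w' (hw' : (rights w').length ≤ _) =>
      le_trans hw' (show (rights w).length ≤ d from hw)) (A.red_rights w hi)

/-! ### Elements of the coinduced module with given values -/

section Coind

variable {V : Type*} [AddCommGroup V] [Module k V] (ρ : h.toRestricted.Rep V)

theorem coind_eq_zero_of_fil {μ : g.Env →ₗ[k] V} (hμ : μ ∈ h.Coind ρ) {d : ℕ}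
    (hd : ∀ b, A.Irr b → b.length ≤ d → μ (A.sw b) = 0) {u : g.Env} (hu : u ∈ h.fil d) :
    μ u = 0 := by
  have h1 := A.mem_span_of_mem_fil hu
  clear hu
  induction h1 using Submodule.span_induction with
  | mem u hu =>
    obtain ⟨a, b, hb, hbd, rfl⟩ := hu
    rw [hμ, hd b hb hbd, map_zero]
  | zero => exact map_zero _
  | add x y _ _ hx hy => rw [map_add, hx, hy, add_zero]
  | smul c x _ hx => rw [map_smul, hx, smul_zero]

/-- An element of the coinduced module is determined by its values on the irreducible words in
the supplement. -/
theorem coind_ext {μ ν : h.Coind ρ} (hd : ∀ b, A.Irr b → μ.1 (A.sw b) = ν.1 (A.sw b)) : μ = ν := by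
  refine Subtype.ext (LinearMap.ext fun u => ?_)
  obtain ⟨d, hu⟩ := h.exists_mem_fil u
  have h1 := A.coind_eq_zero_of_fil ρ (sub_mem μ.2 ν.2) (d := d)
    (fun b hb _ => by rw [LinearMap.sub_apply, hd b hb, sub_self]) hu
  rwa [LinearMap.sub_apply, sub_eq_zero] at h1

/-- The linear map with given values on the irreducible words in the supplement. -/
def extend (f : List S → V) : g.Env →ₗ[k] V :=
  Finsupp.linearCombination k (fun w => ρ.env (A.sub.wp (lefts w)) (f (rights w))) ∘ₗ A.front.nform

theorem extend_apply (f : List S → V) (a : h.toRestricted.Env) {b : List S} (hb : A.Irr b) :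
    A.extend ρ f (h.envIncl a * A.sw b) = ρ.env a (f b) := by
  have ha := A.sub.mem_span_irr a
  induction ha using Submodule.span_induction with
  | mem a ha =>
    obtain ⟨a, ha, rfl⟩ := ha
    rw [← A.front_wp, extend, LinearMap.comp_apply,
      A.front.nform_wp_of_irr (A.front_irr.2 ⟨ha, hb⟩)]
    simp
  | zero => simp
  | add x y _ _ hx hy => rw [map_add, add_mul, map_add, hx, hy, map_add, LinearMap.add_apply]
  | smul c x _ hx =>
    rw [map_smul, smul_mul_assoc, map_smul, hx, map_smul, LinearMap.smul_apply]

theorem extend_mem (f : List S → V) : A.extend ρ f ∈ h.Coind ρ := by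
  intro a u
  obtain ⟨d, hu⟩ := h.exists_mem_fil u
  have h1 := A.mem_span_of_mem_fil hu
  clear hu
  induction h1 using Submodule.span_induction with
  | mem u hu =>
    obtain ⟨a', b, hb, -, rfl⟩ := hu
    rw [← mul_assoc, ← map_mul, extend_apply A ρ f _ hb, extend_apply A ρ f _ hb, map_mul]
    rfl
  | zero => simp
  | add x y _ _ hx hy => rw [mul_add, map_add, hx, hy, map_add, map_add]
  | smul c x _ hx => rw [mul_smul_comm, map_smul, hx, map_smul, map_smul]

/-- A coinduced module contains an element with arbitrary values on the irreducible words in the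
supplement. -/
theorem exists_coind (f : List S → V) : ∃ μ : h.Coind ρ, ∀ b, A.Irr b → μ.1 (A.sw b) = f b :=
  ⟨⟨_, A.extend_mem ρ f⟩, fun b hb => by
    have := A.extend_apply ρ f 1 hb
    rwa [map_one, one_mul, map_one] at this⟩

end Coind

end AdaptedBasis

end Sub

end RestrictedLieSuperalgebra

end RestrictedSuper

end

noncomputable section

namespace RestrictedSuper

namespace RestrictedLieSuperalgebra

namespace Sub

variable {k : Type*} [Field k] {p : ℕ} {L : Type*} [AddCommGroup L] [Module k L]
variable {g : RestrictedLieSuperalgebra k p L} (h : g.Sub)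

/-! ### Supersymmetry of leading terms -/

/-- The span of the products of elements of `g` with fewer than `d` factors outside `h`. -/
def low : ℕ → Submodule k g.Env
  | 0 => ⊥
  | d + 1 => h.fil d

theorem fil_le_low {d e : ℕ} (hd : d < e) : h.fil d ≤ h.low e := by
  obtain ⟨e, rfl⟩ : ∃ e', e = e' + 1 := ⟨e - 1, by omega⟩
  exact h.fil_mono (by omega)

theorem mul_mem_low {d e n : ℕ} {u v : g.Env} (hu : u ∈ h.fil d) (hv : v ∈ h.low e)
    (hn : d + e ≤ n) : u * v ∈ h.low n := by
  rcases e with _ | e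
  · rw [(Submodule.mem_bot k).1 hv, mul_zero]; exact zero_mem _
  · exact h.fil_le_low (by omega) (h.mul_mem_fil hu hv le_rfl)

namespace AdaptedBasis

variable {h} {J S : Type*} (A : h.AdaptedBasis J S)

/-- The parity of a word. -/
def wpar (b : List S) : ZMod 2 := (b.map A.par).sum

theorem sw_mem_deg [CharP k p] [Fact p.Prime] [Fact (2 < p)] (b : List S) :
    A.sw b ∈ g.envGrading.deg (A.wpar b) := by
  induction b with
  | nil => exact g.one_mem
  | cons s b ih =>
    rw [sw_cons, wpar, List.map_cons, List.sum_cons]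
    exact g.mul_mem (g.ι_mem (A.x_mem s)) ih

theorem coord_of_deg {β : ZMod 2} {y : L} (hy : y ∈ g.grading.deg β) {s : S} (hs : A.par s ≠ β) :
    A.coord s y = 0 := by
  refine A.whole.induction_deg (P := fun y => A.coord s y = 0) (map_zero _)
    (fun x z hx hz => by rw [map_add, hx, hz, add_zero]) (fun c x hx => by
      rw [map_smul, hx, smul_zero]) (fun i hi => ?_) hy
  classical
  rw [coord_apply, A.whole.basis.repr_self, Finsupp.single_apply, if_neg]
  rintro rfl
  exact hs hi

/-- Permuting the letters changes a word by a sign and by shorter words. -/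
theorem sw_perm {b b' : List S} (hb : b.Perm b') :
    ∃ c : k, c ≠ 0 ∧ A.sw b - c • A.sw b' ∈ h.low b.length := by
  induction hb with
  | nil => exact ⟨1, one_ne_zero, by simp⟩
  | @cons s b b' _ ih =>
    obtain ⟨c, hc, ih⟩ := ih
    refine ⟨c, hc, ?_⟩
    rw [sw_cons, sw_cons, ← mul_smul_comm, ← mul_sub]
    exact h.mul_mem_low (h.ι_mem_fil_one _) ih (by simp [add_comm])
  | swap s r b =>
    refine ⟨psign k (A.par r * A.par s), ?_, ?_⟩
    · rcases psign_cases k (A.par r * A.par s) with hc | hc <;> rw [hc] <;> simp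
    · rw [sw_cons, sw_cons, sw_cons, sw_cons, ← mul_assoc, ← mul_assoc,
        g.ι_mul_ι (A.x_mem r) (A.x_mem s), add_mul, smul_mul_assoc, add_sub_cancel_left]
      exact h.fil_le_low (d := b.length + 1) (by simp)
        (h.mul_mem_fil (h.ι_mem_fil_one _) (A.sw_mem_fil b) (by omega))
  | @trans b₁ b₂ b₃ h₁ _ ih₁ ih₂ =>
    obtain ⟨c, hc, ih₁⟩ := ih₁
    obtain ⟨c', hc', ih₂⟩ := ih₂
    refine ⟨c * c', mul_ne_zero hc hc', ?_⟩
    rw [← h₁.length_eq] at ih₂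
    have := add_mem ih₁ (Submodule.smul_mem _ c ih₂)
    rwa [smul_sub, smul_smul, sub_add_sub_cancel] at this

variable [CharP k p] [Fact p.Prime] [Fact (2 < p)]

theorem sw_replicate_q (s : S) : A.sw (List.replicate (A.whole.q (Sum.inr s)) s) =
    g.ι (A.whole.pw (Sum.inr s)) := by
  have h1 := A.whole.two_le_q (Sum.inr s)
  rw [sw, List.map_replicate, List.prod_replicate, x]
  rcases A.whole.par_cases (Sum.inr s) with hi | ⟨hi, hi1⟩
  · rw [HomogeneousBasis.q, if_pos hi, HomogeneousBasis.pw, dif_pos hi]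
    exact g.ι_pow ⟨_, _⟩
  · have h := g.ι_mul_ι (A.whole.mem (Sum.inr s)) (A.whole.mem (Sum.inr s))
    rw [hi1, mul_one, psign_one, neg_one_smul, eq_neg_add_iff_add_eq, ← two_smul k,
      ← eq_inv_smul_iff₀ (two_ne_zero_of_char k p)] at h
    rw [HomogeneousBasis.q, if_neg hi, HomogeneousBasis.pw, dif_neg hi, pow_two, h, map_smul]

/-- A word with too many repetitions of a letter is a combination of shorter words. -/
theorem sw_mem_low_of_count [DecidableEq S] {b : List S} {s : S}
    (hs : A.whole.q (Sum.inr s) ≤ b.count s) : A.sw b ∈ h.low b.length := by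
  have h2 := A.whole.two_le_q (Sum.inr s)
  obtain ⟨b', hb'⟩ : ∃ b', b.Perm (List.replicate (A.whole.q (Sum.inr s)) s ++ b') :=
    (List.replicate_sublist_iff.2 hs).exists_perm_append
  obtain ⟨c, -, hc⟩ := A.sw_perm hb'
  have h3 : A.sw (List.replicate (A.whole.q (Sum.inr s)) s ++ b') ∈ h.low b.length := by
    rw [sw_append, sw_replicate_q]
    refine h.fil_le_low (d := 1 + b'.length) ?_
      (h.mul_mem_fil (h.ι_mem_fil_one _) (A.sw_mem_fil b') le_rfl)
    rw [hb'.length_eq, List.length_append, List.length_replicate]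
    omega
  have := add_mem hc (Submodule.smul_mem _ c h3)
  rwa [sub_add_cancel] at this

/-! ### The word of maximal length -/

variable [LinearOrder S]

/-- The increasing word in which each letter occurs `p - 1` times or once, according to its
parity. -/
def IsTop (t : List S) : Prop :=
  t.Pairwise (· ≤ ·) ∧ ∀ s, t.count s + 1 = A.whole.q (Sum.inr s)

variable {A} {t : List S}

theorem IsTop.irr (ht : A.IsTop t) : A.Irr t := ⟨ht.1, fun s => by rw [← ht.2 s]; omega⟩

/-- A word of length at least that of the top word is a rearrangement of it or has too many
repetitions of some letter. -/
theorem IsTop.perm_or (ht : A.IsTop t) {b : List S} (hb : t.length ≤ b.length) :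
    b.Perm t ∨ ∃ s, A.whole.q (Sum.inr s) ≤ b.count s := by
  by_contra hcon
  push Not at hcon
  have hle : ∀ s, b.count s ≤ t.count s := fun s => by
    have := hcon.2 s
    rw [← ht.2 s] at this
    omega
  have : b.Subperm t := List.subperm_ext_iff.2 fun s _ => hle s
  exact hcon.1 (this.perm_of_length_le hb)

theorem IsTop.eq_of_length_le (ht : A.IsTop t) {b : List S} (hb : A.Irr b)
    (hl : t.length ≤ b.length) : b = t := by
  rcases ht.perm_or hl with h1 | ⟨s, hs⟩
  · exact h1.eq_of_pairwise (fun a b _ _ => le_antisymm) hb.1 ht.1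
  · exact absurd (hb.2 s) (not_lt.2 hs)

theorem IsTop.length_le (ht : A.IsTop t) {b : List S} (hb : A.Irr b) : b.length ≤ t.length := by
  by_contra hcon
  rw [ht.eq_of_length_le hb (by omega)] at hcon
  exact hcon le_rfl

/-- An irreducible word has a complement in the top word. -/
theorem IsTop.exists_compl (ht : A.IsTop t) {b : List S} (hb : A.Irr b) :
    ∃ a, A.Irr a ∧ (a ++ b).Perm t := by
  refine ⟨t.diff b, ⟨ht.1.sublist (List.diff_sublist t b), fun s => ?_⟩, ?_⟩
  · rw [List.count_diff, ← ht.2 s]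
    omega
  · rw [List.perm_iff_count]
    intro s
    have := hb.2 s
    rw [← ht.2 s] at this
    rw [List.count_append, List.count_diff]
    omega

/-- Replacing a letter of the top word by an element `y` of `g` multiplies it by the corresponding
coordinate of `y`, up to shorter words. -/
theorem IsTop.replace [Fintype S] (ht : A.IsTop t) {l₁ l₂ : List S} {s : S} (e : t = l₁ ++ s :: l₂)
    (y : L) : A.sw l₁ * g.ι y * A.sw l₂ - A.coord s y • A.sw t ∈ h.low t.length := by
  have hlen : t.length = l₁.length + l₂.length + 1 := by rw [e]; simp; omega
  have h0 : A.sw l₁ * g.ι (y - ∑ r, A.coord r y • A.x r) * A.sw l₂ ∈ h.low t.length := by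
    refine h.fil_le_low (d := l₁.length + l₂.length) (by omega) ?_
    exact h.mul_mem_fil (h.mul_mem_fil (A.sw_mem_fil l₁)
      (h.ι_mem_fil_zero (A.sub_coord_mem y)) le_rfl) (A.sw_mem_fil l₂) (by omega)
  have h1 : ∀ r, r ≠ s → A.coord r y • (A.sw l₁ * g.ι (A.x r) * A.sw l₂) ∈ h.low t.length := by
    intro r hr
    refine Submodule.smul_mem _ _ ?_
    have e1 : A.sw l₁ * g.ι (A.x r) * A.sw l₂ = A.sw (l₁ ++ r :: l₂) := by
      rw [sw_append, sw_cons, mul_assoc]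
    have e2 : t.length = (l₁ ++ r :: l₂).length := by rw [e]; simp
    rw [e1, e2]
    refine A.sw_mem_low_of_count (s := r) ?_
    rw [← ht.2 r, e, List.count_append, List.count_append, List.count_cons_self,
      List.count_cons_of_ne hr.symm]
    omega
  have hsum : ∑ r ∈ Finset.univ.erase s, A.coord r y • (A.sw l₁ * g.ι (A.x r) * A.sw l₂) ∈
      h.low t.length := Submodule.sum_mem _ fun r hr => h1 r (Finset.ne_of_mem_erase hr)
  have h2 := add_mem h0 hsum
  have e3 : A.sw t = A.sw l₁ * g.ι (A.x s) * A.sw l₂ := by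
    rw [e, sw_append, sw_cons, mul_assoc]
  convert h2 using 1
  rw [e3, map_sub, map_sum, mul_sub, sub_mul, Finset.mul_sum, Finset.sum_mul,
    ← Finset.add_sum_erase _ _ (Finset.mem_univ s)]
  simp only [map_smul, mul_smul_comm, smul_mul_assoc]
  abel

/-- Moving an element of `h` from the right to the left of the top word. -/
theorem IsTop.move [Fintype S] (ht : A.IsTop t) {α : ZMod 2} {H : L}
    (hα : H ∈ g.grading.deg α) (l₁ : List S) : ∀ l₂, t = l₁ ++ l₂ →
    A.sw l₁ * g.ι H * A.sw l₂ - (psign k (α * A.wpar l₁) • (g.ι H * A.sw t) -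
      (l₁.map fun s => A.coord s (g.bracket H (A.x s))).sum • A.sw t) ∈ h.low t.length := by
  induction l₁ using List.reverseRecOn with
  | nil => intro l₂ e; simp [wpar, e]
  | append_singleton l₁ s ih =>
    intro l₂ e
    have e' : t = l₁ ++ s :: l₂ := by rw [e]; simp
    have h1 := ih (s :: l₂) e'
    have h2 := ht.replace e' (g.bracket (A.x s) H)
    have h3 := add_mem (Submodule.smul_mem _ (psign k (A.par s * α)) h1) h2
    -- if `H` is odd, the diagonal coordinates of `ad H` vanish, so that signs do not matter
    have hz : psign k (A.par s * α) • A.coord s (g.bracket H (A.x s)) =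
        A.coord s (g.bracket H (A.x s)) := by
      rcases zmod2_cases α with rfl | rfl
      · simp
      · rw [A.coord_of_deg (g.bracket_mem hα (A.x_mem s)), smul_zero]
        generalize A.par s = x
        revert x; decide
    have hz' : ∀ l : List S, psign k (A.par s * α) *
        (l.map fun s => A.coord s (g.bracket H (A.x s))).sum =
        (l.map fun s => A.coord s (g.bracket H (A.x s))).sum := by
      intro l
      rcases zmod2_cases α with rfl | rfl
      · simp
      · have : (l.map fun s => A.coord s (g.bracket H (A.x s))) = l.map fun _ => (0 : k) := by
          refine List.map_congr_left fun r _ => ?_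
          rw [A.coord_of_deg (g.bracket_mem hα (A.x_mem r))]
          generalize A.par r = x
          revert x; decide
        rw [this]; simp
    have hc : A.coord s (g.bracket (A.x s) H) = - A.coord s (g.bracket H (A.x s)) := by
      rw [g.bracket_skew (A.x_mem s) hα, map_neg, map_smul, hz]
    convert h3 using 1
    rw [hc, sw_append, sw_cons, sw_nil, mul_one, sw_cons, mul_assoc (A.sw l₁),
      g.ι_mul_ι (A.x_mem s) hα]
    rw [List.map_append, List.sum_append, List.map_singleton, List.sum_singleton]
    have hp : psign k (α * A.wpar (l₁ ++ [s])) =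
        psign k (A.par s * α) * psign k (α * A.wpar l₁) := by
      rw [← psign_add, wpar, wpar, List.map_append, List.sum_append, List.map_singleton,
        List.sum_singleton, mul_add, mul_comm (A.par s), add_comm]
    rw [hp, smul_sub, smul_sub, smul_smul, smul_smul, hz']
    simp only [mul_add, add_mul, mul_smul_comm, smul_mul_assoc, mul_assoc, add_smul, neg_smul]
    abel

/-- The multiplicity of a letter in the top word is `p - 1 ≡ -1` or `1`, according to its parity.
This is how the signs of the supertrace arise. -/
theorem IsTop.sum_eq [Fintype S] (ht : A.IsTop t) (f : S → k) :
    (t.map f).sum = -∑ s, psign k (A.par s) * f s := by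
  have h1 : (t.map f).sum = ∑ s, (t.count s : k) * f s := by
    have := Finset.sum_list_map_count t f
    rw [this, ← Finset.sum_subset (Finset.subset_univ t.toFinset)]
    · simp
    · intro s _ hs
      rw [List.count_eq_zero.2 (by simpa using hs)]
      simp
  rw [h1, ← Finset.sum_neg_distrib]
  refine Finset.sum_congr rfl fun s _ => ?_
  have h2 : ((t.count s : k) + 1) = (A.whole.q (Sum.inr s) : k) := by
    exact_mod_cast congrArg _ (ht.2 s)
  rw [← neg_mul]
  congr 1
  rw [eq_sub_of_add_eq h2, par]
  rcases A.whole.par_cases (Sum.inr s) with hi | ⟨hi, hi1⟩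
  · rw [HomogeneousBasis.q, if_pos hi, hi]; simp
  · rw [HomogeneousBasis.q, if_neg hi, hi1]; norm_num

/-- The basis of `g/h` given by the basis of the supplement. -/
def quotBasis [Fintype S] (A : h.AdaptedBasis J S) : Module.Basis S k (L ⧸ h.carrier) :=
  Module.Basis.ofEquivFun <| (Submodule.quotEquivOfEq _ _ (by
    ext y
    rw [A.mem_iff_coord, LinearMap.mem_ker, funext_iff]
    rfl)).trans ((LinearMap.pi A.coord).quotKerEquivOfSurjective (by
      intro c
      refine ⟨∑ s, c s • A.x s, funext fun s => ?_⟩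
      simp [map_sum, A.coord_x]))

theorem quotBasis_repr [Fintype S] (y : L) (s : S) :
    A.quotBasis.repr (h.carrier.mkQ y) s = A.coord s y := rfl

theorem quotBasis_apply [Fintype S] (s : S) : A.quotBasis s = h.carrier.mkQ (A.x s) := by
  refine A.quotBasis.repr.injective (Finsupp.ext fun r => ?_)
  rw [A.quotBasis.repr_self, quotBasis_repr, A.coord_x, Finsupp.single_apply]
  simp [eq_comm]

/-- The supertrace of the adjoint action on `g/h`, in terms of a basis of the supplement. -/
theorem strad_eq [Fintype S] (A : h.AdaptedBasis J S) (H : h.carrier) :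
    h.strad H = ∑ s, psign k (A.par s) * A.coord s (g.bracket H (A.x s)) := by
  have key : ∀ (s : S) (y : L ⧸ h.carrier), A.quotBasis.repr (h.quotGrading.parity y) s =
      psign k (A.par s) * A.quotBasis.repr y s := by
    intro s
    have : A.quotBasis.coord s ∘ₗ h.quotGrading.parity =
        psign k (A.par s) • A.quotBasis.coord s := by
      refine A.quotBasis.ext fun r => ?_
      have hr : A.quotBasis r ∈ h.quotGrading.deg (A.par r) := by
        rw [quotBasis_apply]
        exact ⟨_, A.x_mem r, rfl⟩
      rw [LinearMap.comp_apply, h.quotGrading.parity_of_mem hr, map_smul, LinearMap.smul_apply,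
        Module.Basis.coord_apply, A.quotBasis.repr_self, Finsupp.single_apply]
      split_ifs with hrs
      · rw [hrs]
      · simp
    exact fun y => LinearMap.congr_fun this y
  rw [strad, SuperGrading.supertrace_apply, LinearMap.trace_eq_matrix_trace k A.quotBasis,
    Matrix.trace]
  refine Finset.sum_congr rfl fun s _ => ?_
  rw [Matrix.diag_apply, LinearMap.toMatrix_apply, Module.End.mul_apply, key, quotBasis_apply]
  rfl

/-- The commutation of the top word with an element of `h` produces the supertrace. -/
theorem IsTop.mul_ι [Fintype S] (ht : A.IsTop t) {α : ZMod 2} {H : h.carrier}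
    (hα : (H : L) ∈ g.grading.deg α) : A.sw t * g.ι (H : L) -
      (psign k (α * A.wpar t) • (g.ι (H : L) * A.sw t) + h.strad H • A.sw t) ∈ h.low t.length := by
  have h1 := ht.move hα t [] (by simp)
  rw [sw_nil, mul_one, ht.sum_eq, ← A.strad_eq, neg_smul, sub_neg_eq_add] at h1
  exact h1

end AdaptedBasis

end Sub

end RestrictedLieSuperalgebra

end RestrictedSuper

end

noncomputable section

namespace RestrictedSuper

namespace RestrictedLieSuperalgebra

namespace Sub

variable {k : Type*} [Field k] {p : ℕ} {L : Type*} [AddCommGroup L] [Module k L]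
variable [CharP k p] [Fact p.Prime] [Fact (2 < p)]
variable {g : RestrictedLieSuperalgebra k p L}

/-! ### Leading terms of convolution products -/

section Conv

variable {V : Type*} [AddCommGroup V] [Module k V]

theorem conv_one (lam : g.Env →ₗ[k] k) (μ : g.Env →ₗ[k] V) : conv lam μ 1 = lam 1 • μ 1 := by
  have h1 : (1 : g.EnvTensor) = g.tmul 1 1 := rfl
  rw [conv, LinearMap.comp_apply, LinearMap.comp_apply, AlgHom.toLinearMap_apply, map_one, h1]
  refine (convAux_tmul lam μ g.one_mem 1).trans ?_
  rw [SuperGrading.signOp_zero]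
  rfl

/-- The elements of `g` are primitive, hence act as derivations for the convolution product. -/
theorem conv_leibniz (lam : g.Env →ₗ[k] k) (μ : g.Env →ₗ[k] V) {i : ZMod 2} {x : L}
    (hx : x ∈ g.grading.deg i) (u : g.Env) :
    conv lam μ (g.ι x * u) =
      conv (lam ∘ₗ LinearMap.mulLeft k (g.ι x)) (μ ∘ₗ g.envGrading.signOp i) u +
        conv lam (μ ∘ₗ LinearMap.mulLeft k (g.ι x)) u := by
  simp only [conv, LinearMap.comp_apply, AlgHom.toLinearMap_apply, map_mul, comul_ι]
  generalize g.comul u = t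
  have hx' := g.ι_mem hx
  have key : ∀ (j : ZMod 2) (a b : g.Env), a ∈ g.envGrading.deg j →
      convAux lam μ ((GradedTensorProduct.of k g.envGrading.deg g.envGrading.deg).symm
        ((g.tmul (g.ι x) 1 + g.tmul 1 (g.ι x)) * g.tmul a b)) =
      convAux (lam ∘ₗ LinearMap.mulLeft k (g.ι x)) (μ ∘ₗ g.envGrading.signOp i)
        ((GradedTensorProduct.of k g.envGrading.deg g.envGrading.deg).symm (g.tmul a b)) +
      convAux lam (μ ∘ₗ LinearMap.mulLeft k (g.ι x))
        ((GradedTensorProduct.of k g.envGrading.deg g.envGrading.deg).symm (g.tmul a b)) := by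
    intro j a b ha
    rw [add_mul, g.tmul_mul_tmul _ _ g.one_mem ha, g.tmul_mul_tmul _ _ hx' ha, map_add, map_add,
      zero_mul, psign_zero, one_smul, one_mul, one_mul, map_smul, map_smul,
      convAux_tmul lam μ (g.mul_mem hx' ha), convAux_tmul lam μ ha, convAux_tmul _ _ ha,
      convAux_tmul _ _ ha, signOp_ι_mul hx, map_smul, smul_comm (lam a), smul_smul,
      psign_mul_self, one_smul, ← SuperGrading.signOp_mul]
    rfl
  have hk : ∀ t : g.Env ⊗[k] g.Env,
      convAux lam μ ((GradedTensorProduct.of k g.envGrading.deg g.envGrading.deg).symm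
        ((g.tmul (g.ι x) 1 + g.tmul 1 (g.ι x)) *
          GradedTensorProduct.of k g.envGrading.deg g.envGrading.deg t)) =
      convAux (lam ∘ₗ LinearMap.mulLeft k (g.ι x)) (μ ∘ₗ g.envGrading.signOp i)
        ((GradedTensorProduct.of k g.envGrading.deg g.envGrading.deg).symm
          (GradedTensorProduct.of k g.envGrading.deg g.envGrading.deg t)) +
      convAux lam (μ ∘ₗ LinearMap.mulLeft k (g.ι x))
        ((GradedTensorProduct.of k g.envGrading.deg g.envGrading.deg).symm
          (GradedTensorProduct.of k g.envGrading.deg g.envGrading.deg t)) := by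
    intro t
    induction t with
    | zero => simp
    | add s t hs ht => simp only [map_add, mul_add, hs, ht]; abel
    | tmul a b =>
      rw [← g.envGrading.proj_add a, TensorProduct.add_tmul]
      simp only [map_add, mul_add]
      refine (congrArg₂ _ (key 0 _ b (g.envGrading.proj_mem 0 a))
        (key 1 _ b (g.envGrading.proj_mem 1 a))).trans ?_
      rw [add_add_add_comm]
      rfl
  exact hk ((GradedTensorProduct.of k g.envGrading.deg g.envGrading.deg).symm t)

variable (h : g.Sub)

theorem signOp_mem_low {d : ℕ} {u : g.Env} (hu : u ∈ h.low d) (i : ZMod 2) :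
    g.envGrading.signOp i u ∈ h.low d := by
  classical
  rcases zmod2_cases i with rfl | rfl
  · simpa using hu
  rcases d with _ | d
  · rw [(Submodule.mem_bot k).1 hu, map_zero]; exact zero_mem _
  rw [SuperGrading.signOp_one, g.parity_envGrading]
  change u ∈ h.fil d at hu
  change _ ∈ h.fil d
  induction hu using Submodule.span_induction with
  | mem u hu =>
    obtain ⟨l, hl, rfl⟩ := hu
    refine Submodule.subset_span ⟨l.map g.grading.parity, le_trans ?_ hl, ?_⟩
    · rw [List.countP_map]
      refine List.countP_mono_left fun y _ => ?_
      simp only [Function.comp_apply, decide_eq_true_eq]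
      exact mt fun hy => sub_mem (h.proj_mem 0 hy) (h.proj_mem 1 hy)
    · rw [map_list_prod, List.map_map, List.map_map]
      congr 1
      exact List.map_congr_left fun y _ => by simp
  | zero => rw [map_zero]; exact zero_mem _
  | add x y _ _ hx hy => rw [map_add]; exact add_mem hx hy
  | smul c x _ hx => rw [map_smul]; exact Submodule.smul_mem _ _ hx

theorem comp_signOp_low {d : ℕ} {μ : g.Env →ₗ[k] V} (hμ : ∀ u ∈ h.low d, μ u = 0) (i : ZMod 2) :
    ∀ u ∈ h.low d, (μ ∘ₗ g.envGrading.signOp i) u = 0 :=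
  fun _ hu => hμ _ (h.signOp_mem_low hu i)

/-- Orders of vanishing add up under convolution. -/
theorem conv_eq_zero_of_low {d e : ℕ} {lam : g.Env →ₗ[k] k} {μ : g.Env →ₗ[k] V}
    (hl : ∀ u ∈ h.low d, lam u = 0) (hμ : ∀ u ∈ h.low e, μ u = 0) :
    ∀ u ∈ h.low (d + e), conv lam μ u = 0 := by
  classical
  have key : ∀ (l : List L) (d e : ℕ) (lam : g.Env →ₗ[k] k) (μ : g.Env →ₗ[k] V),
      (∀ u ∈ h.low d, lam u = 0) → (∀ u ∈ h.low e, μ u = 0) →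
      l.countP (fun y => y ∉ h.carrier) < d + e → conv lam μ (l.map g.ι).prod = 0 := by
    intro l
    induction l with
    | nil =>
      intro d e lam μ hl hμ hc
      rw [List.map_nil, List.prod_nil, conv_one]
      rcases d with _ | d
      · rw [hμ 1 (h.fil_le_low (d := 0) (by simpa using hc) (h.one_mem_fil 0)), smul_zero]
      · rw [hl 1 (h.fil_le_low (d := 0) (by simp) (h.one_mem_fil 0)), zero_smul]
    | cons y l ih =>
      intro d e lam μ hl hμ hc
      -- multiplication by an element of `h` preserves the order of vanishing, while
      -- multiplication by any element of `g` lowers it by at most one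
      have step : ∀ (i : ZMod 2) (x : L), x ∈ g.grading.deg i → (y ∈ h.carrier → x ∈ h.carrier) →
          conv lam μ (g.ι x * (l.map g.ι).prod) = 0 := by
        intro i x hx hxy
        have hs := h.comp_signOp_low hμ i
        rw [conv_leibniz lam μ hx]
        by_cases hy : y ∈ h.carrier
        · rw [List.countP_cons_of_neg (by simpa using hy)] at hc
          have same : ∀ n, ∀ u ∈ h.low n, g.ι x * u ∈ h.low n := fun n u hu =>
            h.mul_mem_low (h.ι_mem_fil_zero (hxy hy)) hu (by omega)
          rw [ih d e (lam ∘ₗ LinearMap.mulLeft k (g.ι x)) _ (fun u hu => hl _ (same d u hu)) hs hc,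
            ih d e _ (μ ∘ₗ LinearMap.mulLeft k (g.ι x)) hl (fun u hu => hμ _ (same e u hu)) hc,
            add_zero]
        · rw [List.countP_cons_of_pos (by simpa using hy)] at hc
          have lower : ∀ n, ∀ u ∈ h.low (n - 1), g.ι x * u ∈ h.low n := by
            intro n u hu
            rcases n with _ | n
            · rw [(Submodule.mem_bot k).1 hu, mul_zero]; exact zero_mem _
            · exact h.mul_mem_low (h.ι_mem_fil_one x) hu (by omega)
          rw [ih (d - 1) e (lam ∘ₗ LinearMap.mulLeft k (g.ι x)) _ (fun u hu =>
              hl _ (lower d u hu)) hs (by omega),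
            ih d (e - 1) _ (μ ∘ₗ LinearMap.mulLeft k (g.ι x)) hl (fun u hu =>
              hμ _ (lower e u hu)) (by omega), add_zero]
      rw [List.map_cons, List.prod_cons, ← g.grading.proj_add y, map_add, add_mul, map_add,
        step 0 _ (g.grading.proj_mem 0 y) (h.proj_mem 0),
        step 1 _ (g.grading.proj_mem 1 y) (h.proj_mem 1), add_zero]
  intro u hu
  rcases hde : d + e with _ | n
  · rw [hde] at hu
    rw [(Submodule.mem_bot k).1 hu, map_zero]
  · rw [hde] at hu
    change u ∈ h.fil n at hu
    induction hu using Submodule.span_induction with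
    | mem u hu =>
      obtain ⟨l, hl', rfl⟩ := hu
      exact key l d e lam μ hl hμ (by omega)
    | zero => exact map_zero _
    | add x y _ _ hx hy => rw [map_add, hx, hy, add_zero]
    | smul c x _ hx => rw [map_smul, hx, smul_zero]

end Conv

namespace AdaptedBasis

variable {h : g.Sub} {J S : Type*} (A : h.AdaptedBasis J S)
variable {V : Type*} [AddCommGroup V] [Module k V]

theorem sw_mem_low {b : List S} {d : ℕ} (hb : b.length < d) : A.sw b ∈ h.low d :=
  h.fil_le_low hb (A.sw_mem_fil b)

/-- If `lam` vanishes on the words shorter than `b`, only `sw b ⊗ 1` contributes to a convolution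
product. -/
theorem conv_sw_left (b : List S) {lam : g.Env →ₗ[k] k} (μ : g.Env →ₗ[k] V)
    (hl : ∀ u ∈ h.low b.length, lam u = 0) : conv lam μ (A.sw b) = lam (A.sw b) • μ 1 := by
  induction b generalizing lam μ with
  | nil => exact conv_one lam μ
  | cons s b ih =>
    rw [sw_cons, conv_leibniz lam μ (A.x_mem s), ih, h.conv_eq_zero_of_low hl (e := 0)
      (fun u hu => by rw [(Submodule.mem_bot k).1 hu, map_zero]) _ (A.sw_mem_low (by simp)),
      add_zero, LinearMap.comp_apply, LinearMap.comp_apply,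
      g.envGrading.signOp_of_mem _ g.one_mem, mul_zero, psign_zero, one_smul]
    · rfl
    · intro u hu
      exact hl _ (h.mul_mem_low (h.ι_mem_fil_one _) hu (by simp [add_comm]))

/-- If `μ` vanishes on the words shorter than `b`, only `1 ⊗ sw b` contributes to a convolution
product. -/
theorem conv_sw_right (b : List S) (lam : g.Env →ₗ[k] k) {μ : g.Env →ₗ[k] V}
    (hμ : ∀ u ∈ h.low b.length, μ u = 0) : conv lam μ (A.sw b) = lam 1 • μ (A.sw b) := by
  induction b generalizing lam μ with
  | nil => exact conv_one lam μ
  | cons s b ih =>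
    have h0 : conv (lam ∘ₗ LinearMap.mulLeft k (g.ι (A.x s)))
        (μ ∘ₗ g.envGrading.signOp (A.par s)) (A.sw b) = 0 :=
      h.conv_eq_zero_of_low (d := 0) (fun u hu => by rw [(Submodule.mem_bot k).1 hu, map_zero])
        (h.comp_signOp_low hμ _) _ (A.sw_mem_low (by simp))
    rw [sw_cons, conv_leibniz lam μ (A.x_mem s), h0, zero_add, ih]
    · rfl
    · intro u hu
      exact hμ _ (h.mul_mem_low (h.ι_mem_fil_one _) hu (by simp [add_comm]))

/-- If `μ` vanishes on the words shorter than `b`, only two kinds of terms in the coproduct of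
`s :: b` contribute: `lam` is evaluated at `s` alone, or `s` is among the letters at which `μ` is
evaluated. -/
theorem conv_sw_cons (s : S) (b : List S) {lam : g.Env →ₗ[k] k} {μ : g.Env →ₗ[k] V}
    (hμ : ∀ u ∈ h.low b.length, μ u = 0) :
    conv lam μ (A.sw (s :: b)) = (lam (g.ι (A.x s)) * psign k (A.par s * A.wpar b)) • μ (A.sw b) +
      conv lam (μ ∘ₗ LinearMap.mulLeft k (g.ι (A.x s))) (A.sw b) := by
  rw [sw_cons, conv_leibniz lam μ (A.x_mem s), A.conv_sw_right b _
    (h.comp_signOp_low hμ _), LinearMap.comp_apply, LinearMap.comp_apply,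
    g.envGrading.signOp_of_mem _ (A.sw_mem_deg b), map_smul, smul_smul, LinearMap.mulLeft_apply,
    mul_one]

theorem comp_mulLeft_low (s : S) (b : List S) {μ : g.Env →ₗ[k] V}
    (hμ : ∀ u ∈ h.low b.length, μ u = 0) :
    ∀ u ∈ h.low (b.length - 1), (μ ∘ₗ LinearMap.mulLeft k (g.ι (A.x s))) u = 0 := by
  intro u hu
  rcases hb : b.length with _ | n
  · rw [hb] at hu
    rw [(Submodule.mem_bot k).1 hu, map_zero]
  · rw [hb] at hu hμ
    exact hμ _ (h.mul_mem_low (h.ι_mem_fil_one _) hu (by omega))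

/-- Convolution with a form that vanishes on `U'(h)` and on the letters of a word. -/
theorem conv_sw_eq_zero (b : List S) {lam : g.Env →ₗ[k] k} {μ : g.Env →ₗ[k] V}
    (h1 : lam 1 = 0) (hb : ∀ s ∈ b, lam (g.ι (A.x s)) = 0)
    (hμ : ∀ u ∈ h.low (b.length - 1), μ u = 0) : conv lam μ (A.sw b) = 0 := by
  induction b generalizing μ with
  | nil => rw [sw_nil, conv_one, h1, zero_smul]
  | cons s b ih =>
    rw [A.conv_sw_cons s b hμ, hb s (by simp), zero_mul, zero_smul, zero_add]
    exact ih (fun r hr => hb r (by simp [hr])) (A.comp_mulLeft_low s b hμ)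

/-- Convolution with the coordinate of an even letter counts the occurrences of this letter. -/
theorem conv_sw_replicate {i : S} (hi : A.par i = 0) {b : List S} {lam : g.Env →ₗ[k] k}
    (h1 : lam 1 = 0) (hli : lam (g.ι (A.x i)) = 1) (hb : ∀ s ∈ b, lam (g.ι (A.x s)) = 0) (n : ℕ)
    {μ : g.Env →ₗ[k] V} (hμ : ∀ u ∈ h.low (n + b.length), μ u = 0) :
    conv lam μ (A.sw (List.replicate (n + 1) i ++ b)) =
      ((n + 1 : ℕ) : k) • μ (A.sw (List.replicate n i ++ b)) := by
  induction n generalizing μ with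
  | zero =>
    have hμ' : ∀ u ∈ h.low b.length, μ u = 0 := by simpa using hμ
    simp only [zero_add, List.replicate_one, List.replicate_zero, List.nil_append,
      List.singleton_append]
    rw [A.conv_sw_cons i b hμ', A.conv_sw_eq_zero b h1 hb (A.comp_mulLeft_low i b hμ'), hi, hli]
    simp
  | succ n ih =>
    have hlen : (List.replicate (n + 1) i ++ b).length = n + 1 + b.length := by simp
    rw [List.replicate_succ, List.cons_append, A.conv_sw_cons i _ (by rwa [hlen]), ih, hi, hli]
    · rw [LinearMap.comp_apply, LinearMap.mulLeft_apply, ← sw_cons, ← List.cons_append,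
        ← List.replicate_succ]
      push_cast
      rw [zero_mul, psign_zero, mul_one]
      module
    · have := A.comp_mulLeft_low i (List.replicate (n + 1) i ++ b) (μ := μ) (by rwa [hlen])
      rwa [hlen, show n + 1 + b.length - 1 = n + b.length by omega] at this

variable [LinearOrder S]

/-- The elements `η s` of `𝒜` vanish on `U'(h)` and restrict to the coordinates along the
supplement. -/
structure IsDual (A : h.AdaptedBasis J S) (η : S → h.Coord) : Prop where
  low : ∀ s, ∀ u ∈ h.low 1, (η s).1 u = 0
  letter : ∀ s r, (η s).1 (g.ι (A.x r)) = if r = s then 1 else 0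

variable {A} {η : S → h.Coord}

theorem coordProd_low (hη : A.IsDual η) (l : List S) :
    ∀ u ∈ h.low l.length, (h.coordProd (l.map η)).1 u = 0 := by
  induction l with
  | nil => intro u hu; rw [(Submodule.mem_bot k).1 hu, map_zero]
  | cons s l ih =>
    intro u hu
    refine h.conv_eq_zero_of_low (hη.low s) ih u ?_
    rwa [List.length_cons, add_comm] at hu

/-- The product of the coordinates of the letters of an irreducible word does not vanish on this
word. -/
theorem coordProd_sw_ne_zero (hη : A.IsDual η) {l : List S} (hl : A.Irr l) :
    (h.coordProd (l.map η)).1 (A.sw l) ≠ 0 := by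
  induction l with
  | nil => simp [coordProd, coordOne]
  | cons i l ih =>
    have hlow := coordProd_low hη l
    have h1 : (η i).1 1 = 0 := hη.low i 1 (h.one_mem_fil 0)
    obtain ⟨b, hb, hib⟩ : ∃ b, l = List.replicate (l.count i) i ++ b ∧ i ∉ b := by
      have hi : ∀ j ∈ l, i ≤ j := (List.pairwise_cons.1 hl.1).1
      obtain ⟨b, hb⟩ := HomogeneousBasis.replicate_count_prefix hl.1.of_cons hi
      refine ⟨b, hb.symm, List.count_eq_zero.1 ?_⟩
      have := congrArg (List.count i) hb
      rw [List.count_append, List.count_replicate_self] at this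
      omega
    have hl' : A.Irr l := ⟨hl.1.of_cons, fun s => lt_of_le_of_lt List.count_le_count_cons (hl.2 s)⟩
    have hbz : ∀ s ∈ b, (η i).1 (g.ι (A.x s)) = 0 := by
      intro s hs
      rw [hη.letter, if_neg]
      rintro rfl
      exact hib hs
    have hq := hl.2 i
    rw [List.count_cons_self] at hq
    generalize l.count i = n at hb hq
    change conv (η i).1 (h.coordProd (l.map η)).1 (A.sw (i :: l)) ≠ 0
    rcases A.whole.par_cases (Sum.inr i) with hp | ⟨hp, hp1⟩
    · have h2 := A.conv_sw_replicate hp h1 (by rw [hη.letter, if_pos rfl]) hbz n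
        (μ := (h.coordProd (l.map η)).1) (by
          have : l.length = n + b.length := by rw [hb]; simp
          rwa [← this])
      rw [List.replicate_succ, List.cons_append, ← hb] at h2
      rw [h2, smul_eq_mul]
      refine mul_ne_zero ?_ (ih hl')
      rw [HomogeneousBasis.q, if_pos hp] at hq
      rw [Ne, CharP.cast_eq_zero_iff k p]
      exact fun hdvd => absurd (Nat.le_of_dvd (Nat.succ_pos n) hdvd) (not_le.2 hq)
    · rw [HomogeneousBasis.q, if_neg hp] at hq
      obtain rfl : n = 0 := by omega
      simp only [List.replicate_zero, List.nil_append] at hb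
      rw [A.conv_sw_cons i l hlow, A.conv_sw_eq_zero l h1 (by rwa [hb])
        (A.comp_mulLeft_low i l hlow), add_zero, hη.letter, if_pos rfl, one_mul, smul_eq_mul]
      refine mul_ne_zero ?_ (ih hl')
      rcases psign_cases k (A.par i * A.wpar l) with hc | hc <;> rw [hc] <;> simp

end AdaptedBasis

end Sub

end RestrictedLieSuperalgebra

end RestrictedSuper

end

noncomputable section

namespace RestrictedSuper

namespace RestrictedLieSuperalgebra

namespace Sub

variable {k : Type*} [Field k] {p : ℕ} {L : Type*} [AddCommGroup L] [Module k L]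
variable [CharP k p] [Fact p.Prime] [Fact (2 < p)]
variable {g : RestrictedLieSuperalgebra k p L} {h : g.Sub}
variable {V : Type*} [AddCommGroup V] [Module k V] {ρ : h.toRestricted.Rep V}

/-! ### Elements concentrated on the top word -/

instance : IsScalarTower k g.Env (h.Coind ρ) :=
  ⟨fun c u μ => Subtype.ext (LinearMap.ext fun w =>
    (congrArg μ.1 (mul_smul_comm c w u)).trans (map_smul μ.1 c (w * u)))⟩

theorem strad_add (x y : h.carrier) : h.strad (x + y) = h.strad x + h.strad y := by
  rw [strad, strad, strad, map_add, map_add]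

namespace AdaptedBasis

variable {J S : Type*} (A : h.AdaptedBasis J S) [LinearOrder S] {t : List S} {c : k}

/-- A family `F v` of elements of a coinduced module that take the value `c v` on the top word `t`
and vanish on the other irreducible words. -/
def IsTopFamily (t : List S) (c : k) (F : V → h.Coind ρ) : Prop :=
  ∀ v b, A.Irr b → (F v).1 (A.sw b) = if b = t then c • v else 0

variable [LinearOrder J] [WellFoundedLT J] [WellFoundedLT S]

/-- Parities in a coinduced module can be tested on irreducible words. -/
theorem mem_coindDeg {μ : h.Coind ρ} {i : ZMod 2}
    (hμ : ∀ b, A.Irr b → μ.1 (A.sw b) ∈ ρ.grading.deg (i + A.wpar b)) : μ ∈ h.coindDeg ρ i := by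
  have h2 := two_ne_zero_of_char k p
  -- the twist of `μ` by the parity operators
  have hact : ∀ (a : h.toRestricted.Env) (v : V), ρ.grading.parity (ρ.env a v) =
      ρ.env (h.toRestricted.envParity a) (ρ.grading.parity v) := by
    intro a
    induction a using env_induction with
    | h_scalar c => intro v; simp [Algebra.algebraMap_eq_smul_one]
    | h_ι x =>
      intro v
      rw [envParity_ι, Rep.env, lift_ι, lift_ι, ← h.toRestricted.grading.proj_add x]
      simp only [map_add, LinearMap.add_apply]
      rw [ρ.act_parity (h.toRestricted.grading.proj_mem 0 x),
        ρ.act_parity (h.toRestricted.grading.proj_mem 1 x),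
        h.toRestricted.grading.parity_of_mem (h.toRestricted.grading.proj_mem 0 x),
        h.toRestricted.grading.parity_of_mem (h.toRestricted.grading.proj_mem 1 x)]
      simp only [map_smul, LinearMap.smul_apply]
    | h_mul a b ha hb => intro v; rw [map_mul, map_mul, map_mul, Module.End.mul_apply, ha, hb]; rfl
    | h_add a b ha hb =>
      intro v
      rw [map_add, map_add, map_add, LinearMap.add_apply, map_add, ha, hb]; rfl
  have hincl : ∀ a : h.toRestricted.Env, g.envParity (h.envIncl a) =
      h.envIncl (h.toRestricted.envParity a) := by
    have : g.envParity.comp h.envIncl = h.envIncl.comp h.toRestricted.envParity := by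
      ext x
      simp only [AlgHom.comp_apply, envIncl_ι, envParity_ι]
      rw [← g.grading.proj_add (x : L)]
      congr 1
      have hx : ∀ i, ((h.toRestricted.grading.proj i x : h.carrier) : L) = g.grading.proj i x := by
        have h0 : ((h.toRestricted.grading.proj 0 x : h.carrier) : L) ∈ g.grading.deg 0 :=
          h.toRestricted.grading.proj_mem 0 x
        have h1 : ((h.toRestricted.grading.proj 1 x : h.carrier) : L) ∈ g.grading.deg 1 :=
          h.toRestricted.grading.proj_mem 1 x
        have hs := congrArg (Subtype.val) (h.toRestricted.grading.proj_add x)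
        intro i
        conv_rhs => rw [← hs]
        rw [Submodule.coe_add, map_add]
        rcases zmod2_cases i with rfl | rfl
        · rw [g.grading.proj_self h0, g.grading.proj_ne (by decide) h1, add_zero]
        · rw [g.grading.proj_self h1, g.grading.proj_ne (by decide) h0, zero_add]
      rw [g.grading.proj_add, SuperGrading.parity, SuperGrading.parity, LinearMap.sub_apply,
        LinearMap.sub_apply, Submodule.coe_sub, hx, hx]
    exact fun a => DFunLike.congr_fun this a
  let ν : h.Coind ρ := ⟨ρ.grading.parity ∘ₗ μ.1 ∘ₗ g.envParity.toLinearMap, fun a u => by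
    simp only [LinearMap.comp_apply, AlgHom.toLinearMap_apply]
    rw [map_mul, hincl, μ.2, hact]
    congr 2
    exact h.toRestricted.envParity_envParity a⟩
  have hν : ν = psign k i • μ := by
    refine A.coind_ext ρ fun b hb => ?_
    have h1 := (g.mem_envGrading).1 (A.sw_mem_deg b)
    change ρ.grading.parity (μ.1 (g.envParity (A.sw b))) = psign k i • μ.1 (A.sw b)
    rw [h1, map_smul, map_smul, ρ.grading.parity_of_mem (hμ b hb), smul_smul, psign_add,
      mul_comm, mul_assoc, psign_mul_self, mul_one]
  intro j u hu
  have h1 : ρ.grading.parity (μ.1 (g.envParity u)) = psign k i • μ.1 u :=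
    congrArg (fun ν : h.Coind ρ => ν.1 u) hν
  rw [ρ.grading.mem_deg_iff h2, psign_add]
  rw [(g.mem_envGrading).1 hu, map_smul, map_smul] at h1
  rw [mul_comm, mul_smul, ← h1, smul_smul, psign_mul_self, one_smul]

namespace IsTopFamily

variable {A} {F : V → h.Coind ρ}

theorem low (hF : A.IsTopFamily t c F) (v : V) : ∀ u ∈ h.low t.length, (F v).1 u = 0 := by
  intro u hu
  rcases ht : t.length with _ | n
  · rw [ht] at hu
    rw [(Submodule.mem_bot k).1 hu, map_zero]
  · rw [ht] at hu
    refine A.coind_eq_zero_of_fil ρ (F v).2 (d := n) (fun b hb hn => ?_) hu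
    rw [hF v b hb, if_neg]
    rintro rfl
    omega

theorem apply_add (hF : A.IsTopFamily t c F) (v w : V) : F (v + w) = F v + F w := by
  refine A.coind_ext ρ fun b hb => ?_
  change _ = (F v).1 (A.sw b) + (F w).1 (A.sw b)
  rw [hF _ b hb, hF _ b hb, hF _ b hb]
  split_ifs <;> simp

theorem apply_smul (hF : A.IsTopFamily t c F) (a : k) (v : V) : F (a • v) = a • F v := by
  refine A.coind_ext ρ fun b hb => ?_
  change _ = a • (F v).1 (A.sw b)
  rw [hF _ b hb, hF _ b hb]
  split_ifs
  · rw [smul_comm]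
  · rw [smul_zero]

theorem top (hF : A.IsTopFamily t c F) (ht : A.IsTop t) (v : V) : (F v).1 (A.sw t) = c • v := by
  rw [hF v t ht.irr, if_pos rfl]

theorem mem_coindDeg (hF : A.IsTopFamily t c F) {v : V} {i : ZMod 2} (hv : v ∈ ρ.grading.deg i) :
    F v ∈ h.coindDeg ρ (A.wpar t + i) := by
  refine A.mem_coindDeg fun b hb => ?_
  rw [hF v b hb]
  split_ifs with hbt
  · rw [hbt, add_right_comm, CharTwo.add_self_eq_zero, zero_add]
    exact Submodule.smul_mem _ _ hv
  · exact zero_mem _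

/-- The action of `h` on elements concentrated on the top word is twisted by the supertrace. -/
theorem ι_smul [Fintype S] (hF : A.IsTopFamily t c F) (ht : A.IsTop t) {α : ZMod 2}
    {H : h.carrier} (hα : (H : L) ∈ g.grading.deg α) (v : V) :
    g.ι (H : L) • F v = h.strad H • F v + psign k (α * A.wpar t) • F (ρ.act H v) := by
  refine A.coind_ext ρ fun b hb => ?_
  change (F v).1 (A.sw b * g.ι (H : L)) =
    h.strad H • (F v).1 (A.sw b) + psign k (α * A.wpar t) • (F (ρ.act H v)).1 (A.sw b)
  by_cases hbt : b = t
  · have h1 := hF.low v _ (ht.mul_ι hα)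
    rw [map_sub, sub_eq_zero, LinearMap.map_add, LinearMap.map_smul, LinearMap.map_smul,
      h.Coind_ι ρ (F v).2, hF.top ht] at h1
    rw [hbt, h1, hF.top ht, hF.top ht, LinearMap.map_smul, add_comm]
  · rw [hF v b hb, hF _ b hb, if_neg hbt, if_neg hbt, smul_zero, smul_zero, add_zero]
    refine hF.low v _ (h.fil_le_low ?_
      (h.mul_mem_fil (A.sw_mem_fil b) (h.ι_mem_fil_zero H.2) le_rfl))
    by_contra hcon
    exact hbt (ht.eq_of_length_le hb (by omega))

/-- The map `v ↦ F v`, on `k ⊗ V`. -/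
def toLin (hF : A.IsTopFamily t c F) : k ⊗[k] V →ₗ[k] h.Coind ρ :=
  { toFun := F, map_add' := hF.apply_add, map_smul' := hF.apply_smul } ∘ₗ
    (TensorProduct.lid k V).toLinearMap

theorem toLin_tmul (hF : A.IsTopFamily t c F) (v : V) : hF.toLin ((1 : k) ⊗ₜ[k] v) = F v := by
  change F (TensorProduct.lid k V _) = F v
  rw [TensorProduct.lid_tmul, one_smul]

variable [Fintype S] [FiniteDimensional k (L ⧸ h.carrier)] {m : ℕ}

/-- `F` intertwines the twisted representation with the action of `h` on the coinduced module. -/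
theorem toLin_env (hF : A.IsTopFamily t c F) (ht : A.IsTop t) (hm : A.wpar t = m)
    (a : h.toRestricted.Env) (w : k ⊗[k] V) :
    hF.toLin ((h.twist ρ m).env a w) = h.envIncl a • hF.toLin w := by
  induction a using env_induction generalizing w with
  | h_scalar r =>
    rw [AlgHom.commutes, AlgHom.commutes, Algebra.algebraMap_eq_smul_one,
      Algebra.algebraMap_eq_smul_one, smul_assoc, one_smul, LinearMap.smul_apply,
      LinearMap.map_smul]
    rfl
  | h_ι x =>
    obtain ⟨v, rfl⟩ : ∃ v : V, w = (1 : k) ⊗ₜ[k] v :=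
      ⟨TensorProduct.lid k V w, (TensorProduct.lid k V).injective (by simp)⟩
    have key : ∀ (α : ZMod 2) (y : h.carrier), y ∈ h.toRestricted.grading.deg α →
        hF.toLin ((h.twist ρ m).act y ((1 : k) ⊗ₜ[k] v)) = g.ι (y : L) • F v := by
      intro α y hy
      have h1 : (h.twist ρ m).act y = _ := tensorAct_of_mem (h.adQuot.strRep (m : ZMod 2)) ρ hy
      have h2 : (h.adQuot.strRep (m : ZMod 2)).grading.signOp α (1 : k) =
          psign k (α * A.wpar t) • (1 : k) := by
        rw [hm]
        refine SuperGrading.signOp_of_mem _ α ?_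
        simp [Rep.strRep, SuperGrading.shifted]
      have h3 : (h.adQuot.strRep (m : ZMod 2)).act y (1 : k) = h.strad y • (1 : k) := rfl
      rw [h1, LinearMap.add_apply, TensorProduct.map_tmul, TensorProduct.map_tmul, h2, h3,
        ← TensorProduct.smul_tmul', ← TensorProduct.smul_tmul', LinearMap.map_add,
        LinearMap.map_smul, LinearMap.map_smul, LinearMap.id_apply, toLin_tmul, toLin_tmul,
        hF.ι_smul ht hy]
    rw [h.envIncl_ι, Rep.env, lift_ι, toLin_tmul, ← h.toRestricted.grading.proj_add x,
      LinearMap.map_add, LinearMap.add_apply, LinearMap.map_add,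
      key 0 _ (h.toRestricted.grading.proj_mem 0 x), key 1 _ (h.toRestricted.grading.proj_mem 1 x),
      ← add_smul, ← LinearMap.map_add]
    rfl
  | h_mul a b ha hb =>
    rw [map_mul, map_mul, Module.End.mul_apply, ha, hb, mul_smul]
  | h_add a b ha hb =>
    rw [map_add, map_add, LinearMap.add_apply, LinearMap.map_add, ha, hb, add_smul]

/-- The map `u ⊗ w ↦ u F w` on `U'(g) ⊗ (k ⊗ V)`. -/
def lift (hF : A.IsTopFamily t c F) : g.Env ⊗[k] (k ⊗[k] V) →ₗ[g.Env] h.Coind ρ :=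
  TensorProduct.AlgebraTensorModule.lift
    { toFun := fun u =>
        { toFun := fun w => u • hF.toLin w
          map_add' := fun w w' => by rw [LinearMap.map_add, smul_add]
          map_smul' := fun r w => by
            rw [LinearMap.map_smul, RingHom.id_apply]
            exact smul_algebra_smul_comm r u _ }
      map_add' := fun u u' => LinearMap.ext fun w => add_smul u u' _
      map_smul' := fun u u' => LinearMap.ext fun w => mul_smul u u' _ }

theorem indRel_le (hF : A.IsTopFamily t c F) (ht : A.IsTop t) (hm : A.wpar t = m) :
    h.indRel (h.twist ρ m) ≤ LinearMap.ker hF.lift := by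
  refine Submodule.span_le.2 ?_
  rintro _ ⟨u, a, w, rfl⟩
  have h1 : hF.lift ((u * h.envIncl a) ⊗ₜ[k] w - u ⊗ₜ[k] (h.twist ρ m).env a w) =
      (u * h.envIncl a) • hF.toLin w - u • hF.toLin ((h.twist ρ m).env a w) :=
    LinearMap.map_sub hF.lift _ _
  rw [hF.toLin_env ht hm, mul_smul, sub_self] at h1
  exact h1

/-- The morphism `u ⊗ v ↦ u F v` from the induced to the coinduced module. -/
def toHom (hF : A.IsTopFamily t c F) (ht : A.IsTop t) (hm : A.wpar t = m) :
    h.Ind (h.twist ρ m) →ₗ[g.Env] h.Coind ρ :=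
  (h.indRel (h.twist ρ m)).liftQ hF.lift (hF.indRel_le ht hm)

theorem toHom_indMk (hF : A.IsTopFamily t c F) (ht : A.IsTop t) (hm : A.wpar t = m) (u : g.Env)
    (v : V) : hF.toHom ht hm (h.indMk (h.twist ρ m) u ((1 : k) ⊗ₜ[k] v)) = u • F v := by
  rw [← hF.toLin_tmul v]
  rfl

end IsTopFamily

end AdaptedBasis

end Sub

end RestrictedLieSuperalgebra

end RestrictedSuper

end

noncomputable section

namespace RestrictedSuper

namespace RestrictedLieSuperalgebra

namespace Sub

variable {k : Type*} [Field k] {p : ℕ} {L : Type*} [AddCommGroup L] [Module k L]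
variable [CharP k p] [Fact p.Prime] [Fact (2 < p)]
variable {g : RestrictedLieSuperalgebra k p L} {h : g.Sub}
variable {V : Type*} [AddCommGroup V] [Module k V] {ρ : h.toRestricted.Rep V}

theorem _root_.RestrictedSuper.SuperGrading.mem_tensor (h2 : (2 : k) ≠ 0) {W : Type*}
    [AddCommGroup W] [Module k W]
    (G : SuperGrading k V) (H : SuperGrading k W) {i : ZMod 2} {w : V ⊗[k] W} :
    w ∈ (SuperGrading.tensor h2 G H).deg i ↔
      TensorProduct.map G.parity H.parity w = psign k i • w := by
  unfold SuperGrading.tensor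
  exact SuperGrading.mem_ofInvolution _ _ _

/-! ### The isomorphism of an induced with a coinduced module -/

section Parity

variable {W : Type*} [AddCommGroup W] [Module k W] (σ : h.toRestricted.Rep W)

theorem coindDeg_disjoint {i j : ZMod 2} (hij : i ≠ j) {μ : h.Coind ρ} (hi : μ ∈ h.coindDeg ρ i)
    (hj : μ ∈ h.coindDeg ρ j) : μ = 0 := by
  have key : ∀ l, ∀ u ∈ g.envGrading.deg l, μ.1 u = 0 := by
    intro l u hu
    have h1 := ρ.grading.proj_self (hi l u hu)
    rw [← h1]
    exact ρ.grading.proj_ne (fun h => hij (add_right_cancel h).symm) (hj l u hu)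
  refine Subtype.ext (LinearMap.ext fun u => ?_)
  rw [← g.envGrading.proj_add u, map_add, key 0 _ (g.envGrading.proj_mem 0 u),
    key 1 _ (g.envGrading.proj_mem 1 u), add_zero]
  rfl

theorem smul_mem_coindDeg {i j : ZMod 2} {u : g.Env} (hu : u ∈ g.envGrading.deg j) {μ : h.Coind ρ}
    (hμ : μ ∈ h.coindDeg ρ i) : u • μ ∈ h.coindDeg ρ (i + j) := by
  intro l w hw
  have := hμ (l + j) (w * u) (g.mul_mem hw hu)
  rwa [add_comm l, ← add_assoc] at this

/-- An induced module is the sum of its homogeneous parts. -/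
theorem exists_indDeg_add (x : h.Ind σ) :
    ∃ x₀ ∈ h.indDeg σ 0, ∃ x₁ ∈ h.indDeg σ 1, x = x₀ + x₁ := by
  rw [← Set.mem_ofPred_eq (p := fun x => ∃ x₀ ∈ h.indDeg σ 0, ∃ x₁ ∈ h.indDeg σ 1, x = x₀ + x₁)]
  obtain ⟨y, rfl⟩ := (h.indRel σ).mkQ_surjective x
  have hs : ∀ x, x ∈ h.indDeg σ 0 ⊔ h.indDeg σ 1 →
      ∃ x₀ ∈ h.indDeg σ 0, ∃ x₁ ∈ h.indDeg σ 1, x = x₀ + x₁ := fun x hx => by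
    obtain ⟨x₀, h₀, x₁, h₁, e⟩ := Submodule.mem_sup.1 hx
    exact ⟨x₀, h₀, x₁, h₁, e.symm⟩
  have hdeg : ∀ i, h.indDeg σ i ≤ h.indDeg σ 0 ⊔ h.indDeg σ 1 := fun i => by
    rcases zmod2_cases i with rfl | rfl
    · exact le_sup_left
    · exact le_sup_right
  refine hs _ ?_
  induction y with
  | zero => rw [map_zero]; exact zero_mem _
  | add a b ha hb => rw [map_add]; exact add_mem ha hb
  | tmul u v =>
    have hm : ∀ i j, (h.indRel σ).mkQ (g.envGrading.proj i u ⊗ₜ[k] σ.grading.proj j v) ∈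
        h.indDeg σ 0 ⊔ h.indDeg σ 1 := fun i j => hdeg (i + j) <|
      Submodule.subset_span ⟨i, j, _, _, rfl, g.envGrading.proj_mem i u,
          σ.grading.proj_mem j v, rfl⟩
    rw [← g.envGrading.proj_add u, ← σ.grading.proj_add v, TensorProduct.add_tmul,
      TensorProduct.tmul_add, TensorProduct.tmul_add, map_add, map_add, map_add]
    exact add_mem (add_mem (hm 0 0) (hm 0 1)) (add_mem (hm 1 0) (hm 1 1))

/-- An isomorphism that maps homogeneous elements to homogeneous elements of the same parity also
reflects parities. -/
theorem preservesParity_of_forall {Φ : h.Ind σ ≃ₗ[g.Env] h.Coind ρ}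
    (hΦ : ∀ i, ∀ x ∈ h.indDeg σ i, Φ x ∈ h.coindDeg ρ i) : h.PreservesParity Φ := by
  intro i x
  refine ⟨hΦ i x, fun hx => ?_⟩
  obtain ⟨x₀, h₀, x₁, h₁, rfl⟩ := exists_indDeg_add σ x
  rw [map_add] at hx
  rcases zmod2_cases i with rfl | rfl
  · have h2 := sub_mem hx (hΦ 0 _ h₀)
    rw [add_sub_cancel_left] at h2
    have h3 := coindDeg_disjoint (by decide) h2 (hΦ 1 _ h₁)
    rw [Φ.map_eq_zero_iff] at h3
    rwa [h3, add_zero]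
  · have h2 := sub_mem hx (hΦ 1 _ h₁)
    rw [add_sub_cancel_right] at h2
    have h3 := coindDeg_disjoint (by decide) (hΦ 0 _ h₀) h2
    rw [Φ.map_eq_zero_iff] at h3
    rwa [h3, zero_add]

end Parity

namespace AdaptedBasis

variable {J S : Type*} {A : h.AdaptedBasis J S} [LinearOrder S] {t : List S} {c : k}
variable [LinearOrder J] [WellFoundedLT J] [Fintype S]

variable (A) in
theorem finite_irr : {b | A.Irr b}.Finite := by
  refine (List.finite_length_le S (∑ s, A.whole.q (Sum.inr s))).subset fun b hb => ?_
  change b.length ≤ _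
  have h1 : b.length = ∑ s, b.count s := by
    have := Multiset.sum_count_eq_card (s := Finset.univ) (m := (b : Multiset S)) (by simp)
    simpa using this.symm
  rw [h1]
  exact Finset.sum_le_sum fun s _ => (hb.2 s).le

variable (A) in
/-- The irreducible words in the supplement. -/
abbrev IrrWord : Type _ := {b : List S // A.Irr b}

instance : Fintype A.IrrWord := A.finite_irr.fintype

namespace IsTopFamily

variable {F : V → h.Coind ρ}

theorem smul_apply_of_perm (hF : A.IsTopFamily t c F) (ht : A.IsTop t) (hc : c ≠ 0) {a b : List S}
    (hab : (b ++ a).Perm t) : ∃ c' : k, c' ≠ 0 ∧ ∀ v, (A.sw a • F v).1 (A.sw b) = c' • v := by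
  obtain ⟨r, hr, h1⟩ := A.sw_perm hab
  refine ⟨r * c, mul_ne_zero hr hc, fun v => ?_⟩
  rw [hab.length_eq] at h1
  have h2 := hF.low v _ h1
  rw [map_sub, sub_eq_zero, LinearMap.map_smul, hF.top ht, smul_smul, sw_append] at h2
  exact h2

theorem smul_apply_eq_zero (hF : A.IsTopFamily t c F) (ht : A.IsTop t) {a b : List S}
    (hl : b.length + a.length ≤ t.length) (hab : ¬ (b ++ a).Perm t) (v : V) :
    (A.sw a • F v).1 (A.sw b) = 0 := by
  change (F v).1 (A.sw b * A.sw a) = 0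
  rw [← sw_append]
  refine hF.low v _ ?_
  have hl' : (b ++ a).length ≤ t.length := by simpa using hl
  rcases hl'.lt_or_eq with h1 | h1
  · exact h.fil_le_low h1 (A.sw_mem_fil _)
  · rcases ht.perm_or h1.ge with h2 | ⟨s, hs⟩
    · exact absurd h2 hab
    · rw [← h1]
      exact A.sw_mem_low_of_count hs

variable [FiniteDimensional k (L ⧸ h.carrier)] {m : ℕ}

/-- The combinations `∑ b ⊗ v_b` in the induced module, over the irreducible words `b`. -/
def comb (m : ℕ) : (A.IrrWord → V) →ₗ[k] h.Ind (h.twist ρ m) :=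
  ∑ b : A.IrrWord, ((h.indRel (h.twist ρ m)).mkQ.restrictScalars k ∘ₗ
    TensorProduct.mk k g.Env (k ⊗[k] V) (A.sw b) ∘ₗ TensorProduct.mk k k V 1) ∘ₗ LinearMap.proj b

theorem comb_apply (f : A.IrrWord → V) : comb (ρ := ρ) m f =
    ∑ b : A.IrrWord, h.indMk (h.twist ρ m) (A.sw b) ((1 : k) ⊗ₜ[k] f b) := by
  rw [comb, LinearMap.sum_apply]
  rfl

theorem comb_surjective : Function.Surjective (comb (A := A) (ρ := ρ) m) := by
  classical
  rw [← LinearMap.range_eq_top, Submodule.eq_top_iff']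
  intro x
  obtain ⟨y, rfl⟩ := (h.indRel (h.twist ρ m)).mkQ_surjective x
  induction y with
  | zero => rw [map_zero]; exact zero_mem _
  | add a b ha hb => rw [map_add]; exact add_mem ha hb
  | tmul u w =>
    have hu := A.mem_span_back u
    induction hu using Submodule.span_induction with
    | mem u hu =>
      obtain ⟨b, a, hb, rfl⟩ := hu
      obtain ⟨v, hv⟩ : ∃ v : V, (h.twist ρ m).env a w = (1 : k) ⊗ₜ[k] v :=
        ⟨TensorProduct.lid k V ((h.twist ρ m).env a w), (TensorProduct.lid k V).injective (by simp)⟩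
      refine ⟨Pi.single ⟨b, hb⟩ v, ?_⟩
      rw [comb_apply, Finset.sum_eq_single (⟨b, hb⟩ : A.IrrWord)]
      · rw [Pi.single_eq_same, ← hv, indMk, ← sub_eq_zero, ← map_sub, ← neg_sub, map_neg,
          neg_eq_zero, Submodule.mkQ_apply, Submodule.Quotient.mk_eq_zero]
        exact Submodule.subset_span ⟨_, _, _, rfl⟩
      · intro b' _ hb'
        rw [Pi.single_eq_of_ne hb', TensorProduct.tmul_zero, indMk, TensorProduct.tmul_zero,
          map_zero]
      · simp
    | zero => rw [TensorProduct.zero_tmul, map_zero]; exact zero_mem _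
    | add a b _ _ ha hb => rw [TensorProduct.add_tmul, map_add]; exact add_mem ha hb
    | smul r a _ ha =>
      rw [← TensorProduct.smul_tmul']
      exact Submodule.smul_mem (LinearMap.range (comb (A := A) (ρ := ρ) m)) r ha

theorem toHom_comb (hF : A.IsTopFamily t c F) (ht : A.IsTop t) (hm : A.wpar t = m)
    (f : A.IrrWord → V) : hF.toHom ht hm (comb m f) = ∑ b : A.IrrWord, A.sw b • F (f b) := by
  rw [comb_apply, map_sum]
  exact Finset.sum_congr rfl fun b _ => hF.toHom_indMk ht hm _ _

theorem toHom_injective (hF : A.IsTopFamily t c F) (ht : A.IsTop t) (hc : c ≠ 0)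
    (hm : A.wpar t = m) : Function.Injective (hF.toHom ht hm) := by
  classical
  rw [injective_iff_map_eq_zero]
  intro x hx
  obtain ⟨f, rfl⟩ := comb_surjective (A := A) x
  rw [hF.toHom_comb ht hm] at hx
  suffices f = 0 by rw [this, map_zero]
  by_contra hf
  -- evaluate on the complement of a word `a` of maximal length with a nonzero coefficient
  obtain ⟨a, ha, hmax⟩ := Finset.exists_max_image (Finset.univ.filter fun b => f b ≠ 0)
    (fun b : A.IrrWord => b.1.length) (by
      obtain ⟨b, hb⟩ := Function.ne_iff.1 hf
      exact ⟨b, by simpa using hb⟩)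
  rw [Finset.mem_filter] at ha
  obtain ⟨b, hb, hba⟩ := ht.exists_compl a.2
  obtain ⟨c', hc', h1⟩ := hF.smul_apply_of_perm ht hc hba
  have h2 := congrArg (fun μ : h.Coind ρ => μ.1 (A.sw b)) hx
  simp only [Submodule.coe_sum, LinearMap.sum_apply] at h2
  rw [Finset.sum_eq_single a, h1] at h2
  · exact ha.2 ((smul_eq_zero.1 h2).resolve_left hc')
  · intro a' _ haa'
    by_cases h0 : f a' = 0
    · have hF0 : F 0 = 0 := by simpa using hF.apply_smul 0 0
      rw [h0, hF0, smul_zero]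
      rfl
    · have hl := hmax a' (by simpa using h0)
      have hlen := hba.length_eq
      rw [List.length_append] at hlen
      refine hF.smul_apply_eq_zero ht (by omega) (fun hp => haa' (Subtype.ext ?_)) _
      exact ((List.perm_append_left_iff b).1 (hp.trans hba.symm)).eq_of_pairwise
        (fun a b _ _ => le_antisymm) a'.2.1 a.2.1
  · simp

theorem toHom_surjective (hF : A.IsTopFamily t c F) (ht : A.IsTop t) (hc : c ≠ 0)
    (hm : A.wpar t = m) : Function.Surjective (hF.toHom ht hm) := by
  classical
  -- the lowest values of an element of the coinduced module can be removed, by induction on the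
  -- order of vanishing
  have key : ∀ n d, d + n = t.length + 1 → ∀ μ : h.Coind ρ,
      (∀ b, A.Irr b → b.length < d → μ.1 (A.sw b) = 0) → ∃ x, hF.toHom ht hm x = μ := by
    intro n
    induction n with
    | zero =>
      intro d hd μ hμ
      refine ⟨0, ?_⟩
      rw [map_zero]
      refine A.coind_ext ρ fun b hb => ?_
      have := ht.length_le hb
      rw [hμ b hb (by omega)]
      rfl
    | succ n ih =>
      intro d hd μ hμ
      have hcompl : ∀ b : A.IrrWord, ∃ a : A.IrrWord, (b.1 ++ a.1).Perm t := fun b => by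
        obtain ⟨a, ha, hab⟩ := ht.exists_compl b.2
        exact ⟨⟨a, ha⟩, List.perm_append_comm.trans hab⟩
      choose a hba using hcompl
      choose c' hc' h1 using fun b => hF.smul_apply_of_perm ht hc (hba b)
      let ν : h.Coind ρ := ∑ b ∈ Finset.univ.filter (fun b : A.IrrWord => b.1.length = d),
        A.sw (a b) • F ((c' b)⁻¹ • μ.1 (A.sw b))
      obtain ⟨y, hy⟩ : ∃ y, hF.toHom ht hm y = ν := by
        refine ⟨∑ b ∈ Finset.univ.filter (fun b : A.IrrWord => b.1.length = d),
          h.indMk (h.twist ρ m) (A.sw (a b)) ((1 : k) ⊗ₜ[k] ((c' b)⁻¹ • μ.1 (A.sw b))), ?_⟩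
        rw [map_sum]
        exact Finset.sum_congr rfl fun b _ => hF.toHom_indMk ht hm _ _
      have hzero : ∀ b b' : A.IrrWord, b.1.length = d → b'.1.length ≤ d → b' ≠ b → ∀ v,
          (A.sw (a b) • F v).1 (A.sw b') = 0 := by
        intro b b' hbd hbd' hne v
        have hlen := (hba b).length_eq
        rw [List.length_append] at hlen
        refine hF.smul_apply_eq_zero ht (by omega) (fun hp => hne (Subtype.ext ?_)) _
        exact ((List.perm_append_right_iff (a b).1).1 (hp.trans (hba b).symm)).eq_of_pairwise
          (fun a b _ _ => le_antisymm) b'.2.1 b.2.1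
      obtain ⟨x, hx⟩ := ih (d + 1) (by omega) (μ - ν) (by
        intro b' hb' hl
        change μ.1 (A.sw b') - ν.1 (A.sw b') = 0
        simp only [ν, Submodule.coe_sum, LinearMap.sum_apply]
        by_cases hd' : b'.length = d
        · rw [Finset.sum_eq_single (⟨b', hb'⟩ : A.IrrWord), h1, smul_smul,
            mul_inv_cancel₀ (hc' _), one_smul, sub_self]
          · intro b hb hne
            exact hzero b ⟨b', hb'⟩ (Finset.mem_filter.1 hb).2 hd'.le hne.symm _
          · intro hn
            exact absurd (by simpa using hd') hn
        · rw [hμ b' hb' (by omega), Finset.sum_eq_zero, sub_zero]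
          intro b hb
          have hbd := (Finset.mem_filter.1 hb).2
          refine hzero b ⟨b', hb'⟩ hbd (by change b'.length ≤ d; omega) ?_ _
          rintro rfl
          exact hd' hbd)
      exact ⟨x + y, by rw [map_add, hx, hy, sub_add_cancel]⟩
  exact fun μ => key (t.length + 1) 0 (by omega) μ fun b _ hb => absurd hb (Nat.not_lt_zero _)

/-- The isomorphism of the twisted induced module with the coinduced module that is attached to a
family of elements concentrated on the top word. -/
theorem exists_equiv (hF : A.IsTopFamily t c F) (ht : A.IsTop t) (hc : c ≠ 0)
    (hm : A.wpar t = m) : ∃ Φ : h.Ind (h.twist ρ m) ≃ₗ[g.Env] h.Coind ρ, h.PreservesParity Φ ∧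
      ∀ (u : g.Env) (v : V), Φ (h.indMk (h.twist ρ m) u ((1 : k) ⊗ₜ[k] v)) = u • F v := by
  refine ⟨LinearEquiv.ofBijective (hF.toHom ht hm)
    ⟨hF.toHom_injective ht hc hm, hF.toHom_surjective ht hc hm⟩, ?_, hF.toHom_indMk ht hm⟩
  refine preservesParity_of_forall _ fun i x hx => ?_
  induction hx using Submodule.span_induction with
  | mem x hx =>
    obtain ⟨j, l, u, w, hjl, hu, hw, rfl⟩ := hx
    obtain ⟨v, rfl⟩ : ∃ v : V, w = (1 : k) ⊗ₜ[k] v :=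
      ⟨TensorProduct.lid k V w, (TensorProduct.lid k V).injective (by simp)⟩
    have h1 : (1 : k) ∈ (SuperGrading.shifted k (m : ZMod 2)).deg (m : ZMod 2) := by
      simp [SuperGrading.shifted]
    have hv : v ∈ ρ.grading.deg (m + l) := by
      have h2 : TensorProduct.map (SuperGrading.shifted k (m : ZMod 2)).parity ρ.grading.parity
          ((1 : k) ⊗ₜ[k] v) = psign k l • ((1 : k) ⊗ₜ[k] v) :=
        (SuperGrading.mem_tensor (two_ne_zero_of_char k p) _ _).1 hw
      rw [TensorProduct.map_tmul, SuperGrading.parity_of_mem _ h1, ← TensorProduct.smul_tmul'] at h2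
      have h3 := congrArg (TensorProduct.lid k V) h2
      rw [LinearEquiv.map_smul, LinearEquiv.map_smul, TensorProduct.lid_tmul,
        TensorProduct.lid_tmul, one_smul, one_smul] at h3
      rw [ρ.grading.mem_deg_iff (two_ne_zero_of_char k p), psign_add, mul_smul, ← h3, smul_smul,
        psign_mul_self, one_smul]
    have h4 := smul_mem_coindDeg hu (hF.mem_coindDeg hv)
    rw [hm, ← add_assoc, CharTwo.add_self_eq_zero, zero_add, add_comm, hjl,
      ← hF.toHom_indMk ht hm] at h4
    exact h4
  | zero => rw [map_zero]; exact zero_mem _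
  | add a b _ _ ha hb => rw [map_add]; exact add_mem ha hb
  | smul r a _ ha =>
    have : (LinearEquiv.ofBijective (hF.toHom ht hm)
        ⟨hF.toHom_injective ht hc hm, hF.toHom_surjective ht hc hm⟩) (r • a) = r • _ :=
      LinearMap.map_smul_of_tower (hF.toHom ht hm) r a
    rw [this]
    exact Submodule.smul_mem _ r ha

end IsTopFamily

end AdaptedBasis

end Sub

end RestrictedLieSuperalgebra

end RestrictedSuper

end

noncomputable section

namespace RestrictedSuper

/-! ### Increasing words in two alphabets of finite size -/

section Blocks

/-- The multiplicity of a letter in a word. -/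
def mult {S : Type*} [LinearOrder S] (b : List S) (s : S) : ℕ := b.count s

theorem perm_iff_mult {S : Type*} [LinearOrder S] {b b' : List S} :
    b.Perm b' ↔ ∀ s, mult b s = mult b' s := List.perm_iff_count

theorem mult_singleton {S : Type*} [LinearOrder S] (s r : S) :
    mult [s] r = if r = s then 1 else 0 := by
  rw [mult, List.count_singleton]
  simp only [beq_iff_eq, @eq_comm _ s r]

variable {n m : ℕ}

/-- The increasing word in which the letter `i` occurs `f i` times. -/
def block (f : Fin n → ℕ) : List (Fin n) := (List.ofFn fun i => List.replicate (f i) i).flatten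

theorem block_pairwise (f : Fin n → ℕ) : (block f).Pairwise (· ≤ ·) := by
  rw [block, List.pairwise_flatten, List.pairwise_ofFn]
  refine ⟨by simp, fun i j hij x hx y hy => ?_⟩
  rw [List.eq_of_mem_replicate hx, List.eq_of_mem_replicate hy]
  exact hij.le

theorem count_block (f : Fin n → ℕ) (i : Fin n) : (block f).count i = f i := by
  rw [block, List.count_flatten, List.map_ofFn, List.sum_ofFn]
  simp [List.count_replicate]

theorem prod_map_block {M : Type*} [Monoid M] (f : Fin n → ℕ) (x : Fin n → M) :
    ((block f).map x).prod = (List.ofFn fun i => x i ^ f i).prod := by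
  rw [block, List.map_flatten, List.prod_flatten, List.map_ofFn, List.map_ofFn]
  congr 2
  funext i
  simp

theorem block_one : block (fun _ : Fin m => 1) = List.finRange m := by
  refine List.Perm.eq_of_pairwise (fun a b _ _ => le_antisymm) (block_pairwise _)
    (List.pairwise_le_finRange m) (List.perm_iff_count.2 fun i => ?_)
  rw [count_block, List.count_eq_one_of_mem (List.nodup_finRange m) (List.mem_finRange i)]

theorem joinWords_pairwise {α β : Type*} [LinearOrder α] [LinearOrder β] {a : List α} {b : List β}
    (ha : a.Pairwise (· ≤ ·)) (hb : b.Pairwise (· ≤ ·)) : (joinWords a b).Pairwise (· ≤ ·) := by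
  refine List.pairwise_append.2 ⟨?_, ?_, ?_⟩
  · rw [List.pairwise_map]; simpa using ha
  · rw [List.pairwise_map]; simpa using hb
  · intro i hi i' hi'
    obtain ⟨j, _, rfl⟩ := List.mem_map.1 hi
    obtain ⟨s, _, rfl⟩ := List.mem_map.1 hi'
    exact (Sum.Lex.inl_lt_inr j s).le

/-- The increasing word with prescribed multiplicities of the letters. -/
def mword (a : Fin n → ℕ) (α : Fin m → ℕ) : List (Fin n ⊕ₗ Fin m) := joinWords (block a) (block α)

theorem mword_pairwise (a : Fin n → ℕ) (α : Fin m → ℕ) : (mword a α).Pairwise (· ≤ ·) :=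
  joinWords_pairwise (block_pairwise a) (block_pairwise α)

theorem mult_mword_inl (a : Fin n → ℕ) (α : Fin m → ℕ) (i : Fin n) :
    mult (mword a α) (toLex (Sum.inl i)) = a i :=
  (count_joinWords_inl _ _ i).trans (count_block a i)

theorem mult_mword_inr (a : Fin n → ℕ) (α : Fin m → ℕ) (s : Fin m) :
    mult (mword a α) (toLex (Sum.inr s)) = α s :=
  (count_joinWords_inr _ _ s).trans (count_block α s)

theorem mword_eq_iff {a : Fin n → ℕ} {α : Fin m → ℕ} {b : List (Fin n ⊕ₗ Fin m)}
    (hb : b.Pairwise (· ≤ ·)) : mword a α = b ↔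
      (∀ i, a i = mult b (toLex (Sum.inl i))) ∧ ∀ s, α s = mult b (toLex (Sum.inr s)) := by
  constructor
  · rintro rfl
    exact ⟨fun i => (mult_mword_inl a α i).symm, fun s => (mult_mword_inr a α s).symm⟩
  · rintro ⟨h1, h2⟩
    refine List.Perm.eq_of_pairwise (fun a b _ _ => le_antisymm) (mword_pairwise _ _) hb
      (perm_iff_mult.2 fun i => ?_)
    induction i using sumLex_cases with
    | hl i => rw [mult_mword_inl, h1]
    | hr s => rw [mult_mword_inr, h2]

theorem mword_eq_inl_iff {a : Fin n → ℕ} {α : Fin m → ℕ} {i : Fin n} :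
    mword a α = [toLex (Sum.inl i)] ↔ (∀ j, a j = if j = i then 1 else 0) ∧ ∀ s, α s = 0 := by
  rw [mword_eq_iff (List.pairwise_singleton _ _)]
  simp [mult_singleton]

theorem mword_eq_inr_iff {a : Fin n → ℕ} {α : Fin m → ℕ} {s : Fin m} :
    mword a α = [toLex (Sum.inr s)] ↔ (∀ j, a j = 0) ∧ ∀ r, α r = if r = s then 1 else 0 := by
  rw [mword_eq_iff (List.pairwise_singleton _ _)]
  simp [mult_singleton]

theorem mword_eq_nil_iff {a : Fin n → ℕ} {α : Fin m → ℕ} :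
    mword a α = [] ↔ (∀ j, a j = 0) ∧ ∀ r, α r = 0 := by
  rw [mword_eq_iff List.Pairwise.nil]
  simp [mult]

end Blocks

/-- A superspace has a basis of homogeneous elements. -/
theorem SuperGrading.exists_basis {k : Type*} [Field k] {V : Type*} [AddCommGroup V] [Module k V]
    (G : SuperGrading k V) {I₀ I₁ : Type*} (b₀ : Module.Basis I₀ k (G.deg 0))
    (b₁ : Module.Basis I₁ k (G.deg 1)) : ∃ b : Module.Basis (I₀ ⊕ I₁) k V,
      (∀ i, b (Sum.inl i) = b₀ i) ∧ ∀ i, b (Sum.inr i) = b₁ i :=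
  ⟨(b₀.prod b₁).map (Submodule.prodEquivOfIsCompl _ _ G.isCompl),
    fun i => by simp, fun i => by simp⟩

namespace RestrictedLieSuperalgebra

namespace Sub

universe v

variable {k : Type*} [Field k] {p : ℕ} {L : Type v} [AddCommGroup L] [Module k L]
variable {g : RestrictedLieSuperalgebra k p L} (h : g.Sub)

/-! ### Bases of supplements -/

variable {h} in
/-- A basis of a supplement of `h` extends to an adapted basis. -/
theorem IsSupplementBasis.exists_adaptedBasis {n m : ℕ} {e : Fin n → L} {ε : Fin m → L}
    (hB : h.IsSupplementBasis e ε) : ∃ (J : Type v) (_ : LinearOrder J) (_ : WellFoundedLT J)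
      (A : h.AdaptedBasis J (Fin n ⊕ₗ Fin m)),
      (∀ i, A.x (toLex (Sum.inl i)) = e i) ∧ (∀ s, A.x (toLex (Sum.inr s)) = ε s) ∧
      (∀ i, A.par (toLex (Sum.inl i)) = 0) ∧ ∀ s, A.par (toLex (Sum.inr s)) = 1 := by
  let b₀ := Module.Basis.ofVectorSpace k (h.toRestricted.grading.deg 0)
  let b₁ := Module.Basis.ofVectorSpace k (h.toRestricted.grading.deg 1)
  obtain ⟨b, hb₀, hb₁⟩ := h.toRestricted.grading.exists_basis b₀ b₁
  let J := Module.Basis.ofVectorSpaceIndex k (h.toRestricted.grading.deg 0) ⊕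
    Module.Basis.ofVectorSpaceIndex k (h.toRestricted.grading.deg 1)
  obtain ⟨hJ, hJ'⟩ := exists_wellFoundedLT J
  let B : HomogeneousBasis h.toRestricted J :=
    { basis := b
      par := Sum.elim (fun _ => 0) (fun _ => 1)
      mem := by
        rintro (i | i)
        · rw [hb₀]; exact (b₀ i).2
        · rw [hb₁]; exact (b₁ i).2 }
  let c := ((Module.Basis.span hB.linearIndependent).reindex toLex)
  let w := (b.prod c).map (Submodule.prodEquivOfIsCompl _ _ hB.isCompl)
  have hw₀ : ∀ j, w (Sum.inl j) = (b j : L) := fun j => by simp [w]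
  have hw₁ : ∀ s : Fin n ⊕ₗ Fin m, w (Sum.inr s) = Sum.elim e ε (ofLex s) := fun s => by
    simp [w, c, Module.Basis.span_apply]
  let W : HomogeneousBasis g (J ⊕ (Fin n ⊕ₗ Fin m)) :=
    { basis := w
      par := Sum.elim B.par fun s => Sum.elim (fun _ => 0) (fun _ => 1) (ofLex s)
      mem := by
        rintro (j | s)
        · rw [hw₀]
          exact B.mem j
        · rw [hw₁]
          induction s using sumLex_cases with
          | hl i => exact hB.even i
          | hr s => exact hB.odd s }
  exact ⟨J, hJ, hJ', ⟨W, B, hw₀, fun _ => rfl⟩, fun i => hw₁ _, fun s => hw₁ _, fun _ => rfl,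
    fun _ => rfl⟩

/-- A subsuperalgebra of finite codimension has a supplement with a homogeneous basis. -/
theorem exists_isSupplementBasis [FiniteDimensional k (L ⧸ h.carrier)] :
    ∃ (e : Fin (Module.finrank k (h.quotGrading.deg 0)) → L)
      (ε : Fin (Module.finrank k (h.quotGrading.deg 1)) → L), h.IsSupplementBasis e ε := by
  let b₀ := Module.finBasis k (h.quotGrading.deg 0)
  let b₁ := Module.finBasis k (h.quotGrading.deg 1)
  obtain ⟨b, hb₀, hb₁⟩ := h.quotGrading.exists_basis b₀ b₁
  choose e he he' using fun i => (b₀ i).2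
  choose ε hε hε' using fun i => (b₁ i).2
  have hv : h.carrier.mkQ ∘ Sum.elim e ε = b := by
    funext i
    rcases i with i | i
    · rw [hb₀]; exact he' i
    · rw [hb₁]; exact hε' i
  have hv' : ∀ i, h.carrier.mkQ (Sum.elim e ε i) = b i := fun i => congrFun hv i
  have hli : LinearIndependent k (h.carrier.mkQ ∘ Sum.elim e ε) := by
    rw [hv]; exact b.linearIndependent
  refine ⟨e, ε, he, hε, hli.of_comp, ?_⟩
  constructor
  · rw [Submodule.disjoint_def]
    intro x hx hs
    obtain ⟨c, rfl⟩ := (Submodule.mem_span_range_iff_exists_fun k).1 hs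
    have h1 : h.carrier.mkQ (∑ i, c i • Sum.elim e ε i) = 0 :=
      (Submodule.Quotient.mk_eq_zero _).2 hx
    simp only [map_sum, map_smul, hv'] at h1
    have h2 := Fintype.linearIndependent_iff.1 b.linearIndependent c h1
    simp [h2]
  · rw [codisjoint_iff, Submodule.eq_top_iff']
    intro y
    rw [Submodule.mem_sup]
    refine ⟨y - ∑ i, b.repr (h.carrier.mkQ y) i • Sum.elim e ε i, ?_,
      ∑ i, b.repr (h.carrier.mkQ y) i • Sum.elim e ε i, ?_, sub_add_cancel _ _⟩
    · rw [← Submodule.Quotient.mk_eq_zero, ← Submodule.mkQ_apply, map_sub, map_sum]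
      simp only [map_smul, hv', b.sum_repr, sub_self]
    · exact Submodule.sum_mem _ fun i _ =>
        Submodule.smul_mem _ _ (Submodule.subset_span ⟨i, rfl⟩)

end Sub

end RestrictedLieSuperalgebra

end RestrictedSuper

end

noncomputable section

namespace RestrictedSuper

namespace RestrictedLieSuperalgebra

namespace Sub

variable {k : Type*} [Field k] {p : ℕ} {L : Type*} [AddCommGroup L] [Module k L]
variable [CharP k p] [Fact p.Prime] [Fact (2 < p)]
variable {g : RestrictedLieSuperalgebra k p L} {h : g.Sub}
variable {V : Type*} [AddCommGroup V] [Module k V] {ρ : h.toRestricted.Rep V}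

/-! ### The coordinates attached to a basis of a supplement -/

namespace AdaptedBasis

section

variable {J S : Type*} {A : h.AdaptedBasis J S} [LinearOrder S] [LinearOrder J] [WellFoundedLT J]
  [WellFoundedLT S] {t : List S} {η : S → h.Coord}

variable (A) in
theorem irr_nil : A.Irr [] :=
  ⟨List.Pairwise.nil, fun s => lt_of_lt_of_le (by simp) (A.whole.two_le_q (Sum.inr s))⟩

variable (A) in
theorem irr_singleton (s : S) : A.Irr [s] :=
  ⟨List.pairwise_singleton _ _, fun r => lt_of_le_of_lt List.count_le_length
    (lt_of_lt_of_le (by simp) (A.whole.two_le_q (Sum.inr r)))⟩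

/-- The multiples of the product of coordinates of the letters of the top word are concentrated on
the top word. -/
theorem isTopFamily_coordProd (hη : A.IsDual η) (ht : A.IsTop t) :
    A.IsTopFamily t ((h.coordProd (t.map η)).1 (A.sw t))
      fun a : k => a • h.coordProd (t.map η) := by
  intro a b hb
  change a • (h.coordProd (t.map η)).1 (A.sw b) = _
  split_ifs with hbt
  · rw [hbt, smul_eq_mul, smul_eq_mul, mul_comm]
  · have hl : b.length < t.length := by
      by_contra hcon
      exact hbt (ht.eq_of_length_le hb (by omega))
    rw [coordProd_low hη t _ (A.sw_mem_low hl), smul_zero]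

/-- The products of the coordinates of the letters of the top word with elements `hat v` taking
the value `v` at `1` are concentrated on the top word. -/
theorem isTopFamily_coindMul (hη : A.IsDual η) (ht : A.IsTop t) {hat : V → h.Coind ρ}
    (hhat : ∀ v, (hat v).1 1 = v) :
    A.IsTopFamily t ((h.coordProd (t.map η)).1 (A.sw t))
      fun v => h.coindMul ρ (h.coordProd (t.map η)) (hat v) := by
  intro v b hb
  change conv (h.coordProd (t.map η)).1 (hat v).1 (A.sw b) = _
  have hlow : ∀ u ∈ h.low t.length, (h.coordProd (t.map η)).1 u = 0 := by
    simpa using coordProd_low hη t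
  split_ifs with hbt
  · rw [hbt, A.conv_sw_left t _ hlow, hhat]
  · have hl : b.length < t.length := by
      by_contra hcon
      exact hbt (ht.eq_of_length_le hb (by omega))
    exact h.conv_eq_zero_of_low (e := 0) hlow
      (fun u hu => by rw [(Submodule.mem_bot k).1 hu, map_zero]) _ (A.sw_mem_low hl)

end

section

variable {n m : ℕ} {e : Fin n → L} {ε : Fin m → L} {J : Type*}
variable {A : h.AdaptedBasis J (Fin n ⊕ₗ Fin m)}

variable (A) in
/-- The basis of the supplement consists of the even elements `e i` and the odd elements `ε s`. -/
structure Extends (e : Fin n → L) (ε : Fin m → L) : Prop where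
  x_inl : ∀ i, A.x (toLex (Sum.inl i)) = e i
  x_inr : ∀ s, A.x (toLex (Sum.inr s)) = ε s
  par_inl : ∀ i, A.par (toLex (Sum.inl i)) = 0
  par_inr : ∀ s, A.par (toLex (Sum.inr s)) = 1

namespace Extends

theorem sw_mword (hA : A.Extends e ε) (a : Fin n → Fin p) (α : Fin m → Fin 2) :
    A.sw (mword (fun i => (a i : ℕ)) fun s => (α s : ℕ)) = g.monomial e ε a α := by
  rw [monomial, mword, sw, joinWords, List.map_append, List.prod_append, List.map_map, List.map_map,
    prod_map_block, prod_map_block]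
  simp only [Function.comp_apply, hA.x_inl, hA.x_inr]

theorem q_inl (hA : A.Extends e ε) (i : Fin n) : A.whole.q (Sum.inr (toLex (Sum.inl i))) = p :=
  if_pos (hA.par_inl i)

theorem q_inr (hA : A.Extends e ε) (s : Fin m) : A.whole.q (Sum.inr (toLex (Sum.inr s))) = 2 := by
  have h1 : A.whole.par (Sum.inr (toLex (Sum.inr s))) = 1 := hA.par_inr s
  rw [HomogeneousBasis.q, h1, if_neg one_ne_zero]

/-- The irreducible words correspond to the monomials. -/
theorem irr_iff (hA : A.Extends e ε) {b : List (Fin n ⊕ₗ Fin m)} : A.Irr b ↔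
    ∃ (a : Fin n → Fin p) (α : Fin m → Fin 2),
      mword (fun i => (a i : ℕ)) (fun s => (α s : ℕ)) = b := by
  constructor
  · intro hb
    refine ⟨fun i => ⟨mult b (toLex (Sum.inl i)), ?_⟩, fun s => ⟨mult b (toLex (Sum.inr s)), ?_⟩,
      (mword_eq_iff hb.1).2 ⟨fun i => rfl, fun s => rfl⟩⟩
    · rw [← hA.q_inl i]; exact hb.2 _
    · rw [← hA.q_inr s]; exact hb.2 _
  · rintro ⟨a, α, rfl⟩
    refine ⟨mword_pairwise _ _, fun s => ?_⟩
    change mult _ s < _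
    induction s using sumLex_cases with
    | hl i => rw [mult_mword_inl, hA.q_inl]; exact (a i).2
    | hr s => rw [mult_mword_inr, hA.q_inr]; exact (α s).2

/-- A statement about monomials, in terms of irreducible words. -/
theorem forall_irr_iff (hA : A.Extends e ε) {W : Type*} {f : g.Env → W}
    {f' : List (Fin n ⊕ₗ Fin m) → W} : (∀ b, A.Irr b → f (A.sw b) = f' b) ↔
      ∀ (a : Fin n → Fin p) (α : Fin m → Fin 2), f (g.monomial e ε a α) =
        f' (mword (fun i => (a i : ℕ)) fun s => (α s : ℕ)) := by
  constructor
  · intro hf a α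
    rw [← hA.sw_mword]
    exact hf _ (hA.irr_iff.2 ⟨a, α, rfl⟩)
  · intro hf b hb
    obtain ⟨a, α, rfl⟩ := hA.irr_iff.1 hb
    rw [hA.sw_mword, hf]

theorem isCoordinates_iff (hA : A.Extends e ε) {η : Fin n → h.Coord} {ζ : Fin m → h.Coord}
    {hat : V → h.Coind ρ} : h.IsCoordinates ρ e ε η ζ hat ↔
      (∀ s b, A.Irr b → (Sum.elim η ζ (ofLex s)).1 (A.sw b) = if b = [s] then 1 else 0) ∧
      ∀ v b, A.Irr b → (hat v).1 (A.sw b) = if b = [] then v else 0 := by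
  classical
  constructor
  · intro hc
    refine ⟨fun s => ?_, fun v => ?_⟩
    · rw [hA.forall_irr_iff (f' := fun b => if b = [s] then 1 else 0)]
      intro a α
      induction s using sumLex_cases with
      | hl i =>
        refine (hc.eta i a α).trans (if_congr ?_ rfl rfl)
        rw [mword_eq_inl_iff]
      | hr s =>
        refine (hc.zeta s a α).trans (if_congr ?_ rfl rfl)
        rw [mword_eq_inr_iff]
    · rw [hA.forall_irr_iff (f' := fun b => if b = [] then v else 0)]
      intro a α
      refine (hc.hat v a α).trans (if_congr ?_ rfl rfl)
      rw [mword_eq_nil_iff]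
  · rintro ⟨h1, h2⟩
    refine ⟨fun i a α => ?_, fun s a α => ?_, fun v a α => ?_⟩
    · refine ((hA.forall_irr_iff (f' := fun b => if b = [toLex (Sum.inl i)] then (1 : k) else 0)).1
        (h1 (toLex (Sum.inl i))) a α).trans (if_congr ?_ rfl rfl)
      rw [mword_eq_inl_iff]
    · refine ((hA.forall_irr_iff (f' := fun b => if b = [toLex (Sum.inr s)] then (1 : k) else 0)).1
        (h1 (toLex (Sum.inr s))) a α).trans (if_congr ?_ rfl rfl)
      rw [mword_eq_inr_iff]
    · refine ((hA.forall_irr_iff (f' := fun b => if b = [] then v else 0)).1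
        (h2 v) a α).trans (if_congr ?_ rfl rfl)
      rw [mword_eq_nil_iff]

variable [LinearOrder J] [WellFoundedLT J]

theorem existsUnique_isCoordinates (hA : A.Extends e ε) :
    ∃! c : (Fin n → h.Coord) × (Fin m → h.Coord) × (V → h.Coind ρ),
      h.IsCoordinates ρ e ε c.1 c.2.1 c.2.2 := by
  classical
  choose θ hθ using fun s : Fin n ⊕ₗ Fin m =>
    A.exists_coind h.toRestricted.trivialRep fun b => if b = [s] then (1 : k) else 0
  choose hat hhat using fun v : V => A.exists_coind ρ fun b => if b = [] then v else 0
  refine ⟨⟨fun i => θ (toLex (Sum.inl i)), fun s => θ (toLex (Sum.inr s)), hat⟩, ?_, ?_⟩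
  · refine hA.isCoordinates_iff.2 ⟨fun s => ?_, hhat⟩
    induction s using sumLex_cases with
    | hl i => exact hθ _
    | hr s => exact hθ _
  · rintro ⟨η', ζ', hat'⟩ hc
    replace hc := hA.isCoordinates_iff.1 hc
    refine Prod.ext (funext fun i => ?_) (Prod.ext (funext fun s => ?_) (funext fun v => ?_))
    · exact A.coind_ext _ fun b hb => (hc.1 (toLex (Sum.inl i)) b hb).trans (hθ _ b hb).symm
    · exact A.coind_ext _ fun b hb => (hc.1 (toLex (Sum.inr s)) b hb).trans (hθ _ b hb).symm
    · exact A.coind_ext _ fun b hb => (hc.2 v b hb).trans (hhat v b hb).symm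

theorem isDual (hA : A.Extends e ε) {η : Fin n → h.Coord} {ζ : Fin m → h.Coord}
    {hat : V → h.Coind ρ} (hc : h.IsCoordinates ρ e ε η ζ hat) :
    A.IsDual fun s => Sum.elim η ζ (ofLex s) := by
  have h1 := (hA.isCoordinates_iff.1 hc).1
  refine ⟨fun s u hu => ?_, fun s r => ?_⟩
  · refine A.coind_eq_zero_of_fil _ (Sum.elim η ζ (ofLex s)).2 (d := 0) (fun b hb hb0 => ?_) hu
    rw [h1 s b hb, if_neg]
    rintro rfl
    simp at hb0
  · have h2 := h1 s [r] (A.irr_singleton r)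
    rw [sw_cons, sw_nil, mul_one] at h2
    exact h2.trans (if_congr (by simp) rfl rfl)

theorem hat_one (hA : A.Extends e ε) {η : Fin n → h.Coord} {ζ : Fin m → h.Coord}
    {hat : V → h.Coind ρ} (hc : h.IsCoordinates ρ e ε η ζ hat) (v : V) : (hat v).1 1 = v := by
  simpa using (hA.isCoordinates_iff.1 hc).2 v [] A.irr_nil

theorem isTop (hA : A.Extends e ε) : A.IsTop (mword (fun _ => p - 1) fun _ => 1) := by
  refine ⟨mword_pairwise _ _, fun s => ?_⟩
  change mult _ s + 1 = _
  induction s using sumLex_cases with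
  | hl i =>
    have := (Fact.out : p.Prime).pos
    rw [mult_mword_inl, hA.q_inl]
    omega
  | hr s => rw [mult_mword_inr, hA.q_inr]

theorem wpar_top (hA : A.Extends e ε) : A.wpar (mword (fun _ => p - 1) fun _ => 1) = m := by
  have h0 : ∀ l : List (Fin n), (l.map (A.par ∘ fun i => toLex (Sum.inl i))).sum = 0 := fun l => by
    simp [Function.comp_def, hA.par_inl]
  have h1 : ∀ l : List (Fin m), (l.map (A.par ∘ fun s => toLex (Sum.inr s))).sum = l.length :=
    fun l => by simp [Function.comp_def, hA.par_inr]
  rw [mword, block_one, joinWords, wpar, List.map_append, List.sum_append, List.map_map,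
    List.map_map, h0, h1, zero_add, List.length_finRange]

theorem topCoord_eq (η : Fin n → h.Coord) (ζ : Fin m → h.Coord) :
    h.topCoord η ζ = h.coordProd ((mword (fun _ => p - 1) fun _ => 1).map
      fun s => Sum.elim η ζ (ofLex s)) := by
  rw [topCoord, mword, block_one, joinWords, List.map_append, List.map_map, List.map_map, block,
    List.map_flatten, List.map_ofFn, List.ofFn_eq_map (f := ζ)]
  congr 3
  congr 1
  funext i
  simp

end Extends

end

end AdaptedBasis

/-- The coordinates attached to a basis of a supplement, the element `Λ` and the isomorphism `Φ`. -/
theorem IsSupplementBasis.exists_equiv [FiniteDimensional k (L ⧸ h.carrier)]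
    (π : h.toRestricted.Rep V) {n m : ℕ} {e : Fin n → L} {ε : Fin m → L}
    (hB : h.IsSupplementBasis e ε) :
    (∃! c : (Fin n → h.Coord) × (Fin m → h.Coord) × (V → h.Coind π),
      h.IsCoordinates π e ε c.1 c.2.1 c.2.2) ∧
    ∀ (η : Fin n → h.Coord) (ζ : Fin m → h.Coord) (hat : V → h.Coind π),
      h.IsCoordinates π e ε η ζ hat →
      h.topCoord η ζ ≠ 0 ∧
      h.topCoord η ζ ∈ h.coindDeg h.toRestricted.trivialRep (m : ZMod 2) ∧
      (∀ H : h.carrier, g.ι (H : L) • h.topCoord η ζ = h.strad H • h.topCoord η ζ) ∧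
      ∃ Φ : h.Ind (h.twist π m) ≃ₗ[g.Env] h.Coind π, h.PreservesParity Φ ∧
        ∀ (u : g.Env) (v : V), Φ (h.indMk (h.twist π m) u ((1 : k) ⊗ₜ[k] v)) =
          u • h.coindMul π (h.topCoord η ζ) (hat v) := by
  obtain ⟨J, _, _, A, hx, hx', hp, hp'⟩ := hB.exists_adaptedBasis
  have hA : A.Extends e ε := ⟨hx, hx', hp, hp'⟩
  refine ⟨hA.existsUnique_isCoordinates, fun η ζ hat hc => ?_⟩
  have hη := hA.isDual hc
  have ht := hA.isTop
  have hc0 := AdaptedBasis.coordProd_sw_ne_zero hη ht.irr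
  have hF := AdaptedBasis.isTopFamily_coordProd hη ht
  have hF' := AdaptedBasis.isTopFamily_coindMul hη ht (hA.hat_one hc)
  rw [← AdaptedBasis.Extends.topCoord_eq η ζ] at hc0 hF hF'
  refine ⟨?_, ?_, ?_, hF'.exists_equiv ht hc0 hA.wpar_top⟩
  · intro h0
    rw [h0] at hc0
    exact hc0 rfl
  · have h1 : (1 : k) ∈ h.toRestricted.trivialRep.grading.deg 0 := by
      simp [trivialRep, SuperGrading.shifted]
    have h2 := hF.mem_coindDeg h1
    rwa [hA.wpar_top, add_zero, one_smul] at h2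
  · have key : ∀ (α : ZMod 2) (y : h.carrier), y ∈ h.toRestricted.grading.deg α →
        g.ι (y : L) • h.topCoord η ζ = h.strad y • h.topCoord η ζ := by
      intro α y hy
      have h1 := hF.ι_smul ht hy 1
      have h2 : h.toRestricted.trivialRep.act y (1 : k) = 0 := rfl
      rwa [h2, one_smul, zero_smul, smul_zero, add_zero] at h1
    intro H
    rw [← h.toRestricted.grading.proj_add H, Submodule.coe_add, map_add, add_smul,
      key 0 _ (h.toRestricted.grading.proj_mem 0 H), key 1 _ (h.toRestricted.grading.proj_mem 1 H),
      strad_add, add_smul]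

end Sub

end RestrictedLieSuperalgebra

end RestrictedSuper

end

theorem mainTheorem2 {k : Type*} [Field k] {p : ℕ} [Fact p.Prime] [Fact (2 < p)] [CharP k p]
    {L : Type*} [AddCommGroup L] [Module k L] (g : RestrictedLieSuperalgebra k p L) (h : g.Sub)
    [FiniteDimensional k (L ⧸ h.carrier)]
    (m : ℕ) (hm : m = Module.finrank k (h.quotGrading.deg 1))
    {V : Type*} [AddCommGroup V] [Module k V] (π : h.toRestricted.Rep V) :
    (∃ Φ : h.Ind (h.twist π m) ≃ₗ[g.Env] h.Coind π, h.PreservesParity Φ) ∧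
    ∀ (n : ℕ) (e : Fin n → L) (ε : Fin m → L), h.IsSupplementBasis e ε →
      (∃! c : (Fin n → h.Coord) × (Fin m → h.Coord) × (V → h.Coind π),
        h.IsCoordinates π e ε c.1 c.2.1 c.2.2) ∧
      ∀ (η : Fin n → h.Coord) (ζ : Fin m → h.Coord) (hat : V → h.Coind π),
        h.IsCoordinates π e ε η ζ hat →
        h.topCoord η ζ ≠ 0 ∧
        h.topCoord η ζ ∈ h.coindDeg h.toRestricted.trivialRep (m : ZMod 2) ∧
        (∀ H : h.carrier, g.ι (H : L) • h.topCoord η ζ = h.strad H • h.topCoord η ζ) ∧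
        ∃ Φ : h.Ind (h.twist π m) ≃ₗ[g.Env] h.Coind π, h.PreservesParity Φ ∧
          ∀ (u : g.Env) (v : V), Φ (h.indMk (h.twist π m) u ((1 : k) ⊗ₜ[k] v)) =
            u • h.coindMul π (h.topCoord η ζ) (hat v) := by
  refine ⟨?_, fun n e ε hB => hB.exists_equiv π⟩
  subst hm
  obtain ⟨e, ε, hB⟩ := h.exists_isSupplementBasis
  obtain ⟨⟨c, hc, -⟩, hmain⟩ := hB.exists_equiv π
  obtain ⟨-, -, -, Φ, hΦ, -⟩ := hmain _ _ _ hc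
  exact ⟨Φ, hΦ⟩
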